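/- Let $M$ be a connected smooth manifold of dimension $n\ge 2$ with a smooth Riemannian or pseudo-Riemannian metric $g$ and Laplacian $\Delta=|g|^{-1/2}\partial_i(|g|^{1/2}g^{ij}\partial_j)$, and let $V$ be a smooth real function on $M$. Consider the Klein–Gordon equation $H:=\Delta u+Vu=0$ and its Lagrangian $$L=\tfrac12\sqrt{|g|}\,g^{ij}u_iu_j-\tfrac12\sqrt{|g|}\,Vu^2 .$$ Let $X=\xi^i(x,u)\partial_i+\eta(x,u)\partial_u$ be a smooth vector field on $M\times\mathbb R$, with first and second prolongations $X^{[1]}$, $X^{[2]}$. Call $X$ a Lie point symmetry if, in every coordinate system, $X^{[2]}H=0$ whenever $H=0$; call $X$ a Noether point symmetry of $L$ if in every coordinate system there is a smooth gauge function $A^i(x,u)$ with $X^{[1]}L+L\,D_i\xi^i=D_iA^i$ identically in $(x,u,u_i)$, where $D_i=\partial_i+u_i\partial_u$ on functions of $(x,u)$. (i) $X$ is a Lie point symmetry if and only if there are smooth functions $\psi,b$ on $M$ and a constant $a_0$ such that $\xi=\xi(x)$ is independent of $u$ and is a conformal Killing vector with conformal factor $\psi$, i.e. $\mathcal L_\xi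 g=2\psi g$ (Killing vectors, $\psi=0$, included), $$\eta=\tfrac{2-n}{2}\,\psi u+a_0u+b,\qquad \Delta b+Vb=0,\qquad \xi^kV_{,k}+2\psi V+\tfrac{2-n}{2}\Delta\psi=0 .$$ (ii) The Noether point symmetries of $L$ are exactly the Lie point symmetries of this form with $a_0=0$: $X$ is a Noether point symmetry if and only if it is a Lie point symmetry that can be written as in (i) with $a_0=0$; and if $X$ is as in (i) with some $\psi,a_0,b$, then $X$ is a Noether point symmetry if and only if $a_0=0$. (iii) If $X$ is as in (i) with $a_0=0$, then in every coordinate system its gauge functions are exactly the functions given, with indices lowered by $g$, by $$A_i=\tfrac{2-n}{4}\sqrt{|g|}\,\psi_{,i}u^2+\sqrt{|g|}\,b_{,i}u+\Phi_i(x),$$ where the $\Phi^i=g^{ij}\Phi_j$ are smooth functions with $D_i\Phi^i=\partial_i\Phi^i=0$. -/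

import Mathlib

open scoped Manifold ContDiff

noncomputable section

namespace KleinGordon

/-- The coordinate space `ℝⁿ`. -/
abbrev Coord (n : ℕ) : Type := EuclideanSpace ℝ (Fin n)

/-- First order jets `(x, u, u_i)`, in coordinates. -/
abbrev Jet1 (n : ℕ) : Type := Coord n × ℝ × (Fin n → ℝ)

/-- Second order jets `(x, u, u_i, u_{ij})`, in coordinates.  Only jets with a symmetric last
component occur as jets of functions; this is imposed where jets are quantified over. -/
abbrev Jet2 (n : ℕ) : Type := Coord n × ℝ × (Fin n → ℝ) × (Fin n → Fin n → ℝ)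

section Coordinates

variable {n : ℕ}

/-- The `i`-th coordinate vector. -/
def basisVec (i : Fin n) : Coord n := EuclideanSpace.single i (1 : ℝ)

/-- `∂f/∂xⁱ` for a function of `x`. -/
def pd (i : Fin n) (f : Coord n → ℝ) (x : Coord n) : ℝ := fderiv ℝ f x (basisVec i)

/-- `∂f/∂xⁱ` for a function of `(x, u)`. -/
def dX (i : Fin n) (f : Coord n × ℝ → ℝ) (z : Coord n × ℝ) : ℝ := fderiv ℝ f z (basisVec i, 0)

/-- `∂f/∂u` for a function of `(x, u)`. -/
def dU (f : Coord n × ℝ → ℝ) (z : Coord n × ℝ) : ℝ := fderiv ℝ f z (0, 1)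

/-- The total derivative `D_i f = ∂f/∂xⁱ + u_i ∂f/∂u` of a function of `(x, u)`. -/
def totalD (i : Fin n) (f : Coord n × ℝ → ℝ) (j : Jet1 n) : ℝ :=
  dX i f (j.1, j.2.1) + j.2.2 i * dU f (j.1, j.2.1)

/-- The first prolongation coefficients
`η_i = η_{,i} + u_i η_{,u} - ξʲ_{,i} u_j - u_i u_j ξʲ_{,u}`. -/
def eta1 (ξ : Coord n × ℝ → Coord n) (η : Coord n × ℝ → ℝ) (j : Jet1 n) (i : Fin n) : ℝ :=
  let z : Coord n × ℝ := (j.1, j.2.1)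
  let p := j.2.2
  dX i η z + p i * dU η z - ∑ k, dX i (fun w => ξ w k) z * p k
    - ∑ k, p i * p k * dU (fun w => ξ w k) z

/-- The second prolongation coefficients `η_{ij}`. -/
def eta2 (ξ : Coord n × ℝ → Coord n) (η : Coord n × ℝ → ℝ) (J : Jet2 n) (i j : Fin n) : ℝ :=
  let z : Coord n × ℝ := (J.1, J.2.1)
  let p := J.2.2.1
  let q := J.2.2.2
  dX i (dX j η) z
    + (dX i (dU η) z * p j + dX j (dU η) z * p i)
    - ∑ k, dX i (dX j (fun w => ξ w k)) z * p k
    + dU (dU η) z * p i * p j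
    - ∑ k, (dX i (dU (fun w => ξ w k)) z * p j + dX j (dU (fun w => ξ w k)) z * p i) * p k
    - ∑ k, dU (dU (fun w => ξ w k)) z * p i * p j * p k
    + dU η z * q i j
    - ∑ k, (dX j (fun w => ξ w k) z * q i k + dX i (fun w => ξ w k) z * q j k)
    - ∑ k, dU (fun w => ξ w k) z * (p k * q i j + p j * q i k + p i * q j k)

/-- The derivative `X^{[1]} F` of a function on first order jets along the first prolongation of
`X = ξⁱ ∂_i + η ∂_u`. -/
def prolong1 (ξ : Coord n × ℝ → Coord n) (η : Coord n × ℝ → ℝ) (F : Jet1 n → ℝ)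
    (j : Jet1 n) : ℝ :=
  fderiv ℝ F j (ξ (j.1, j.2.1), η (j.1, j.2.1), eta1 ξ η j)

/-- The derivative `X^{[2]} F` of a function on second order jets along the second prolongation
of `X = ξⁱ ∂_i + η ∂_u`. -/
def prolong2 (ξ : Coord n × ℝ → Coord n) (η : Coord n × ℝ → ℝ) (F : Jet2 n → ℝ)
    (J : Jet2 n) : ℝ :=
  fderiv ℝ F J (ξ (J.1, J.2.1), η (J.1, J.2.1), eta1 ξ η (J.1, J.2.1, J.2.2.1), eta2 ξ η J)

/-- `√|g|` for a matrix `G x = (g_{ij}(x))` of metric components. -/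
def sqrtDet (G : Coord n → Matrix (Fin n) (Fin n) ℝ) (x : Coord n) : ℝ := √|(G x).det|

/-- The Laplacian `Δf = |g|^{-1/2} ∂_i (|g|^{1/2} g^{ij} ∂_j f)`. -/
def laplacian (G : Coord n → Matrix (Fin n) (Fin n) ℝ) (f : Coord n → ℝ) (x : Coord n) : ℝ :=
  (sqrtDet G x)⁻¹ * ∑ i, pd i (fun y => sqrtDet G y * ∑ j, (G y)⁻¹ i j * pd j f y) x

/-- The Klein-Gordon equation `Δu + V u = 0` as a function `H` on second order jets: the
Laplacian is expanded as `g^{ij} u_{ij} + |g|^{-1/2} ∂_i (|g|^{1/2} g^{ij}) u_j`. -/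
def kgEquation (G : Coord n → Matrix (Fin n) (Fin n) ℝ) (W : Coord n → ℝ) (J : Jet2 n) : ℝ :=
  ∑ i, ∑ j, (G J.1)⁻¹ i j * J.2.2.2 i j
    + ∑ j, ((sqrtDet G J.1)⁻¹ * ∑ i, pd i (fun y => sqrtDet G y * (G y)⁻¹ i j) J.1) * J.2.2.1 j
    + W J.1 * J.2.1

/-- The Klein-Gordon Lagrangian `L = ½ √|g| g^{ij} u_i u_j - ½ √|g| V u²` on first order jets. -/
def kgLagrangian (G : Coord n → Matrix (Fin n) (Fin n) ℝ) (W : Coord n → ℝ) (j : Jet1 n) : ℝ :=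
  1 / 2 * sqrtDet G j.1 * ∑ i, ∑ k, (G j.1)⁻¹ i k * j.2.2 i * j.2.2 k
    - 1 / 2 * sqrtDet G j.1 * W j.1 * j.2.1 ^ 2

/-- The components `(𝓛_ξ g)_{ij} = ξᵏ ∂_k g_{ij} + g_{kj} ∂_i ξᵏ + g_{ik} ∂_j ξᵏ` of the Lie
derivative of the metric. -/
def lieDerivMetric (G : Coord n → Matrix (Fin n) (Fin n) ℝ) (ξ : Coord n → Coord n)
    (x : Coord n) (i j : Fin n) : ℝ :=
  ∑ k, (ξ x k * pd k (fun y => G y i j) x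
    + G x k j * pd i (fun y => ξ y k) x + G x i k * pd j (fun y => ξ y k) x)

end Coordinates

section Manifold

variable (n : ℕ) (M : Type*) [TopologicalSpace M] [ChartedSpace (Coord n) M]
  [IsManifold (𝓡 n) ∞ M]

/-- A smooth pseudo-Riemannian metric (of any signature; Riemannian metrics are included). -/
structure PseudoRiemannianMetric where
  /-- the bilinear form on the tangent space at `x` -/
  inner (x : M) : TangentSpace (𝓡 n) x →L[ℝ] TangentSpace (𝓡 n) x →L[ℝ] ℝ
  symm (x : M) (v w : TangentSpace (𝓡 n) x) : inner x v w = inner x w v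
  nondegenerate (x : M) (v : TangentSpace (𝓡 n) x) (hv : ∀ w, inner x v w = 0) : v = 0
  contMDiff : ContMDiff (𝓡 n) ((𝓡 n).prod 𝓘(ℝ, Coord n →L[ℝ] Coord n →L[ℝ] ℝ)) ∞
    (fun x ↦ Bundle.TotalSpace.mk' (Coord n →L[ℝ] Coord n →L[ℝ] ℝ)
      (E := fun x : M ↦ TangentSpace (𝓡 n) x →L[ℝ] TangentSpace (𝓡 n) x →L[ℝ] ℝ) x (inner x))

/-- A smooth generator `X = ξⁱ(x, u) ∂_i + η(x, u) ∂_u` of point transformations: a smooth vector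
field on `M × ℝ`. -/
structure PointGenerator where
  /-- the component along `M` -/
  ξ (x : M) (u : ℝ) : TangentSpace (𝓡 n) x
  /-- the component along `ℝ` -/
  η : M → ℝ → ℝ
  contMDiff_ξ : ContMDiff ((𝓡 n).prod 𝓘(ℝ, ℝ)) (𝓡 n).tangent ∞
    (fun z : M × ℝ ↦ (⟨z.1, ξ z.1 z.2⟩ : TangentBundle (𝓡 n) M))
  contMDiff_η : ContMDiff ((𝓡 n).prod 𝓘(ℝ, ℝ)) 𝓘(ℝ, ℝ) ∞ (fun z : M × ℝ ↦ η z.1 z.2)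

variable {n M}

/-- The smooth charts (local coordinate systems) of `M`. -/
abbrev smoothCharts (n : ℕ) (M : Type*) [TopologicalSpace M] [ChartedSpace (Coord n) M] :
    Set (OpenPartialHomeomorph M (Coord n)) :=
  IsManifold.maximalAtlas (𝓡 n) ∞ M

/-- The coordinate vector field `∂_i` of the chart `e`, at the point with coordinates `y`. -/
def coordVec (e : OpenPartialHomeomorph M (Coord n)) (y : Coord n) (i : Fin n) :
    TangentSpace (𝓡 n) (e.symm y) :=
  mfderiv (𝓡 n) (𝓡 n) e.symm y (basisVec i : Coord n)

/-- The components of a tangent vector at `x` in the chart `e`. -/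
def vecComp (e : OpenPartialHomeomorph M (Coord n)) (x : M) (v : TangentSpace (𝓡 n) x) :
    Coord n :=
  mfderiv (𝓡 n) (𝓡 n) e x v

/-- The components `g_{ij}` of the metric in the chart `e`. -/
def PseudoRiemannianMetric.comp (g : PseudoRiemannianMetric n M)
    (e : OpenPartialHomeomorph M (Coord n)) (y : Coord n) : Matrix (Fin n) (Fin n) ℝ :=
  Matrix.of fun i j => g.inner (e.symm y) (coordVec e y i) (coordVec e y j)

/-- The components `ξⁱ(x, u)` of a generator in the chart `e`. -/
def PointGenerator.ξComp (X : PointGenerator n M) (e : OpenPartialHomeomorph M (Coord n))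
    (z : Coord n × ℝ) : Coord n :=
  vecComp e (e.symm z.1) (X.ξ (e.symm z.1) z.2)

/-- The component `η(x, u)` of a generator in the chart `e`. -/
def PointGenerator.ηComp (X : PointGenerator n M) (e : OpenPartialHomeomorph M (Coord n))
    (z : Coord n × ℝ) : ℝ :=
  X.η (e.symm z.1) z.2

/-- `X` is a Lie point symmetry of `Δu + V u = 0`: in every coordinate system, `X^{[2]} H = 0`
at all second order jets with `H = 0`. -/
def IsLieSymmetry (g : PseudoRiemannianMetric n M) (V : M → ℝ) (X : PointGenerator n M) : Prop :=
  ∀ e ∈ smoothCharts n M, ∀ y ∈ e.target, ∀ (u : ℝ) (p : Fin n → ℝ) (q : Fin n → Fin n → ℝ),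
    (∀ i j, q i j = q j i) →
    kgEquation (g.comp e) (V ∘ e.symm) (y, u, p, q) = 0 →
    prolong2 (X.ξComp e) (X.ηComp e) (kgEquation (g.comp e) (V ∘ e.symm)) (y, u, p, q) = 0

/-- `A = (Aⁱ(x, u))` is a gauge function for `X` in the coordinates `e`: the Noether condition
`X^{[1]} L + L D_i ξⁱ = D_i Aⁱ` holds identically in `(x, u, u_i)`. -/
structure IsGauge (g : PseudoRiemannianMetric n M) (V : M → ℝ) (X : PointGenerator n M)
    (e : OpenPartialHomeomorph M (Coord n)) (A : Coord n × ℝ → Fin n → ℝ) : Prop where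
  smooth : ContDiffOn ℝ ∞ A (e.target ×ˢ Set.univ)
  noether : ∀ y ∈ e.target, ∀ (u : ℝ) (p : Fin n → ℝ),
    prolong1 (X.ξComp e) (X.ηComp e) (kgLagrangian (g.comp e) (V ∘ e.symm)) (y, u, p)
      + kgLagrangian (g.comp e) (V ∘ e.symm) (y, u, p)
          * ∑ i, totalD i (fun z => X.ξComp e z i) (y, u, p)
      = ∑ i, totalD i (fun z => A z i) (y, u, p)

/-- `X` is a Noether point symmetry of the Klein-Gordon Lagrangian: in every coordinate system
it has a gauge function. -/
def IsNoetherSymmetry (g : PseudoRiemannianMetric n M) (V : M → ℝ) (X : PointGenerator n M) :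
    Prop :=
  ∀ e ∈ smoothCharts n M, ∃ A : Coord n × ℝ → Fin n → ℝ, IsGauge g V X e A

/-- The vector field `ξ` on `M` is a conformal Killing vector with conformal factor `ψ`:
`𝓛_ξ g = 2 ψ g`. Killing vectors (`ψ = 0`) are included. -/
def IsConformalKilling (g : PseudoRiemannianMetric n M) (ξ : ∀ x : M, TangentSpace (𝓡 n) x)
    (ψ : M → ℝ) : Prop :=
  ∀ e ∈ smoothCharts n M, ∀ y ∈ e.target, ∀ i j,
    lieDerivMetric (g.comp e) (fun z => vecComp e (e.symm z) (ξ (e.symm z))) y i j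
      = 2 * ψ (e.symm y) * g.comp e y i j

/-- `b` is a solution of the Klein-Gordon equation `Δb + V b = 0`. -/
def IsSolution (g : PseudoRiemannianMetric n M) (V b : M → ℝ) : Prop :=
  ∀ e ∈ smoothCharts n M, ∀ y ∈ e.target,
    laplacian (g.comp e) (b ∘ e.symm) y + V (e.symm y) * b (e.symm y) = 0

/-- `X = ξⁱ(x) ∂_i + ((2-n)/2 ψ u + a₀ u + b) ∂_u`, with `ξ` a conformal Killing vector with
conformal factor `ψ`, with `b` a solution of the Klein-Gordon equation, and with
`ξᵏ V_{,k} + 2 ψ V + (2-n)/2 Δψ = 0`. -/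
structure IsConformalGenerator (g : PseudoRiemannianMetric n M) (V : M → ℝ)
    (X : PointGenerator n M) (ψ : M → ℝ) (a₀ : ℝ) (b : M → ℝ) : Prop where
  smooth_ψ : ContMDiff (𝓡 n) 𝓘(ℝ, ℝ) ∞ ψ
  smooth_b : ContMDiff (𝓡 n) 𝓘(ℝ, ℝ) ∞ b
  ξ_indep : ∀ x u, X.ξ x u = X.ξ x 0
  conformal : IsConformalKilling g (fun x => X.ξ x 0) ψ
  η_eq : ∀ x u, X.η x u = (2 - (n : ℝ)) / 2 * ψ x * u + a₀ * u + b x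
  solution : IsSolution g V b
  constraint : ∀ e ∈ smoothCharts n M, ∀ y ∈ e.target,
    ∑ k, X.ξComp e (y, 0) k * pd k (V ∘ e.symm) y + 2 * ψ (e.symm y) * V (e.symm y)
      + (2 - (n : ℝ)) / 2 * laplacian (g.comp e) (ψ ∘ e.symm) y = 0

end Manifold

end KleinGordon

end

/-!
# Lie and Noether point symmetries of the Klein-Gordon equation

Everything is a computation in one coordinate chart, followed by a gluing argument.

**Lie symmetries.** On a fixed first order jet `(x, u, u_i)` both `H` and `X^{[2]} H` are affine
functions of the symmetric matrix `u_{ij}`, so `X^{[2]} H = 0` on `H = 0` means `X^{[2]} H = m H`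
with a multiplier `m(x, u, u_i)` (`exists_multiplier`). The coefficient of `u_{ij}` in this identity
contains the symmetrization of `uⁱ ∂ξʲ/∂u`, which would have to be a multiple of `g^{ij}`; in
dimension at least two, rank considerations give `∂ξ/∂u = 0` (`eq_zero_of_rank_one`). What remains
of the coefficient is the conformal Killing equation for `g⁻¹`
(`IsLieSymmetryOn.second_order`, `IsMetricOn.conformal_iff_inv`).
For a conformal Killing vector the Lie derivative of the first order coefficients
`|g|^{-1/2} ∂_i (|g|^{1/2} g^{ij})` of the Laplacian can be computed in closed form
(`IsMetricOn.fderiv_drift_of_conformal`), and `X^{[2]} H` becomes a multiple of `H` plus a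
polynomial of degree two in `u_i` (`prolong2_of_conformal`). This polynomial vanishes if and only if
`η = σ u + b` with `dσ = (2 - n) / 2 dψ`, `Δb + V b = 0` and the constraint on `V` holds.

**Noether symmetries.** The Noether condition is a polynomial of degree three in `u_i`
(`noether_lhs_eq`). Its cubic part `g(p, p) ⟨∂ξ/∂u, p⟩` forces `∂ξ/∂u = 0` (`eq_zero_of_cubic`); its
quadratic part is the conformal Killing equation together with `∂η/∂u = (2 - n) / 2 ψ`, which is
where `a₀ = 0` comes from (`IsGaugeOn.conformal`); its linear part determines `∂Aⁱ/∂u`, so that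
`Aⁱ` is obtained by an integration in `u`; and its constant part says that the divergence of the
integration constants `Φⁱ` vanishes (`isGaugeOn_iff_of_conformal`,
`IsConformalOn.isGaugeOn_iff`).

**Gluing.** The conformal factor of `ξ` in a chart is `(2n)⁻¹ g^{ij} (𝓛_ξ g)_{ij}`. Since `𝓛_ξ g` is
a tensor (`lieDerivMetric_comp`), these local factors define a smooth function `ψ` on `M`. Then
`σ - (2 - n) / 2 ψ` is a function on `M` with vanishing differential, hence a constant `a₀`, because
`M` is connected (`exists_isConformalGenerator`).
-/

noncomputable section

namespace KleinGordon

variable {n : ℕ}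

/-! ### Partial derivatives in coordinates -/

lemma fderiv_eq_sum_pd (f : Coord n → ℝ) (x v : Coord n) :
    fderiv ℝ f x v = ∑ k, v k * pd k f x := by
  have hv : v = ∑ k, v k • basisVec k := by
    have := (EuclideanSpace.basisFun (Fin n) ℝ).sum_repr v
    simpa [basisVec] using this.symm
  conv_lhs => rw [hv]
  simp [map_sum, pd]

lemma contDiffOn_fderiv_apply {E F : Type*} [NormedAddCommGroup E] [NormedSpace ℝ E]
    [NormedAddCommGroup F] [NormedSpace ℝ F] {f : E → F} {U : Set E} (hU : IsOpen U)
    (hf : ContDiffOn ℝ ∞ f U) (v : E) : ContDiffOn ℝ ∞ (fun x => fderiv ℝ f x v) U :=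
  (hf.fderiv_of_isOpen hU (m := ∞) (by simp)).clm_apply contDiffOn_const

lemma contDiffOn_pd {f : Coord n → ℝ} {U : Set (Coord n)} (hf : ContDiffOn ℝ ∞ f U)
    (hU : IsOpen U) (i : Fin n) : ContDiffOn ℝ ∞ (pd i f) U :=
  contDiffOn_fderiv_apply hU hf _

lemma contDiffOn_dU {f : Coord n × ℝ → ℝ} {U : Set (Coord n × ℝ)} (hf : ContDiffOn ℝ ∞ f U)
    (hU : IsOpen U) : ContDiffOn ℝ ∞ (dU f) U :=
  contDiffOn_fderiv_apply hU hf _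

lemma differentiableAt_of_contDiffOn {E F : Type*} [NormedAddCommGroup E] [NormedSpace ℝ E]
    [NormedAddCommGroup F] [NormedSpace ℝ F] {f : E → F} {U : Set E} (hf : ContDiffOn ℝ ∞ f U)
    (hU : IsOpen U) {x : E} (hx : x ∈ U) : DifferentiableAt ℝ f x :=
  (hf.contDiffAt (hU.mem_nhds hx)).differentiableAt (by simp)

lemma fderiv_congr_on {E : Type*} [NormedAddCommGroup E] [NormedSpace ℝ E] {f g : E → ℝ}
    {U : Set E} (hU : IsOpen U) (h : ∀ y ∈ U, f y = g y) {x : E} (hx : x ∈ U) :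
    fderiv ℝ f x = fderiv ℝ g x :=
  Filter.EventuallyEq.fderiv_eq (Filter.eventuallyEq_of_mem (hU.mem_nhds hx) h)

lemma pd_congr_on {f g : Coord n → ℝ} {U : Set (Coord n)} (hU : IsOpen U)
    (h : ∀ y ∈ U, f y = g y) {x : Coord n} (hx : x ∈ U) (i : Fin n) : pd i f x = pd i g x := by
  rw [pd, pd, fderiv_congr_on hU h hx]

lemma pd_add {f g : Coord n → ℝ} {x : Coord n} (hf : DifferentiableAt ℝ f x)
    (hg : DifferentiableAt ℝ g x) (i : Fin n) :
    pd i (fun y => f y + g y) x = pd i f x + pd i g x := by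
  simp only [pd]; rw [fderiv_fun_add hf hg]; rfl

lemma pd_sub {f g : Coord n → ℝ} {x : Coord n} (hf : DifferentiableAt ℝ f x)
    (hg : DifferentiableAt ℝ g x) (i : Fin n) :
    pd i (fun y => f y - g y) x = pd i f x - pd i g x := by
  simp only [pd]; rw [fderiv_fun_sub hf hg]; rfl

lemma pd_mul {f g : Coord n → ℝ} {x : Coord n} (hf : DifferentiableAt ℝ f x)
    (hg : DifferentiableAt ℝ g x) (i : Fin n) :
    pd i (fun y => f y * g y) x = f x * pd i g x + pd i f x * g x := by
  simp only [pd]; rw [fderiv_fun_mul hf hg]; simp; ring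

lemma fderiv_mul_apply {E : Type*} [NormedAddCommGroup E] [NormedSpace ℝ E] {f g : E → ℝ}
    {x : E} (hf : DifferentiableAt ℝ f x) (hg : DifferentiableAt ℝ g x) (v : E) :
    fderiv ℝ (fun y => f y * g y) x v = f x * fderiv ℝ g x v + fderiv ℝ f x v * g x := by
  rw [fderiv_fun_mul hf hg]; simp; ring

lemma pd_sum {ι : Type*} {s : Finset ι} {f : ι → Coord n → ℝ} {x : Coord n}
    (hf : ∀ a ∈ s, DifferentiableAt ℝ (f a) x) (i : Fin n) :
    pd i (fun y => ∑ a ∈ s, f a y) x = ∑ a ∈ s, pd i (f a) x := by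
  simp only [pd]; rw [fderiv_fun_sum hf]; simp

lemma pd_const_mul {f : Coord n → ℝ} {x : Coord n} (hf : DifferentiableAt ℝ f x) (c : ℝ)
    (i : Fin n) : pd i (fun y => c * f y) x = c * pd i f x := by
  simp only [pd]; rw [fderiv_const_mul hf]; rfl

lemma pd_pd_comm {f : Coord n → ℝ} {U : Set (Coord n)} (hU : IsOpen U)
    (hf : ContDiffOn ℝ ∞ f U) {x : Coord n} (hx : x ∈ U) (i j : Fin n) :
    pd i (pd j f) x = pd j (pd i f) x := by
  have hc : ContDiffAt ℝ ∞ f x := hf.contDiffAt (hU.mem_nhds hx)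
  have hs : IsSymmSndFDerivAt ℝ f x :=
    hc.isSymmSndFDerivAt (by simpa using WithTop.coe_le_coe.2 (le_top (a := (2 : ℕ∞))))
  have hd : DifferentiableAt ℝ (fderiv ℝ f) x :=
    differentiableAt_of_contDiffOn (hf.fderiv_of_isOpen hU (m := ∞) (by simp)) hU hx
  have key : ∀ a b : Fin n, pd a (pd b f) x = fderiv ℝ (fderiv ℝ f) x (basisVec a) (basisVec b) := by
    intro a b
    have : pd b f = fun y => fderiv ℝ f y (basisVec b) := rfl
    rw [pd, this, fderiv_clm_apply hd (differentiableAt_const _)]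
    simp
  rw [key, key]; exact hs.eq _ _

/-- The derivative of a function which is polynomial of degree at most two in `u`. -/
lemma fderiv_quadratic_apply {F : Coord n × ℝ → ℝ} {a σ b : Coord n → ℝ} {U : Set (Coord n)}
    (hU : IsOpen U) (hF : ∀ y ∈ U, ∀ u, F (y, u) = a y * u ^ 2 + σ y * u + b y) {y : Coord n}
    (hy : y ∈ U) (ha : DifferentiableAt ℝ a y) (hσ : DifferentiableAt ℝ σ y)
    (hb : DifferentiableAt ℝ b y) (u : ℝ) (v : Coord n × ℝ) :
    fderiv ℝ F (y, u) v = fderiv ℝ a y v.1 * u ^ 2 + fderiv ℝ σ y v.1 * u + fderiv ℝ b y v.1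
      + (2 * a y * u + σ y) * v.2 := by
  have h1 : F =ᶠ[nhds (y, u)] fun z => a z.1 * z.2 ^ 2 + σ z.1 * z.2 + b z.1 := by
    filter_upwards [(hU.preimage continuous_fst).mem_nhds (show (y, u).1 ∈ U from hy)] with z hz
    exact hF z.1 hz z.2
  rw [h1.fderiv_eq]
  have hfst : HasFDerivAt (fun z : Coord n × ℝ => z.1) (ContinuousLinearMap.fst ℝ (Coord n) ℝ)
    (y, u) := hasFDerivAt_fst
  have hsnd : HasFDerivAt (fun z : Coord n × ℝ => z.2) (ContinuousLinearMap.snd ℝ (Coord n) ℝ)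
    (y, u) := hasFDerivAt_snd
  have hc : ∀ f : Coord n → ℝ, DifferentiableAt ℝ f y → HasFDerivAt (fun z : Coord n × ℝ => f z.1)
      ((fderiv ℝ f y).comp (ContinuousLinearMap.fst ℝ (Coord n) ℝ)) (y, u) := fun f hf =>
    HasFDerivAt.comp (y, u) (f := fun z : Coord n × ℝ => z.1) (g := f) hf.hasFDerivAt hfst
  have h2 : HasFDerivAt (fun z : Coord n × ℝ => a z.1 * z.2 ^ 2 + σ z.1 * z.2 + b z.1) _ (y, u) :=
    (((hc a ha).mul (hsnd.pow 2)).add ((hc σ hσ).mul hsnd)).add (hc b hb)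
  rw [h2.fderiv]
  simp
  ring

lemma dX_quadratic {F : Coord n × ℝ → ℝ} {a σ b : Coord n → ℝ} {U : Set (Coord n)}
    (hU : IsOpen U) (hF : ∀ y ∈ U, ∀ u, F (y, u) = a y * u ^ 2 + σ y * u + b y) {y : Coord n}
    (hy : y ∈ U) (ha : DifferentiableAt ℝ a y) (hσ : DifferentiableAt ℝ σ y)
    (hb : DifferentiableAt ℝ b y) (u : ℝ) (i : Fin n) :
    dX i F (y, u) = pd i a y * u ^ 2 + pd i σ y * u + pd i b y := by
  rw [dX, fderiv_quadratic_apply hU hF hy ha hσ hb]; simp [pd]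

lemma dU_quadratic {F : Coord n × ℝ → ℝ} {a σ b : Coord n → ℝ} {U : Set (Coord n)}
    (hU : IsOpen U) (hF : ∀ y ∈ U, ∀ u, F (y, u) = a y * u ^ 2 + σ y * u + b y) {y : Coord n}
    (hy : y ∈ U) (ha : DifferentiableAt ℝ a y) (hσ : DifferentiableAt ℝ σ y)
    (hb : DifferentiableAt ℝ b y) (u : ℝ) :
    dU F (y, u) = 2 * a y * u + σ y := by
  rw [dU, fderiv_quadratic_apply hU hF hy ha hσ hb]; simp

lemma dX_affine {F : Coord n × ℝ → ℝ} {σ b : Coord n → ℝ} {U : Set (Coord n)}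
    (hU : IsOpen U) (hF : ∀ y ∈ U, ∀ u, F (y, u) = σ y * u + b y) {y : Coord n}
    (hy : y ∈ U) (hσ : DifferentiableAt ℝ σ y) (hb : DifferentiableAt ℝ b y) (u : ℝ) (i : Fin n) :
    dX i F (y, u) = pd i σ y * u + pd i b y := by
  rw [dX_quadratic (a := fun _ => 0) hU (fun y hy u => by rw [hF y hy u]; ring) hy
    (differentiableAt_const _) hσ hb]
  simp [pd]

lemma dU_affine {F : Coord n × ℝ → ℝ} {σ b : Coord n → ℝ} {U : Set (Coord n)}
    (hU : IsOpen U) (hF : ∀ y ∈ U, ∀ u, F (y, u) = σ y * u + b y) {y : Coord n}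
    (hy : y ∈ U) (hσ : DifferentiableAt ℝ σ y) (hb : DifferentiableAt ℝ b y) (u : ℝ) :
    dU F (y, u) = σ y := by
  rw [dU_quadratic (a := fun _ => 0) hU (fun y hy u => by rw [hF y hy u]; ring) hy
    (differentiableAt_const _) hσ hb]
  simp

lemma dX_indep {F : Coord n × ℝ → ℝ} {b : Coord n → ℝ} {U : Set (Coord n)}
    (hU : IsOpen U) (hF : ∀ y ∈ U, ∀ u, F (y, u) = b y) {y : Coord n}
    (hy : y ∈ U) (hb : DifferentiableAt ℝ b y) (u : ℝ) (i : Fin n) :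
    dX i F (y, u) = pd i b y := by
  rw [dX_affine (σ := fun _ => 0) hU (fun y hy u => by rw [hF y hy u]; ring) hy
    (differentiableAt_const _) hb]
  simp [pd]

lemma dU_indep {F : Coord n × ℝ → ℝ} {b : Coord n → ℝ} {U : Set (Coord n)}
    (hU : IsOpen U) (hF : ∀ y ∈ U, ∀ u, F (y, u) = b y) {y : Coord n}
    (hy : y ∈ U) (hb : DifferentiableAt ℝ b y) (u : ℝ) :
    dU F (y, u) = 0 := by
  rw [dU_affine (σ := fun _ => 0) hU (fun y hy u => by rw [hF y hy u]; ring) hy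
    (differentiableAt_const _) hb]

lemma hasDerivAt_dU {F : Coord n × ℝ → ℝ} {y : Coord n} {u : ℝ}
    (hF : DifferentiableAt ℝ F (y, u)) : HasDerivAt (fun t => F (y, t)) (dU F (y, u)) u := by
  have h1 : HasDerivAt (fun t : ℝ => (y, t)) ((0 : Coord n), (1 : ℝ)) u :=
    (hasDerivAt_const u y).prodMk (hasDerivAt_id u)
  exact HasFDerivAt.comp_hasDerivAt (f := fun t : ℝ => (y, t)) u hF.hasFDerivAt h1

/-- Integration in `u` of a function whose `u`-derivative is affine in `u`. -/
lemma eq_quadratic_of_dU {F : Coord n × ℝ → ℝ} {y : Coord n} {a σ : ℝ}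
    (hF : ∀ u, DifferentiableAt ℝ F (y, u)) (h : ∀ u, dU F (y, u) = 2 * a * u + σ) (u : ℝ) :
    F (y, u) = a * u ^ 2 + σ * u + F (y, 0) := by
  have hd : ∀ t, HasDerivAt (fun t => F (y, t) - (a * t ^ 2 + σ * t)) 0 t := by
    intro t
    have h2 : HasDerivAt (fun t : ℝ => a * t ^ 2 + σ * t) (2 * a * t + σ) t := by
      have := ((hasDerivAt_pow 2 t).const_mul a).add ((hasDerivAt_id t).const_mul σ)
      refine this.congr_deriv ?_
      simp; ring
    have := (hasDerivAt_dU (hF t)).sub h2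
    rw [h t, sub_self] at this
    exact this
  have := is_const_of_deriv_eq_zero (fun t => (hd t).differentiableAt) (fun t => (hd t).deriv) u 0
  simp at this
  linarith

/-! ### Metrics in coordinates -/

/-- The components of a smooth pseudo-Riemannian metric on an open set of coordinate space. -/
structure IsMetricOn (G : Coord n → Matrix (Fin n) (Fin n) ℝ) (U : Set (Coord n)) : Prop where
  isOpen : IsOpen U
  smooth : ∀ i j, ContDiffOn ℝ ∞ (fun y => G y i j) U
  symm : ∀ y ∈ U, (G y).IsSymm
  det_ne : ∀ y ∈ U, (G y).det ≠ 0

lemma contDiffOn_det {E ι : Type*} [NormedAddCommGroup E] [NormedSpace ℝ E] [Fintype ι]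
    [DecidableEq ι] {A : E → Matrix ι ι ℝ} {U : Set E}
    (hA : ∀ i j, ContDiffOn ℝ ∞ (fun y => A y i j) U) :
    ContDiffOn ℝ ∞ (fun y => (A y).det) U := by
  simp only [Matrix.det_apply]
  refine ContDiffOn.sum fun σ _ => ContDiffOn.const_smul _ ?_
  exact contDiffOn_prod fun i _ => hA _ _

/-- The derivative of the determinant at an invertible matrix (Jacobi's formula). -/
lemma fderiv_det_apply {E : Type*} [NormedAddCommGroup E] [NormedSpace ℝ E] {ι : Type*} [Fintype ι]
    [DecidableEq ι] {A : E → Matrix ι ι ℝ} {U : Set E} (hU : IsOpen U)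
    (hA : ∀ i j, ContDiffOn ℝ ∞ (fun y => A y i j) U) {y : E} (hy : y ∈ U)
    (hdet : (A y).det ≠ 0) (v : E) :
    fderiv ℝ (fun y => (A y).det) y v
      = (A y).det * ((A y)⁻¹ * Matrix.of fun i j => fderiv ℝ (fun z => A z i j) y v).trace := by
  -- `det` is smooth on the space of matrices, here encoded as functions of two indices, and its
  -- derivative is computed along the line `A y + t D`
  set D : Matrix ι ι ℝ := Matrix.of fun i j => fderiv ℝ (fun z => A z i j) y v with hD
  let d : (ι → ι → ℝ) → ℝ := fun B => (Matrix.of B).det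
  have hd : DifferentiableAt ℝ d (A y) := by
    have : ContDiffOn ℝ ∞ d Set.univ := contDiffOn_det (A := fun B : ι → ι → ℝ => Matrix.of B)
      (fun i j => ((contDiff_apply_apply ℝ ℝ i j).contDiffOn))
    exact differentiableAt_of_contDiffOn this isOpen_univ (Set.mem_univ _)
  have hAd : HasFDerivAt (fun z i j => A z i j)
      (ContinuousLinearMap.pi fun i => ContinuousLinearMap.pi fun j =>
        fderiv ℝ (fun z => A z i j) y) y := by
    refine hasFDerivAt_pi.2 fun i => hasFDerivAt_pi.2 fun j => ?_
    exact (differentiableAt_of_contDiffOn (hA i j) hU hy).hasFDerivAt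
  have hcomp : HasFDerivAt (fun z => (A z).det) _ y :=
    HasFDerivAt.comp (g := d) (f := fun z i j => A z i j) y hd.hasFDerivAt hAd
  have h1 : fderiv ℝ (fun y => (A y).det) y v = fderiv ℝ d (A y) (D : ι → ι → ℝ) := by
    rw [hcomp.fderiv]; rfl
  let a₀ : ι → ι → ℝ := fun i j => A y i j
  let D₀ : ι → ι → ℝ := fun i j => D i j
  have hline : HasDerivAt (fun t : ℝ => a₀ + t • D₀)
      D₀ 0 := by
    simpa using ((hasDerivAt_id (0 : ℝ)).smul_const D₀).const_add a₀
  have h2 : HasDerivAt (fun t : ℝ => d (a₀ + t • D₀))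
      (fderiv ℝ d a₀ D₀) 0 := by
    have hd' : HasFDerivAt d (fderiv ℝ d a₀)
      (a₀ + (0 : ℝ) • D₀) := by
      rw [zero_smul, add_zero]; exact hd.hasFDerivAt
    exact hd'.comp_hasDerivAt (0 : ℝ) hline
  have hunit : IsUnit (A y).det := isUnit_iff_ne_zero.2 hdet
  have h3 : HasDerivAt (fun t : ℝ => d (a₀ + t • D₀))
      ((A y).det * ((A y)⁻¹ * D).trace) 0 := by
    have e : (fun t : ℝ => d (a₀ + t • D₀))
        = fun t : ℝ => (A y).det * (1 + t • ((A y)⁻¹ * D)).det := by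
      funext t
      rw [← Matrix.det_mul, mul_add, mul_one, Matrix.mul_smul, ← mul_assoc,
        Matrix.mul_nonsing_inv _ hunit, one_mul]
      rfl
    rw [e]
    refine HasDerivAt.const_mul _ ?_
    set N := (A y)⁻¹ * D
    have h4 : (fun t : ℝ => (1 + t • N).det) = fun t =>
        ((1 + (Polynomial.X : Polynomial ℝ) • N.map Polynomial.C).det).eval t := by
      funext t
      rw [← Polynomial.coe_evalRingHom, RingHom.map_det]
      congr 1
      ext i j
      by_cases hij : i = j <;> simp [hij, Polynomial.eval_mul] <;> exact mul_comm _ _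
    rw [h4, ← Matrix.derivative_det_one_add_X_smul]
    exact Polynomial.hasDerivAt _ _
  rw [h1, h2.unique h3]

namespace IsMetricOn

variable {G : Coord n → Matrix (Fin n) (Fin n) ℝ} {U : Set (Coord n)} {y : Coord n}

lemma isUnit_det (hG : IsMetricOn G U) (hy : y ∈ U) : IsUnit (G y).det :=
  isUnit_iff_ne_zero.2 (hG.det_ne y hy)

lemma inv_symm (hG : IsMetricOn G U) (hy : y ∈ U) (i j : Fin n) : (G y)⁻¹ i j = (G y)⁻¹ j i := by
  have : ((G y)⁻¹).IsSymm := by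
    rw [Matrix.IsSymm, Matrix.transpose_nonsing_inv, hG.symm y hy]
  exact this.apply j i

lemma smooth_inv (hG : IsMetricOn G U) (i j : Fin n) :
    ContDiffOn ℝ ∞ (fun y => (G y)⁻¹ i j) U := by
  have : (fun y => (G y)⁻¹ i j) = fun y => (G y).det⁻¹ * (G y).adjugate i j := by
    funext y; simp [Matrix.inv_def]
  rw [this]
  refine ((contDiffOn_det hG.smooth).inv hG.det_ne).mul ?_
  simp only [Matrix.adjugate_apply]
  refine contDiffOn_det fun a b => ?_
  by_cases h : a = j
  · simp only [h, Matrix.updateRow_self]; exact contDiffOn_const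
  · simp only [ne_eq, h, not_false_eq_true, Matrix.updateRow_ne]; exact hG.smooth a b

lemma sqrtDet_pos (hG : IsMetricOn G U) (hy : y ∈ U) : 0 < sqrtDet G y :=
  Real.sqrt_pos.2 (abs_pos.2 (hG.det_ne y hy))

lemma smooth_sqrtDet (hG : IsMetricOn G U) : ContDiffOn ℝ ∞ (sqrtDet G) U := by
  intro y hy
  have h1 := (contDiffOn_det hG.smooth).contDiffAt (hG.isOpen.mem_nhds hy)
  exact ((h1.abs (hG.det_ne y hy)).sqrt (abs_pos.2 (hG.det_ne y hy)).ne').contDiffWithinAt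

lemma fderiv_sqrtDet (hG : IsMetricOn G U) (hy : y ∈ U) (v : Coord n) :
    fderiv ℝ (sqrtDet G) y v = 1 / 2 * sqrtDet G y *
      ((G y)⁻¹ * Matrix.of fun i j => fderiv ℝ (fun z => G z i j) y v).trace := by
  have hs := differentiableAt_of_contDiffOn hG.smooth_sqrtDet hG.isOpen hy
  have hdet := differentiableAt_of_contDiffOn (contDiffOn_det hG.smooth) hG.isOpen hy
  -- `|g|` is eliminated in favour of `√|g| ^ 4 = (det g) ^ 2`, which avoids the sign of `det g`
  have h4 : ∀ z, sqrtDet G z * sqrtDet G z * (sqrtDet G z * sqrtDet G z)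
      = (G z).det * (G z).det := by
    intro z; simp [sqrtDet, Real.mul_self_sqrt (abs_nonneg _)]
  have h5 : fderiv ℝ (fun z => sqrtDet G z * sqrtDet G z * (sqrtDet G z * sqrtDet G z)) y v
      = fderiv ℝ (fun z => (G z).det * (G z).det) y v := by rw [funext h4]
  rw [fderiv_mul_apply (hs.fun_mul hs) (hs.fun_mul hs), fderiv_mul_apply hs hs,
    fderiv_mul_apply hdet hdet, fderiv_det_apply hG.isOpen hG.smooth hy (hG.det_ne y hy)] at h5
  set T := ((G y)⁻¹ * Matrix.of fun i j => fderiv ℝ (fun z => G z i j) y v).trace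
  have hp := hG.sqrtDet_pos hy
  have h6 : (4 * sqrtDet G y ^ 3) * fderiv ℝ (sqrtDet G) y v
      = (4 * sqrtDet G y ^ 3) * (1 / 2 * sqrtDet G y * T) := by
    linear_combination h5 - 2 * T * h4 y
  exact mul_left_cancel₀ (by positivity) h6

lemma fderiv_inv (hG : IsMetricOn G U) (hy : y ∈ U) (v : Coord n) :
    (Matrix.of fun i j => fderiv ℝ (fun z => (G z)⁻¹ i j) y v)
      = -((G y)⁻¹ * (Matrix.of fun i j => fderiv ℝ (fun z => G z i j) y v) * (G y)⁻¹) := by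
  set D := Matrix.of fun i j => fderiv ℝ (fun z => G z i j) y v with hD
  set E := Matrix.of fun i j => fderiv ℝ (fun z => (G z)⁻¹ i j) y v with hE
  have hGd := fun i j => differentiableAt_of_contDiffOn (hG.smooth i j) hG.isOpen hy
  have hId := fun i j => differentiableAt_of_contDiffOn (hG.smooth_inv i j) hG.isOpen hy
  have h1 : E * G y + (G y)⁻¹ * D = 0 := by
    ext i j
    have h2 : ∀ z ∈ U, ∑ k, (G z)⁻¹ i k * G z k j = (1 : Matrix (Fin n) (Fin n) ℝ) i j := by
      intro z hz
      rw [← Matrix.nonsing_inv_mul _ (hG.isUnit_det hz), Matrix.mul_apply]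
    have h3 := congrArg (fun L : Coord n →L[ℝ] ℝ => L v) (fderiv_congr_on hG.isOpen h2 hy)
    simp only [fderiv_fun_const] at h3
    rw [fderiv_fun_sum fun k _ => (hId i k).fun_mul (hGd k j)] at h3
    simp only [_root_.sum_apply, fderiv_mul_apply (hId i _) (hGd _ j)] at h3
    rw [Finset.sum_add_distrib] at h3
    simp only [Matrix.add_apply, Matrix.mul_apply, hD, hE, Matrix.of_apply, Matrix.zero_apply]
    rw [add_comm, h3]; rfl
  have h4 : E * G y * (G y)⁻¹ = E := by
    rw [mul_assoc, Matrix.mul_nonsing_inv _ (hG.isUnit_det hy), mul_one]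
  rw [← h4, eq_neg_of_add_eq_zero_left h1, neg_mul]

end IsMetricOn

/-! ### Conformal Killing vectors in coordinates -/

/-- The divergence `∂_k ζᵏ` of the components of a vector field (without the factor `√|g|`). -/
def coordDiv (ζ : Coord n → Coord n) (y : Coord n) : ℝ := ∑ k, pd k (fun z => ζ z k) y

/-- The coefficient `|g|^{-1/2} ∂_i (|g|^{1/2} g^{ij})` of `u_j` in the Laplacian. -/
def drift (G : Coord n → Matrix (Fin n) (Fin n) ℝ) (j : Fin n) (y : Coord n) : ℝ :=
  (sqrtDet G y)⁻¹ * ∑ i, pd i (fun z => sqrtDet G z * (G z)⁻¹ i j) y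

/-- The Jacobian matrix `(∂_i ζᵏ)_{ki}`. -/
def jacobian (ζ : Coord n → Coord n) (y : Coord n) : Matrix (Fin n) (Fin n) ℝ :=
  Matrix.of fun k i => pd i (fun z => ζ z k) y

/-- The only possible conformal factor of `ζ`, i.e. `(2n)⁻¹ g^{ij} (𝓛_ζ g)_{ij}`. -/
def confFactor (G : Coord n → Matrix (Fin n) (Fin n) ℝ) (ζ : Coord n → Coord n) (y : Coord n) : ℝ :=
  (2 * (n : ℝ))⁻¹ * ∑ i, ∑ j, (G y)⁻¹ i j * lieDerivMetric G ζ y i j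

namespace IsMetricOn

variable {G : Coord n → Matrix (Fin n) (Fin n) ℝ} {U : Set (Coord n)} {y : Coord n}

lemma smooth_drift (hG : IsMetricOn G U) (j : Fin n) : ContDiffOn ℝ ∞ (drift G j) U := by
  refine (hG.smooth_sqrtDet.inv fun y hy => (hG.sqrtDet_pos hy).ne').mul ?_
  exact ContDiffOn.sum fun i _ =>
    contDiffOn_pd (hG.smooth_sqrtDet.mul (hG.smooth_inv i j)) hG.isOpen i

lemma smooth_confFactor (hG : IsMetricOn G U) {ζ : Coord n → Coord n}
    (hζ : ∀ k, ContDiffOn ℝ ∞ (fun z => ζ z k) U) : ContDiffOn ℝ ∞ (confFactor G ζ) U := by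
  refine contDiffOn_const.mul ?_
  refine ContDiffOn.sum fun i _ => ContDiffOn.sum fun j _ => (hG.smooth_inv i j).mul ?_
  refine ContDiffOn.sum fun k _ => ContDiffOn.add (ContDiffOn.add ?_ ?_) ?_
  · exact (hζ k).mul (contDiffOn_pd (hG.smooth i j) hG.isOpen k)
  · exact (hG.smooth k j).mul (contDiffOn_pd (hζ k) hG.isOpen i)
  · exact (hG.smooth i k).mul (contDiffOn_pd (hζ k) hG.isOpen j)

lemma sum_inv_mul_self (hG : IsMetricOn G U) (hy : y ∈ U) :
    ∑ i, ∑ j, (G y)⁻¹ i j * G y i j = n := by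
  have h : ((G y)⁻¹ * G y).trace = n := by
    rw [Matrix.nonsing_inv_mul _ (hG.isUnit_det hy), Matrix.trace_one, Fintype.card_fin]
  rw [← h, Matrix.trace]
  refine Finset.sum_congr rfl fun i _ => ?_
  rw [Matrix.diag_apply, Matrix.mul_apply]
  exact Finset.sum_congr rfl fun j _ => by rw [(hG.symm y hy).apply i j]

lemma eq_confFactor (hG : IsMetricOn G U) (hn : n ≠ 0) (hy : y ∈ U) {ζ : Coord n → Coord n} {c : ℝ}
    (h : ∀ i j, lieDerivMetric G ζ y i j = 2 * c * G y i j) : c = confFactor G ζ y := by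
  have h0 : (n : ℝ) ≠ 0 := Nat.cast_ne_zero.2 hn
  have : ∑ i, ∑ j, (G y)⁻¹ i j * lieDerivMetric G ζ y i j = 2 * c * n := by
    rw [← hG.sum_inv_mul_self hy, Finset.mul_sum]
    refine Finset.sum_congr rfl fun i _ => ?_
    rw [Finset.mul_sum]
    exact Finset.sum_congr rfl fun j _ => by rw [h i j]; ring
  rw [confFactor, this]
  field_simp

lemma lieDerivMetric_eq_matrix (ζ : Coord n → Coord n) :
    Matrix.of (lieDerivMetric G ζ y) = (Matrix.of fun i j => fderiv ℝ (fun z => G z i j) y (ζ y))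
      + (jacobian ζ y).transpose * G y + G y * jacobian ζ y := by
  ext i j
  simp only [lieDerivMetric, Matrix.of_apply, Matrix.add_apply, Matrix.mul_apply,
    Matrix.transpose_apply, jacobian, fderiv_eq_sum_pd, Finset.sum_add_distrib]
  congr 2
  exact Finset.sum_congr rfl fun k _ => mul_comm _ _

/-- The conformal Killing equation in terms of the inverse metric. -/
lemma conformal_iff_inv (hG : IsMetricOn G U) (hy : y ∈ U) (ζ : Coord n → Coord n) (c : ℝ) :
    (∀ i j, lieDerivMetric G ζ y i j = 2 * c * G y i j) ↔
      ∀ i j, fderiv ℝ (fun z => (G z)⁻¹ i j) y (ζ y)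
        = ∑ k, ((G y)⁻¹ k j * pd k (fun z => ζ z i) y + (G y)⁻¹ i k * pd k (fun z => ζ z j) y)
          - 2 * c * (G y)⁻¹ i j := by
  set D := Matrix.of fun i j => fderiv ℝ (fun z => G z i j) y (ζ y) with hD
  set Z := jacobian ζ y with hZ
  set h := (G y)⁻¹ with hh
  have hl : h * G y = 1 := Matrix.nonsing_inv_mul _ (hG.isUnit_det hy)
  have hr : G y * h = 1 := Matrix.mul_nonsing_inv _ (hG.isUnit_det hy)
  have e1 : (∀ i j, lieDerivMetric G ζ y i j = 2 * c * G y i j) ↔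
      D + Z.transpose * G y + G y * Z = (2 * c) • G y := by
    rw [← lieDerivMetric_eq_matrix, ← Matrix.ext_iff]; rfl
  have e2 : (∀ i j, fderiv ℝ (fun z => (G z)⁻¹ i j) y (ζ y)
        = ∑ k, (h k j * pd k (fun z => ζ z i) y + h i k * pd k (fun z => ζ z j) y)
          - 2 * c * h i j) ↔ -(h * D * h) = Z * h + h * Z.transpose - (2 * c) • h := by
    rw [hD, hh, ← hG.fderiv_inv hy, ← Matrix.ext_iff]
    refine forall_congr' fun i => forall_congr' fun j => ?_
    simp only [Matrix.of_apply, Matrix.sub_apply, Matrix.add_apply, Matrix.mul_apply,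
      Matrix.smul_apply, Matrix.transpose_apply, hZ, jacobian, Finset.sum_add_distrib, smul_eq_mul,
      mul_comm]
  rw [e1, e2]
  constructor
  · intro H
    have : D = (2 * c) • G y - Z.transpose * G y - G y * Z := by rw [← H]; abel
    rw [this]
    have a1 : h * (Z.transpose * G y) * h = h * Z.transpose := by
      rw [mul_assoc, mul_assoc, hr, mul_one]
    have a2 : h * (G y * Z) * h = Z * h := by rw [← mul_assoc, hl, one_mul]
    rw [mul_sub, mul_sub, sub_mul, sub_mul, a1, a2, Matrix.mul_smul, hl, Matrix.smul_mul, one_mul]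
    abel
  · intro H
    have a0 : D = G y * (h * D * h) * G y := by
      rw [mul_assoc h, ← mul_assoc (G y), hr, one_mul, mul_assoc, hl, mul_one]
    have : h * D * h = (2 * c) • h - Z * h - h * Z.transpose := by
      rw [← neg_neg (h * D * h), H]; abel
    rw [a0, this]
    have a1 : G y * (h * Z.transpose) * G y = Z.transpose * G y := by
      rw [← mul_assoc, hr, one_mul]
    have a2 : G y * (Z * h) * G y = G y * Z := by rw [mul_assoc, mul_assoc, hl, mul_one]
    rw [mul_sub, mul_sub, sub_mul, sub_mul, a1, a2, Matrix.mul_smul, hr, Matrix.smul_mul, one_mul]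
    abel

lemma fderiv_sqrtDet_of_conformal (hG : IsMetricOn G U) (hy : y ∈ U) {ζ : Coord n → Coord n}
    {c : ℝ} (h : ∀ i j, lieDerivMetric G ζ y i j = 2 * c * G y i j) :
    fderiv ℝ (sqrtDet G) y (ζ y) = (n * c - coordDiv ζ y) * sqrtDet G y := by
  rw [hG.fderiv_sqrtDet hy]
  set D := Matrix.of fun i j => fderiv ℝ (fun z => G z i j) y (ζ y) with hD
  have hl : (G y)⁻¹ * G y = 1 := Matrix.nonsing_inv_mul _ (hG.isUnit_det hy)
  have hr : G y * (G y)⁻¹ = 1 := Matrix.mul_nonsing_inv _ (hG.isUnit_det hy)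
  have e1 : D + (jacobian ζ y).transpose * G y + G y * jacobian ζ y = (2 * c) • G y := by
    rw [← lieDerivMetric_eq_matrix]; ext i j; exact h i j
  have e2 : D = (2 * c) • G y - (jacobian ζ y).transpose * G y - G y * jacobian ζ y := by
    rw [← e1]; abel
  have e3 : (jacobian ζ y).trace = coordDiv ζ y := rfl
  have e4 : ((G y)⁻¹ * ((jacobian ζ y).transpose * G y)).trace = coordDiv ζ y := by
    rw [Matrix.trace_mul_comm, mul_assoc, hr, mul_one, Matrix.trace_transpose, e3]
  rw [e2, mul_sub, mul_sub, Matrix.trace_sub, Matrix.trace_sub, e4, ← mul_assoc, hl, one_mul, e3,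
    Matrix.mul_smul, hl, Matrix.trace_smul, Matrix.trace_one, Fintype.card_fin, smul_eq_mul]
  ring

/-- The conformal Killing equation for the density `√|g| g^{ij}`. -/
lemma fderiv_density_of_conformal (hG : IsMetricOn G U) (hy : y ∈ U) {ζ : Coord n → Coord n}
    {c : ℝ} (h : ∀ i j, lieDerivMetric G ζ y i j = 2 * c * G y i j) (i j : Fin n) :
    fderiv ℝ (fun z => sqrtDet G z * (G z)⁻¹ i j) y (ζ y)
      = (n - 2) * c * (sqrtDet G y * (G y)⁻¹ i j)
        + ∑ k, (sqrtDet G y * (G y)⁻¹ k j * pd k (fun z => ζ z i) y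
          + sqrtDet G y * (G y)⁻¹ i k * pd k (fun z => ζ z j) y)
        - coordDiv ζ y * (sqrtDet G y * (G y)⁻¹ i j) := by
  rw [fderiv_mul_apply (differentiableAt_of_contDiffOn hG.smooth_sqrtDet hG.isOpen hy)
    (differentiableAt_of_contDiffOn (hG.smooth_inv i j) hG.isOpen hy),
    hG.fderiv_sqrtDet_of_conformal hy h, (hG.conformal_iff_inv hy ζ c).1 h]
  have : ∑ k, (sqrtDet G y * (G y)⁻¹ k j * pd k (fun z => ζ z i) y
          + sqrtDet G y * (G y)⁻¹ i k * pd k (fun z => ζ z j) y)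
      = sqrtDet G y * ∑ k, ((G y)⁻¹ k j * pd k (fun z => ζ z i) y
        + (G y)⁻¹ i k * pd k (fun z => ζ z j) y) := by
    rw [Finset.mul_sum]; exact Finset.sum_congr rfl fun k _ => by ring
  rw [this]
  ring

/-- The derivative of the first-order coefficient of the Laplacian along a conformal Killing
vector.  This is the source of the term `(2 - n) / 2 ψ u` of a conformal symmetry. -/
lemma fderiv_drift_of_conformal (hG : IsMetricOn G U) {ζ : Coord n → Coord n}
    (hζ : ∀ k, ContDiffOn ℝ ∞ (fun z => ζ z k) U) {ψ : Coord n → ℝ} (hψ : ContDiffOn ℝ ∞ ψ U)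
    (h : ∀ y ∈ U, ∀ i j, lieDerivMetric G ζ y i j = 2 * ψ y * G y i j) (hy : y ∈ U) (j : Fin n) :
    fderiv ℝ (drift G j) y (ζ y)
      = (n - 2) * ∑ i, (G y)⁻¹ i j * pd i ψ y - 2 * ψ y * drift G j y
        + ∑ m, drift G m y * pd m (fun z => ζ z j) y
        + ∑ i, ∑ m, (G y)⁻¹ i m * pd i (pd m (fun z => ζ z j)) y := by
  have hU := hG.isOpen
  have dif : ∀ {f : Coord n → ℝ}, ContDiffOn ℝ ∞ f U → DifferentiableAt ℝ f y := fun hf =>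
    differentiableAt_of_contDiffOn hf hU hy
  -- the density `K = √|g| g⁻¹`, whose divergence is `√|g|` times the coefficient
  set K : Fin n → Fin n → Coord n → ℝ := fun i j z => sqrtDet G z * (G z)⁻¹ i j with hK
  have sK : ∀ i j, ContDiffOn ℝ ∞ (K i j) U := fun i j => hG.smooth_sqrtDet.mul (hG.smooth_inv i j)
  set S : Fin n → Coord n → ℝ := fun j z => ∑ i, pd i (K i j) z with hS
  have sS : ∀ j, ContDiffOn ℝ ∞ (S j) U := fun j =>
    ContDiffOn.sum fun i _ => contDiffOn_pd (sK i j) hU i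
  have hSB : ∀ j, ∀ z ∈ U, S j z = sqrtDet G z * drift G j z := by
    intro j z hz
    rw [drift, ← mul_assoc, mul_inv_cancel₀ (hG.sqrtDet_pos hz).ne', one_mul]
  have s2 : ∀ i k, ContDiffOn ℝ ∞ (pd i (fun z => ζ z k)) U := fun i k => contDiffOn_pd (hζ k) hU i
  have sdiv : ContDiffOn ℝ ∞ (coordDiv ζ) U := ContDiffOn.sum fun k _ => s2 k k
  have step1 : ∀ i, ∀ z ∈ U, ∑ m, ζ z m * pd m (K i j) z
      = (n - 2) * (ψ z * K i j z) + ∑ k, (K k j z * pd k (fun z => ζ z i) z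
          + K i k z * pd k (fun z => ζ z j) z) - coordDiv ζ z * K i j z := by
    intro i z hz
    rw [← fderiv_eq_sum_pd, hG.fderiv_density_of_conformal hz (h z hz), mul_assoc]
  have step2 : ∀ i, ∑ m, (ζ y m * pd i (pd m (K i j)) y + pd i (fun z => ζ z m) y * pd m (K i j) y)
      = (n - 2) * (ψ y * pd i (K i j) y + pd i ψ y * K i j y)
        + ∑ k, ((K k j y * pd i (pd k (fun z => ζ z i)) y
            + pd i (K k j) y * pd k (fun z => ζ z i) y)
          + (K i k y * pd i (pd k (fun z => ζ z j)) y
            + pd i (K i k) y * pd k (fun z => ζ z j) y))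
        - (coordDiv ζ y * pd i (K i j) y
          + (∑ k, pd i (pd k (fun z => ζ z k)) y) * K i j y) := by
    intro i
    have e := pd_congr_on hU (step1 i) hy i
    rw [pd_sum fun m _ => (dif (hζ m)).fun_mul (dif (contDiffOn_pd (sK i j) hU m))] at e
    rw [Finset.sum_congr rfl fun m _ => pd_mul (dif (hζ m)) (dif (contDiffOn_pd (sK i j) hU m)) i]
      at e
    rw [e]
    have d1 : DifferentiableAt ℝ (fun z => ψ z * K i j z) y := (dif hψ).fun_mul (dif (sK i j))
    have d2 : ∀ k, DifferentiableAt ℝ (fun z => K k j z * pd k (fun z => ζ z i) z) y := fun k =>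
      (dif (sK k j)).fun_mul (dif (s2 k i))
    have d3 : ∀ k, DifferentiableAt ℝ (fun z => K i k z * pd k (fun z => ζ z j) z) y := fun k =>
      (dif (sK i k)).fun_mul (dif (s2 k j))
    have d4 : DifferentiableAt ℝ (fun z => coordDiv ζ z * K i j z) y :=
      (dif sdiv).fun_mul (dif (sK i j))
    have d5 : DifferentiableAt ℝ (fun z => ∑ k, (K k j z * pd k (fun z => ζ z i) z
          + K i k z * pd k (fun z => ζ z j) z)) y :=
      DifferentiableAt.fun_sum fun k _ => (d2 k).fun_add (d3 k)
    rw [pd_sub ((d1.const_mul _).fun_add d5) d4, pd_add (d1.const_mul _) d5, pd_const_mul d1,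
      pd_mul (dif hψ) (dif (sK i j)), pd_mul (dif sdiv) (dif (sK i j)),
      pd_sum fun k _ => (d2 k).fun_add (d3 k)]
    rw [Finset.sum_congr rfl fun k _ => pd_add (d2 k) (d3 k) i]
    rw [Finset.sum_congr rfl fun k _ => congrArg₂ (· + ·)
      (pd_mul (dif (sK k j)) (dif (s2 k i)) i) (pd_mul (dif (sK i k)) (dif (s2 k j)) i)]
    have ediv : pd i (coordDiv ζ) y = ∑ k, pd i (pd k (fun z => ζ z k)) y :=
      pd_sum (f := fun k => pd k (fun z => ζ z k)) (fun k _ => dif (s2 k k)) i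
    rw [ediv]
  have step3 : fderiv ℝ (S j) y (ζ y) = (n - 2) * (ψ y * S j y + ∑ i, pd i ψ y * K i j y)
      + ∑ i, ∑ m, K i m y * pd i (pd m (fun z => ζ z j)) y
      + ∑ m, S m y * pd m (fun z => ζ z j) y - coordDiv ζ y * S j y := by
    have e := Finset.sum_congr rfl fun i (_ : i ∈ Finset.univ) => step2 i
    simp only [Finset.sum_add_distrib, Finset.sum_sub_distrib] at e
    have c0 : fderiv ℝ (S j) y (ζ y) = ∑ i, ∑ m, ζ y m * pd i (pd m (K i j)) y := by
      rw [fderiv_eq_sum_pd, Finset.sum_comm]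
      refine Finset.sum_congr rfl fun m _ => ?_
      rw [← Finset.mul_sum]
      congr 1
      simp only [hS]
      rw [pd_sum fun i _ => dif (contDiffOn_pd (sK i j) hU i)]
      exact Finset.sum_congr rfl fun i _ => pd_pd_comm hU (sK i j) hy m i
    have c1 : ∑ i, ∑ m, pd i (fun z => ζ z m) y * pd m (K i j) y
        = ∑ i, ∑ k, pd i (K k j) y * pd k (fun z => ζ z i) y := by
      rw [Finset.sum_comm]
      exact Finset.sum_congr rfl fun i _ => Finset.sum_congr rfl fun k _ => mul_comm _ _
    have c2 : ∑ i, (∑ k, pd i (pd k (fun z => ζ z k)) y) * K i j y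
        = ∑ i, ∑ k, K k j y * pd i (pd k (fun z => ζ z i)) y := by
      rw [Finset.sum_comm]
      refine Finset.sum_congr rfl fun i _ => ?_
      rw [Finset.sum_mul]
      exact Finset.sum_congr rfl fun k _ => by rw [pd_pd_comm hU (hζ k) hy, mul_comm]
    have c3 : ∑ i, ∑ k, pd i (K i k) y * pd k (fun z => ζ z j) y
        = ∑ m, S m y * pd m (fun z => ζ z j) y := by
      rw [Finset.sum_comm]
      exact Finset.sum_congr rfl fun k _ => by rw [← Finset.sum_mul]
    have c4 : ∑ i, (n - 2) * (ψ y * pd i (K i j) y + pd i ψ y * K i j y)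
        = ((n : ℝ) - 2) * (ψ y * S j y + ∑ i, pd i ψ y * K i j y) := by
      rw [← Finset.mul_sum, Finset.sum_add_distrib, ← Finset.mul_sum]
    have c5 : ∑ i, coordDiv ζ y * pd i (K i j) y = coordDiv ζ y * S j y := by
      rw [← Finset.mul_sum]
    rw [c0]
    linarith
  have sp := hG.sqrtDet_pos hy
  have e1 : fderiv ℝ (S j) y (ζ y) = sqrtDet G y * fderiv ℝ (drift G j) y (ζ y)
      + (n * ψ y - coordDiv ζ y) * sqrtDet G y * drift G j y := by
    rw [fderiv_congr_on hU (hSB j) hy, fderiv_mul_apply (dif hG.smooth_sqrtDet)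
      (dif (hG.smooth_drift j)), hG.fderiv_sqrtDet_of_conformal hy (h y hy)]
  have f1 : ∑ i, pd i ψ y * K i j y = sqrtDet G y * ∑ i, (G y)⁻¹ i j * pd i ψ y := by
    rw [Finset.mul_sum]; exact Finset.sum_congr rfl fun k _ => by simp only [hK]; ring
  have f2 : ∑ i, ∑ m, K i m y * pd i (pd m (fun z => ζ z j)) y
      = sqrtDet G y * ∑ i, ∑ m, (G y)⁻¹ i m * pd i (pd m (fun z => ζ z j)) y := by
    simp only [Finset.mul_sum]
    exact Finset.sum_congr rfl fun i _ => Finset.sum_congr rfl fun k _ => by simp only [hK]; ring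
  have f3 : ∑ m, S m y * pd m (fun z => ζ z j) y
      = sqrtDet G y * ∑ m, drift G m y * pd m (fun z => ζ z j) y := by
    rw [Finset.mul_sum]; exact Finset.sum_congr rfl fun k _ => by rw [hSB k y hy]; ring
  rw [f1, f2, f3, e1, hSB j y hy] at step3
  refine mul_left_cancel₀ sp.ne' ?_
  linear_combination step3

end IsMetricOn

/-! ### The second prolongation of the Klein-Gordon equation -/

lemma hasFDerivAt_fst_mul_clm {E : Type*} [NormedAddCommGroup E] [NormedSpace ℝ E]
    {f : Coord n → ℝ} (ℓ : Coord n × E →L[ℝ] ℝ) {J : Coord n × E}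
    (hf : DifferentiableAt ℝ f J.1) :
    HasFDerivAt (fun J : Coord n × E => f J.1 * ℓ J)
      (f J.1 • ℓ + ℓ J • (fderiv ℝ f J.1).comp (ContinuousLinearMap.fst ℝ (Coord n) E)) J := by
  have h1 : HasFDerivAt (fun J : Coord n × E => f J.1)
      ((fderiv ℝ f J.1).comp (ContinuousLinearMap.fst ℝ (Coord n) E)) J :=
    HasFDerivAt.comp J (f := fun J : Coord n × E => J.1) (g := f) hf.hasFDerivAt hasFDerivAt_fst
  exact h1.mul ℓ.hasFDerivAt

lemma fderiv_kgEquation {G : Coord n → Matrix (Fin n) (Fin n) ℝ} {U : Set (Coord n)}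
    (hG : IsMetricOn G U) {W : Coord n → ℝ} (hW : ContDiffOn ℝ ∞ W U) {y : Coord n} (hy : y ∈ U)
    (u : ℝ) (p : Fin n → ℝ) (q : Fin n → Fin n → ℝ) (v : Jet2 n) :
    fderiv ℝ (kgEquation G W) (y, u, p, q) v
      = ∑ i, ∑ j, ((G y)⁻¹ i j * v.2.2.2 i j + q i j * fderiv ℝ (fun z => (G z)⁻¹ i j) y v.1)
        + ∑ j, (drift G j y * v.2.2.1 j + p j * fderiv ℝ (drift G j) y v.1)
        + (W y * v.2.1 + u * fderiv ℝ W y v.1) := by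
  have dif : ∀ {f : Coord n → ℝ}, ContDiffOn ℝ ∞ f U → DifferentiableAt ℝ f y := fun hf =>
    differentiableAt_of_contDiffOn hf hG.isOpen hy
  let ℓq : Fin n → Fin n → (Jet2 n →L[ℝ] ℝ) := fun i j =>
    (ContinuousLinearMap.proj j).comp ((ContinuousLinearMap.proj i).comp
      ((ContinuousLinearMap.snd ℝ (Fin n → ℝ) (Fin n → Fin n → ℝ)).comp
        ((ContinuousLinearMap.snd ℝ ℝ _).comp (ContinuousLinearMap.snd ℝ (Coord n) _))))
  let ℓp : Fin n → (Jet2 n →L[ℝ] ℝ) := fun j =>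
    (ContinuousLinearMap.proj j).comp
      ((ContinuousLinearMap.fst ℝ (Fin n → ℝ) (Fin n → Fin n → ℝ)).comp
        ((ContinuousLinearMap.snd ℝ ℝ _).comp (ContinuousLinearMap.snd ℝ (Coord n) _)))
  let ℓu : Jet2 n →L[ℝ] ℝ :=
    (ContinuousLinearMap.fst ℝ ℝ _).comp (ContinuousLinearMap.snd ℝ (Coord n) _)
  have h1 : HasFDerivAt (fun J : Jet2 n => ∑ i, ∑ j, (G J.1)⁻¹ i j * ℓq i j J) _ (y, u, p, q) :=
    HasFDerivAt.fun_sum fun i _ => HasFDerivAt.fun_sum fun j _ =>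
      hasFDerivAt_fst_mul_clm (f := fun z => (G z)⁻¹ i j) (ℓq i j) (dif (hG.smooth_inv i j))
  have h2 : HasFDerivAt (fun J : Jet2 n => ∑ j, drift G j J.1 * ℓp j J) _ (y, u, p, q) :=
    HasFDerivAt.fun_sum fun j _ =>
      hasFDerivAt_fst_mul_clm (f := drift G j) (ℓp j) (dif (hG.smooth_drift j))
  have h3 : HasFDerivAt (fun J : Jet2 n => W J.1 * ℓu J) _ (y, u, p, q) :=
    hasFDerivAt_fst_mul_clm (f := W) ℓu (dif hW)
  have h4 : HasFDerivAt (kgEquation G W) _ (y, u, p, q) := (h1.add h2).add h3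
  rw [h4.fderiv]
  simp only [_root_.add_apply, _root_.sum_apply, _root_.smul_apply, smul_eq_mul,
    ContinuousLinearMap.comp_apply]
  rfl

/-- The components `g^{ij}_{,k} ξᵏ - g^{kj} ξⁱ_{,k} - g^{ik} ξʲ_{,k}` of the Lie derivative of the
inverse metric along a field `ξ(x, u)`. -/
def lieInv (G : Coord n → Matrix (Fin n) (Fin n) ℝ) (ξ : Coord n × ℝ → Coord n) (z : Coord n × ℝ)
    (i j : Fin n) : ℝ :=
  fderiv ℝ (fun y => (G y)⁻¹ i j) z.1 (ξ z)
    - ∑ k, ((G z.1)⁻¹ k j * dX k (fun w => ξ w i) z + (G z.1)⁻¹ i k * dX k (fun w => ξ w j) z)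

/-- The dependence of `X^{[2]} H` on the second derivatives. -/
lemma prolong2_kgEquation_affine {G : Coord n → Matrix (Fin n) (Fin n) ℝ} {U : Set (Coord n)}
    (hG : IsMetricOn G U) {W : Coord n → ℝ} (hW : ContDiffOn ℝ ∞ W U) {y : Coord n} (hy : y ∈ U)
    (ξ : Coord n × ℝ → Coord n) (η : Coord n × ℝ → ℝ)
    (u : ℝ) (p : Fin n → ℝ) (q : Fin n → Fin n → ℝ) (hq : ∀ i j, q i j = q j i) :
    prolong2 ξ η (kgEquation G W) (y, u, p, q)
      = ∑ i, ∑ j, (lieInv G ξ (y, u) i j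
          + (dU η (y, u) - ∑ k, dU (fun w => ξ w k) (y, u) * p k) * (G y)⁻¹ i j
          - 2 * (∑ k, (G y)⁻¹ i k * p k) * dU (fun w => ξ w j) (y, u)) * q i j
        + prolong2 ξ η (kgEquation G W) (y, u, p, 0) := by
  set h := (G y)⁻¹ with hh
  have hs : ∀ i j, h i j = h j i := hG.inv_symm hy
  rw [prolong2, prolong2, fderiv_kgEquation hG hW hy, fderiv_kgEquation hG hW hy]
  simp only [lieInv]
  set w : Fin n → ℝ := fun k => dU (fun w => ξ w k) (y, u) with hw
  set Z : Fin n → Fin n → ℝ := fun k i => dX i (fun w => ξ w k) (y, u) with hZ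
  set D : Fin n → Fin n → ℝ := fun i j => fderiv ℝ (fun z => (G z)⁻¹ i j) y (ξ (y, u)) with hD
  set c := dU η (y, u) with hc
  have e2 : ∀ i j, eta2 ξ η (y, u, p, q) i j = eta2 ξ η (y, u, p, 0) i j
      + c * q i j - ∑ k, (Z k j * q i k + Z k i * q j k)
      - ∑ k, w k * (p k * q i j + p j * q i k + p i * q j k) := by
    intro i j
    simp only [eta2, hc, hZ, hw, Pi.zero_apply, mul_zero, add_zero, Finset.sum_const_zero]
    ring
  have key : ∑ i, ∑ j, h i j * (c * q i j - ∑ k, (Z k j * q i k + Z k i * q j k)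
      - ∑ k, w k * (p k * q i j + p j * q i k + p i * q j k))
      = ∑ i, ∑ j, (- ∑ k, (h k j * Z i k + h i k * Z j k) + (c - ∑ k, w k * p k) * h i j
          - 2 * (∑ k, h i k * p k) * w j) * q i j := by
    have a1 : ∑ i, ∑ j, h i j * ∑ k, Z k j * q i k = ∑ i, ∑ j, (∑ k, h i k * Z j k) * q i j := by
      simp only [Finset.mul_sum, Finset.sum_mul]
      refine Finset.sum_congr rfl fun i _ => ?_
      rw [Finset.sum_comm]
      exact Finset.sum_congr rfl fun j _ => Finset.sum_congr rfl fun k _ => by ring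
    have a2 : ∑ i, ∑ j, h i j * ∑ k, Z k i * q j k = ∑ i, ∑ j, (∑ k, h k j * Z i k) * q i j := by
      rw [Finset.sum_comm]
      simp only [Finset.mul_sum, Finset.sum_mul]
      conv_rhs => rw [Finset.sum_comm]
      refine Finset.sum_congr rfl fun i _ => ?_
      rw [Finset.sum_comm]
      exact Finset.sum_congr rfl fun j _ => Finset.sum_congr rfl fun k _ => by rw [hq i j]; ring
    have a3 : ∑ i, ∑ j, h i j * ∑ k, w k * p j * q i k
        = ∑ i, ∑ j, ((∑ k, h i k * p k) * w j) * q i j := by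
      simp only [Finset.mul_sum, Finset.sum_mul]
      refine Finset.sum_congr rfl fun i _ => ?_
      rw [Finset.sum_comm]
      exact Finset.sum_congr rfl fun j _ => Finset.sum_congr rfl fun k _ => by ring
    have a4 : ∑ i, ∑ j, h i j * ∑ k, w k * p i * q j k
        = ∑ i, ∑ j, ((∑ k, h i k * p k) * w j) * q i j := by
      rw [← a3, Finset.sum_comm]
      exact Finset.sum_congr rfl fun i _ => Finset.sum_congr rfl fun j _ => by rw [hs i j]
    have l : ∀ i j, h i j * (c * q i j - ∑ k, (Z k j * q i k + Z k i * q j k)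
        - ∑ k, w k * (p k * q i j + p j * q i k + p i * q j k))
        = (c - ∑ k, w k * p k) * h i j * q i j - h i j * ∑ k, Z k j * q i k
          - h i j * ∑ k, Z k i * q j k - h i j * ∑ k, w k * p j * q i k
          - h i j * ∑ k, w k * p i * q j k := by
      intro i j
      have : ∑ k, w k * (p k * q i j + p j * q i k + p i * q j k)
          = (∑ k, w k * p k) * q i j + ∑ k, w k * p j * q i k + ∑ k, w k * p i * q j k := by
        rw [Finset.sum_mul, ← Finset.sum_add_distrib, ← Finset.sum_add_distrib]
        exact Finset.sum_congr rfl fun k _ => by ring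
      rw [this, Finset.sum_add_distrib]
      ring
    have r : ∀ i j, (- ∑ k, (h k j * Z i k + h i k * Z j k) + (c - ∑ k, w k * p k) * h i j
          - 2 * (∑ k, h i k * p k) * w j) * q i j
        = (c - ∑ k, w k * p k) * h i j * q i j - (∑ k, h i k * Z j k) * q i j
          - (∑ k, h k j * Z i k) * q i j - ((∑ k, h i k * p k) * w j) * q i j
          - ((∑ k, h i k * p k) * w j) * q i j := by
      intro i j; rw [Finset.sum_add_distrib]; ring
    simp only [l, r, Finset.sum_sub_distrib, a1, a2, a3, a4]
  have l1 : ∑ i, ∑ j, (h i j * eta2 ξ η (y, u, p, q) i j + q i j * D i j)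
      = ∑ i, ∑ j, h i j * eta2 ξ η (y, u, p, 0) i j
        + ∑ i, ∑ j, h i j * (c * q i j - ∑ k, (Z k j * q i k + Z k i * q j k)
          - ∑ k, w k * (p k * q i j + p j * q i k + p i * q j k)) + ∑ i, ∑ j, D i j * q i j := by
    simp only [← Finset.sum_add_distrib]
    exact Finset.sum_congr rfl fun i _ => Finset.sum_congr rfl fun j _ => by rw [e2]; ring
  have l2 : ∑ i, ∑ j, (D i j - ∑ k, (h k j * Z i k + h i k * Z j k)
          + (c - ∑ k, w k * p k) * h i j - 2 * (∑ k, h i k * p k) * w j) * q i j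
      = ∑ i, ∑ j, D i j * q i j + ∑ i, ∑ j, (- ∑ k, (h k j * Z i k + h i k * Z j k)
          + (c - ∑ k, w k * p k) * h i j - 2 * (∑ k, h i k * p k) * w j) * q i j := by
    simp only [← Finset.sum_add_distrib]
    exact Finset.sum_congr rfl fun i _ => Finset.sum_congr rfl fun j _ => by ring
  simp only [Pi.zero_apply, zero_mul, add_zero]
  rw [l1, l2, key]
  ring

/-! ### Linear algebra of symmetric matrices -/

/-- An affine function of a symmetric matrix which vanishes on the hyperplane `⟨h, q⟩ + d = 0`
is a multiple of `⟨h, q⟩ + d`. -/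
lemma exists_multiplier {h S : Fin n → Fin n → ℝ} (hs : ∀ i j, h i j = h j i)
    (h0 : ∃ i j, h i j ≠ 0) {c d : ℝ}
    (H : ∀ q : Fin n → Fin n → ℝ, (∀ i j, q i j = q j i) → ∑ i, ∑ j, h i j * q i j + d = 0 →
      ∑ i, ∑ j, S i j * q i j + c = 0) :
    ∃ m : ℝ, ∀ q : Fin n → Fin n → ℝ, (∀ i j, q i j = q j i) →
      ∑ i, ∑ j, S i j * q i j + c = m * (∑ i, ∑ j, h i j * q i j + d) := by
  obtain ⟨a, b, hab⟩ := h0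
  set N := ∑ i, ∑ j, h i j * h i j with hN
  have hNpos : 0 < N := by
    have h1 : 0 < ∑ j, h a j * h a j :=
      Finset.sum_pos' (fun j _ => mul_self_nonneg _) ⟨b, Finset.mem_univ _, mul_self_pos.2 hab⟩
    exact Finset.sum_pos' (fun i _ => Finset.sum_nonneg fun j _ => mul_self_nonneg _)
      ⟨a, Finset.mem_univ _, h1⟩
  have lin : ∀ (T q : Fin n → Fin n → ℝ) (t : ℝ), ∑ i, ∑ j, T i j * (q i j - t * h i j)
      = ∑ i, ∑ j, T i j * q i j - t * ∑ i, ∑ j, T i j * h i j := by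
    intro T q t
    simp only [Finset.mul_sum, ← Finset.sum_sub_distrib]
    exact Finset.sum_congr rfl fun i _ => Finset.sum_congr rfl fun j _ => by ring
  refine ⟨(∑ i, ∑ j, S i j * h i j) / N, fun q hq => ?_⟩
  have := H (fun i j => q i j - ((∑ i, ∑ j, h i j * q i j + d) / N) * h i j)
    (fun i j => by rw [hq i j, hs i j]) (by rw [lin, ← hN]; field_simp; ring)
  rw [lin] at this
  field_simp
  field_simp at this
  linarith

lemma sum_sum_single_add (T : Fin n → Fin n → ℝ) (a b : Fin n) :
    ∑ i, ∑ j, T i j * ((Pi.single a 1 : Fin n → ℝ) i * (Pi.single b 1 : Fin n → ℝ) j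
      + (Pi.single b 1 : Fin n → ℝ) i * (Pi.single a 1 : Fin n → ℝ) j) = T a b + T b a := by
  simp [mul_add, Finset.sum_add_distrib, Pi.single_apply]

lemma sum_sum_mul_mul_eq (T : Matrix (Fin n) (Fin n) ℝ) (a b : Fin n → ℝ) :
    ∑ i, ∑ j, T i j * (a i * b j) = a ⬝ᵥ T.mulVec b := by
  simp only [dotProduct, Matrix.mulVec, Finset.mul_sum]
  exact Finset.sum_congr rfl fun i _ => Finset.sum_congr rfl fun j _ => by ring

/-- A nondegenerate symmetric matrix of size at least two is not proportional to `w wᵀ`, unless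
`w = 0`. -/
lemma eq_zero_of_rank_one {h : Matrix (Fin n) (Fin n) ℝ} (hn : 2 ≤ n) (hdet : IsUnit h.det)
    {w : Fin n → ℝ} {m : ℝ}
    (H : ∀ q : Fin n → Fin n → ℝ, (∀ i j, q i j = q j i) →
      ∑ i, ∑ j, w i * w j * q i j = m * ∑ i, ∑ j, h i j * q i j) (hs : h.IsSymm) : w = 0 := by
  -- a nonzero covector annihilated by `w`
  obtain ⟨a, ha0, haw⟩ : ∃ a : Fin n → ℝ, a ≠ 0 ∧ ∑ i, w i * a i = 0 := by
    let i₀ : Fin n := ⟨0, by omega⟩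
    let i₁ : Fin n := ⟨1, by omega⟩
    have h01 : i₀ ≠ i₁ := by simp [i₀, i₁]
    by_cases hw : w i₁ = 0
    · refine ⟨Pi.single i₁ 1, fun h => ?_, ?_⟩
      · simpa using congrFun h i₁
      · simp [Pi.single_apply, hw]
    · refine ⟨Pi.single i₀ (w i₁) - Pi.single i₁ (w i₀), fun h => hw ?_, ?_⟩
      · simpa [h01] using congrFun h i₀
      · simp [mul_sub, Finset.sum_sub_distrib, Pi.single_apply, mul_comm]
  have hq : ∀ b : Fin n → ℝ, ∑ i, ∑ j, w i * w j * (a i * b j + b i * a j) = 0 := by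
    intro b
    have : ∑ i, ∑ j, w i * w j * (a i * b j + b i * a j)
        = (∑ i, w i * a i) * (∑ j, w j * b j) + (∑ i, w i * b i) * (∑ j, w j * a j) := by
      simp only [Finset.sum_mul_sum, ← Finset.sum_add_distrib]
      exact Finset.sum_congr rfl fun i _ => Finset.sum_congr rfl fun j _ => by ring
    rw [this, haw]; ring
  have hb : ∀ b : Fin n → ℝ, m * (b ⬝ᵥ h.mulVec a) = 0 := by
    intro b
    have h1 := H (fun i j => a i * b j + b i * a j) (fun i j => by ring)
    rw [hq b] at h1
    have h2 : ∑ i, ∑ j, h i j * (a i * b j + b i * a j) = 2 * (b ⬝ᵥ h.mulVec a) := by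
      simp only [mul_add, Finset.sum_add_distrib, sum_sum_mul_mul_eq]
      rw [Matrix.dotProduct_mulVec, ← Matrix.mulVec_transpose, hs, dotProduct_comm]
      ring
    rw [h2] at h1
    linarith
  have hm : m = 0 := by
    by_contra hm
    apply ha0
    have h1 : h.mulVec a = 0 := by
      have := hb (h.mulVec a)
      exact dotProduct_self_eq_zero.1 ((mul_eq_zero.1 this).resolve_left hm)
    have := congrArg (h⁻¹).mulVec h1
    rwa [Matrix.mulVec_mulVec, Matrix.nonsing_inv_mul _ hdet, Matrix.one_mulVec,
      Matrix.mulVec_zero] at this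
  have h3 := H (fun i j => w i * w j) (fun i j => by ring)
  rw [hm, zero_mul] at h3
  have h4 : (∑ i, w i * w i) * (∑ i, w i * w i) = 0 := by
    rw [Finset.sum_mul_sum, ← h3]
    exact Finset.sum_congr rfl fun i _ => Finset.sum_congr rfl fun j _ => by ring
  exact dotProduct_self_eq_zero.1 (mul_self_eq_zero.1 h4)

lemma eq_of_forall_symm {h S : Fin n → Fin n → ℝ} (hs : ∀ i j, h i j = h j i)
    (hS : ∀ i j, S i j = S j i) {m : ℝ}
    (H : ∀ q : Fin n → Fin n → ℝ, (∀ i j, q i j = q j i) →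
      ∑ i, ∑ j, S i j * q i j = m * ∑ i, ∑ j, h i j * q i j) (i j : Fin n) :
    S i j = m * h i j := by
  have := H (fun a b => (Pi.single i 1 : Fin n → ℝ) a * (Pi.single j 1 : Fin n → ℝ) b
      + (Pi.single j 1 : Fin n → ℝ) a * (Pi.single i 1 : Fin n → ℝ) b) (fun a b => by ring)
  rw [sum_sum_single_add, sum_sum_single_add, ← hS i j, ← hs i j] at this
  linarith

/-- A symmetric bilinear form is determined by its quadratic form. -/
lemma eq_of_quadratic {h S : Fin n → Fin n → ℝ} (hs : ∀ i j, h i j = h j i)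
    (hS : ∀ i j, S i j = S j i)
    (H : ∀ p : Fin n → ℝ, ∑ i, ∑ j, S i j * (p i * p j) = ∑ i, ∑ j, h i j * (p i * p j))
    (i j : Fin n) : S i j = h i j := by
  have pol : ∀ (T : Fin n → Fin n → ℝ), (∀ i j, T i j = T j i) →
      ∑ a, ∑ b, T a b * ((Pi.single i 1 + Pi.single j 1 : Fin n → ℝ) a
        * (Pi.single i 1 + Pi.single j 1 : Fin n → ℝ) b) = T i i + T j j + 2 * T i j := by
    intro T hT
    simp only [Pi.add_apply, add_mul, mul_add, Finset.sum_add_distrib]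
    simp [Pi.single_apply]
    rw [hT j i]; ring
  have dia : ∀ (T : Fin n → Fin n → ℝ) (i : Fin n), ∑ a, ∑ b, T a b *
      ((Pi.single i 1 : Fin n → ℝ) a * (Pi.single i 1 : Fin n → ℝ) b) = T i i := by
    intro T i; simp [Pi.single_apply]
  have h1 := H (Pi.single i 1 + Pi.single j 1)
  rw [pol S hS, pol h hs] at h1
  have h2 := H (Pi.single i 1)
  have h3 := H (Pi.single j 1)
  rw [dia, dia] at h2 h3
  linarith

/-! ### Lie point symmetries in coordinates -/

/-- The Lie symmetry condition in a coordinate domain `U`. -/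
def IsLieSymmetryOn (G : Coord n → Matrix (Fin n) (Fin n) ℝ) (W : Coord n → ℝ)
    (ξ : Coord n × ℝ → Coord n) (η : Coord n × ℝ → ℝ) (U : Set (Coord n)) : Prop :=
  ∀ y ∈ U, ∀ (u : ℝ) (p : Fin n → ℝ) (q : Fin n → Fin n → ℝ), (∀ i j, q i j = q j i) →
    kgEquation G W (y, u, p, q) = 0 → prolong2 ξ η (kgEquation G W) (y, u, p, q) = 0

/-- The coordinate form of a conformal generator, with `η = σ u + b`; the function
`σ - (2 - n) / 2 ψ` is only required to be locally constant. -/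
structure IsConformalOn (G : Coord n → Matrix (Fin n) (Fin n) ℝ) (W : Coord n → ℝ)
    (ξ : Coord n × ℝ → Coord n) (η : Coord n × ℝ → ℝ) (U : Set (Coord n)) (ψ σ b : Coord n → ℝ) :
    Prop where
  smooth_ψ : ContDiffOn ℝ ∞ ψ U
  smooth_σ : ContDiffOn ℝ ∞ σ U
  smooth_b : ContDiffOn ℝ ∞ b U
  ξ_indep : ∀ y ∈ U, ∀ u, ξ (y, u) = ξ (y, 0)
  conformal : ∀ y ∈ U, ∀ i j, lieDerivMetric G (fun z => ξ (z, 0)) y i j = 2 * ψ y * G y i j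
  η_eq : ∀ y ∈ U, ∀ u, η (y, u) = σ y * u + b y
  grad : ∀ y ∈ U, ∀ i, pd i σ y = (2 - (n : ℝ)) / 2 * pd i ψ y
  solution : ∀ y ∈ U, laplacian G b y + W y * b y = 0
  constraint : ∀ y ∈ U, ∑ k, ξ (y, 0) k * pd k W y + 2 * ψ y * W y
    + (2 - (n : ℝ)) / 2 * laplacian G ψ y = 0

section

variable {G : Coord n → Matrix (Fin n) (Fin n) ℝ} {W : Coord n → ℝ} {U : Set (Coord n)}
  {ξ : Coord n × ℝ → Coord n} {η : Coord n × ℝ → ℝ}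

lemma kgEquation_eq (y : Coord n) (u : ℝ) (p : Fin n → ℝ) (q : Fin n → Fin n → ℝ) :
    kgEquation G W (y, u, p, q) = ∑ i, ∑ j, (G y)⁻¹ i j * q i j
      + (∑ j, drift G j y * p j + W y * u) := by
  rw [← add_assoc]; rfl

lemma IsMetricOn.exists_inv_ne_zero (hG : IsMetricOn G U) (hn : n ≠ 0) {y : Coord n}
    (hy : y ∈ U) : ∃ i j, (G y)⁻¹ i j ≠ 0 := by
  by_contra! H
  have h0 : (G y)⁻¹ = 0 := by ext i j; exact H i j
  have h1 := Matrix.nonsing_inv_mul _ (hG.isUnit_det hy)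
  rw [h0, zero_mul] at h1
  have := congrFun (congrFun h1 ⟨0, Nat.pos_of_ne_zero hn⟩) ⟨0, Nat.pos_of_ne_zero hn⟩
  simp at this

lemma IsMetricOn.lieInv_symm (hG : IsMetricOn G U) {y : Coord n} (hy : y ∈ U) (u : ℝ)
    (i j : Fin n) : lieInv G ξ (y, u) i j = lieInv G ξ (y, u) j i := by
  simp only [lieInv]
  congr 1
  · rw [fderiv_congr_on hG.isOpen (fun z hz => hG.inv_symm hz i j) hy]
  · refine Finset.sum_congr rfl fun k _ => ?_
    rw [hG.inv_symm hy k j, hG.inv_symm hy i k, add_comm]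

/-- Comparing the coefficients of the second derivatives in `X^{[2]} H = m H` shows that `ξ` does
not depend on `u` and that `g⁻¹` is conformally invariant. -/
lemma IsLieSymmetryOn.second_order (hL : IsLieSymmetryOn G W ξ η U) (hG : IsMetricOn G U)
    (hn : 2 ≤ n) (hW : ContDiffOn ℝ ∞ W U) {y : Coord n} (hy : y ∈ U) (u : ℝ) :
    (∀ k, dU (fun w => ξ w k) (y, u) = 0) ∧
      ∃ m, ∀ i j, lieInv G ξ (y, u) i j = m * (G y)⁻¹ i j := by
  set h := (G y)⁻¹ with hh
  have hs : ∀ i j, h i j = h j i := hG.inv_symm hy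
  set w : Fin n → ℝ := fun k => dU (fun w => ξ w k) (y, u) with hw
  set E : Fin n → Fin n → ℝ := lieInv G ξ (y, u) with hE
  set c := dU η (y, u)
  have mult : ∀ p : Fin n → ℝ, ∃ m : ℝ, ∀ q : Fin n → Fin n → ℝ, (∀ i j, q i j = q j i) →
      ∑ i, ∑ j, (E i j + (c - ∑ k, w k * p k) * h i j - 2 * (∑ k, h i k * p k) * w j) * q i j
        = m * ∑ i, ∑ j, h i j * q i j := by
    intro p
    obtain ⟨m, hm⟩ := exists_multiplier (h := h)
      (S := fun i j => E i j + (c - ∑ k, w k * p k) * h i j - 2 * (∑ k, h i k * p k) * w j)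
      (c := prolong2 ξ η (kgEquation G W) (y, u, p, 0)) (d := ∑ j, drift G j y * p j + W y * u)
      hs (hG.exists_inv_ne_zero (by omega) hy) (fun q hq hz => by
        rw [← kgEquation_eq] at hz
        have := hL y hy u p q hq hz
        rwa [prolong2_kgEquation_affine hG hW hy ξ η u p q hq] at this)
    refine ⟨m, fun q hq => ?_⟩
    have h0 := hm 0 (fun _ _ => rfl)
    have h1 := hm q hq
    simp only [Pi.zero_apply, mul_zero, Finset.sum_const_zero, zero_add] at h0
    rw [h0, mul_add] at h1
    linarith
  obtain ⟨m0, hm0⟩ := mult 0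
  have hm0' : ∀ q : Fin n → Fin n → ℝ, (∀ i j, q i j = q j i) →
      ∑ i, ∑ j, E i j * q i j = (m0 - c) * ∑ i, ∑ j, h i j * q i j := by
    intro q hq
    have := hm0 q hq
    simp only [Pi.zero_apply, mul_zero, Finset.sum_const_zero, sub_zero, zero_mul, add_mul,
      Finset.sum_add_distrib, mul_assoc, ← Finset.mul_sum] at this
    linarith
  -- the covector `p = g w` makes the rank-one term equal to `w wᵀ`
  obtain ⟨m1, hm1⟩ := mult ((G y).mulVec w)
  have hp : ∀ i, ∑ k, h i k * (G y).mulVec w k = w i := by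
    intro i
    have : h.mulVec ((G y).mulVec w) = w := by
      rw [Matrix.mulVec_mulVec, Matrix.nonsing_inv_mul _ (hG.isUnit_det hy), Matrix.one_mulVec]
    exact congrFun this i
  have hdet : IsUnit h.det := Matrix.isUnit_nonsing_inv_det _ (hG.isUnit_det hy)
  have hw0 : w = 0 := by
    refine eq_zero_of_rank_one (h := h) (m := (m0 - m1 - ∑ k, w k * (G y).mulVec w k) / 2) hn hdet
      (fun q hq => ?_) (Matrix.IsSymm.ext fun i j => hs j i)
    have h1 := hm1 q hq
    simp only [hp] at h1
    have h2 := hm0' q hq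
    have h3 : ∑ i, ∑ j, (E i j + (c - ∑ k, w k * (G y).mulVec w k) * h i j
        - 2 * w i * w j) * q i j = ∑ i, ∑ j, E i j * q i j
          + (c - ∑ k, w k * (G y).mulVec w k) * ∑ i, ∑ j, h i j * q i j
          - 2 * ∑ i, ∑ j, w i * w j * q i j := by
      simp only [Finset.mul_sum, ← Finset.sum_add_distrib, ← Finset.sum_sub_distrib]
      exact Finset.sum_congr rfl fun i _ => Finset.sum_congr rfl fun j _ => by ring
    rw [h3, h2] at h1
    linarith
  refine ⟨fun k => congrFun hw0 k, m0 - c, fun i j => ?_⟩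
  exact eq_of_forall_symm hs (hG.lieInv_symm hy u) hm0' i j

lemma smooth_slice {F : Coord n × ℝ → ℝ} (hF : ContDiffOn ℝ ∞ F (U ×ˢ Set.univ)) (u : ℝ) :
    ContDiffOn ℝ ∞ (fun y => F (y, u)) U :=
  hF.comp (contDiffOn_id.prodMk contDiffOn_const) fun _ hy => ⟨hy, Set.mem_univ _⟩

/-- For a field which does not depend on `u`, the conformal Killing equation is the one of the
inverse metric. -/
lemma IsMetricOn.conformal_iff_lieInv (hG : IsMetricOn G U)
    (hξ : ∀ k, ContDiffOn ℝ ∞ (fun z => ξ z k) (U ×ˢ Set.univ))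
    (hind : ∀ y ∈ U, ∀ u, ξ (y, u) = ξ (y, 0)) {y : Coord n} (hy : y ∈ U) (u c : ℝ) :
    (∀ i j, lieDerivMetric G (fun z => ξ (z, 0)) y i j = 2 * c * G y i j) ↔
      ∀ i j, lieInv G ξ (y, u) i j = -2 * c * (G y)⁻¹ i j := by
  rw [hG.conformal_iff_inv hy]
  refine forall_congr' fun i => forall_congr' fun j => ?_
  have hd : ∀ k i, dX i (fun w => ξ w k) (y, u) = pd i (fun z => ξ (z, 0) k) y := fun k i =>
    dX_indep hG.isOpen (fun z hz u => by rw [hind z hz u]) hy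
      (differentiableAt_of_contDiffOn (smooth_slice (hξ k) 0) hG.isOpen hy) u i
  simp only [lieInv, hd, hind y hy u]
  constructor <;> intro h <;> linarith

lemma indep_of_dU_eq_zero (hU : IsOpen U)
    (hξ : ∀ k, ContDiffOn ℝ ∞ (fun z => ξ z k) (U ×ˢ Set.univ))
    (h0 : ∀ y ∈ U, ∀ u k, dU (fun w => ξ w k) (y, u) = 0) :
    ∀ y ∈ U, ∀ u, ξ (y, u) = ξ (y, 0) := by
  intro y hy u
  ext k
  have := eq_quadratic_of_dU (F := fun w => ξ w k) (y := y) (a := 0) (σ := 0)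
    (fun u => differentiableAt_of_contDiffOn (hξ k) (hU.prod isOpen_univ)
      ⟨hy, Set.mem_univ _⟩) (fun u => by rw [h0 y hy u k]; ring) u
  simpa using this

lemma laplacian_eq (hG : IsMetricOn G U) {f : Coord n → ℝ} (hf : ContDiffOn ℝ ∞ f U) {y : Coord n}
    (hy : y ∈ U) : laplacian G f y
      = ∑ i, ∑ j, (G y)⁻¹ i j * pd i (pd j f) y + ∑ j, drift G j y * pd j f y := by
  have dif : ∀ {f : Coord n → ℝ}, ContDiffOn ℝ ∞ f U → DifferentiableAt ℝ f y := fun hf =>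
    differentiableAt_of_contDiffOn hf hG.isOpen hy
  have sK : ∀ i j, ContDiffOn ℝ ∞ (fun z => sqrtDet G z * (G z)⁻¹ i j) U := fun i j =>
    hG.smooth_sqrtDet.mul (hG.smooth_inv i j)
  have sf : ∀ j, ContDiffOn ℝ ∞ (pd j f) U := fun j => contDiffOn_pd hf hG.isOpen j
  have e1 : ∀ i, pd i (fun y => sqrtDet G y * ∑ j, (G y)⁻¹ i j * pd j f y) y
      = ∑ j, (sqrtDet G y * (G y)⁻¹ i j * pd i (pd j f) y
        + pd i (fun z => sqrtDet G z * (G z)⁻¹ i j) y * pd j f y) := by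
    intro i
    have : (fun y => sqrtDet G y * ∑ j, (G y)⁻¹ i j * pd j f y)
        = fun y => ∑ j, (sqrtDet G y * (G y)⁻¹ i j) * pd j f y := by
      funext y; rw [Finset.mul_sum]; exact Finset.sum_congr rfl fun j _ => by ring
    rw [this, pd_sum fun j _ => (dif (sK i j)).fun_mul (dif (sf j))]
    exact Finset.sum_congr rfl fun j _ => pd_mul (dif (sK i j)) (dif (sf j)) i
  rw [laplacian, Finset.sum_congr rfl fun i _ => e1 i]
  simp only [Finset.sum_add_distrib, mul_add, Finset.mul_sum, drift, Finset.sum_mul]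
  have s0 := (hG.sqrtDet_pos hy).ne'
  congr 1
  · refine Finset.sum_congr rfl fun i _ => Finset.sum_congr rfl fun j _ => ?_
    field_simp
  · rw [Finset.sum_comm]
    exact Finset.sum_congr rfl fun i _ => Finset.sum_congr rfl fun j _ => by ring

lemma laplacian_congr_grad (hU : IsOpen U) {f g : Coord n → ℝ} {c : ℝ}
    (h : ∀ y ∈ U, ∀ i, pd i f y = c * pd i g y) {y : Coord n} (hy : y ∈ U)
    (hG : IsMetricOn G U) (hg : ContDiffOn ℝ ∞ g U) (hf : ContDiffOn ℝ ∞ f U) :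
    laplacian G f y = c * laplacian G g y := by
  rw [laplacian_eq hG hf hy, laplacian_eq hG hg hy, mul_add, Finset.mul_sum, Finset.mul_sum]
  congr 1
  · refine Finset.sum_congr rfl fun i _ => ?_
    rw [Finset.mul_sum]
    refine Finset.sum_congr rfl fun j _ => ?_
    rw [pd_congr_on hU (fun z hz => h z hz j) hy, pd_const_mul
      (differentiableAt_of_contDiffOn (contDiffOn_pd hg hU j) hU hy)]
    ring
  · exact Finset.sum_congr rfl fun j _ => by rw [h y hy j]; ring

/-- For a conformal Killing vector `ξ`, the function `X^{[2]} H` is a multiple of `H` up to terms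
which do not involve the second derivatives. -/
lemma prolong2_of_conformal (hG : IsMetricOn G U) (hW : ContDiffOn ℝ ∞ W U)
    (hξ : ∀ k, ContDiffOn ℝ ∞ (fun z => ξ z k) (U ×ˢ Set.univ))
    {ψ : Coord n → ℝ} (hψ : ContDiffOn ℝ ∞ ψ U)
    (hind : ∀ y ∈ U, ∀ u, ξ (y, u) = ξ (y, 0))
    (hc : ∀ y ∈ U, ∀ i j, lieDerivMetric G (fun z => ξ (z, 0)) y i j = 2 * ψ y * G y i j)
    {y : Coord n} (hy : y ∈ U) (u : ℝ) (p : Fin n → ℝ) (q : Fin n → Fin n → ℝ)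
    (hq : ∀ i j, q i j = q j i) :
    prolong2 ξ η (kgEquation G W) (y, u, p, q)
      = (dU η (y, u) - 2 * ψ y) * kgEquation G W (y, u, p, q)
        + ∑ j, (∑ i, (G y)⁻¹ i j * (dX i (dU η) (y, u) + dX i (dU η) (y, u)
            + (n - 2) * pd i ψ y)) * p j
        + dU (dU η) (y, u) * ∑ i, ∑ j, (G y)⁻¹ i j * (p i * p j)
        + (fderiv ℝ W y (ξ (y, 0)) * u + 2 * ψ y * W y * u
          + ∑ i, ∑ j, (G y)⁻¹ i j * dX i (dX j η) (y, u) + ∑ j, drift G j y * dX j η (y, u)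
          + W y * η (y, u) - dU η (y, u) * W y * u) := by
  have hU := hG.isOpen
  have sζ : ∀ k, ContDiffOn ℝ ∞ (fun z => ξ (z, 0) k) U := fun k => smooth_slice (hξ k) 0
  have dif : ∀ {f : Coord n → ℝ}, ContDiffOn ℝ ∞ f U → ∀ {z}, z ∈ U → DifferentiableAt ℝ f z :=
    fun hf _ hz => differentiableAt_of_contDiffOn hf hU hz
  have d1 : ∀ k i, ∀ z ∈ U, ∀ u, dX i (fun w => ξ w k) (z, u) = pd i (fun z => ξ (z, 0) k) z :=
    fun k i z hz u => dX_indep hU (fun z hz u => by rw [hind z hz u]) hz (dif (sζ k) hz) u i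
  have d0 : ∀ k, ∀ z ∈ U, ∀ u, dU (fun w => ξ w k) (z, u) = 0 :=
    fun k z hz u => dU_indep hU (b := fun z => ξ (z, 0) k) (fun z hz u => by rw [hind z hz u]) hz
      (dif (sζ k) hz) u
  have d11 : ∀ k i j, dX i (dX j (fun w => ξ w k)) (y, u) = pd i (pd j (fun z => ξ (z, 0) k)) y :=
    fun k i j => dX_indep hU (d1 k j) hy (dif (contDiffOn_pd (sζ k) hU j) hy) u i
  have d10 : ∀ k i, dX i (dU (fun w => ξ w k)) (y, u) = 0 := fun k i => by
    rw [dX_indep (b := fun _ => 0) hU (d0 k) hy (differentiableAt_const _) u i]; simp [pd]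
  have d00 : ∀ k, dU (dU (fun w => ξ w k)) (y, u) = 0 := fun k =>
    dU_indep (b := fun _ => 0) hU (d0 k) hy (differentiableAt_const _) u
  have hinv := (hG.conformal_iff_lieInv hξ hind hy u (ψ y)).1 (hc y hy)
  rw [prolong2_kgEquation_affine hG hW hy ξ η u p q hq, kgEquation_eq]
  have eq1 : ∑ i, ∑ j, (lieInv G ξ (y, u) i j
          + (dU η (y, u) - ∑ k, dU (fun w => ξ w k) (y, u) * p k) * (G y)⁻¹ i j
          - 2 * (∑ k, (G y)⁻¹ i k * p k) * dU (fun w => ξ w j) (y, u)) * q i j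
      = (dU η (y, u) - 2 * ψ y) * ∑ i, ∑ j, (G y)⁻¹ i j * q i j := by
    simp only [Finset.mul_sum]
    refine Finset.sum_congr rfl fun i _ => Finset.sum_congr rfl fun j _ => ?_
    simp only [d0 _ y hy u, hinv, zero_mul, Finset.sum_const_zero]
    ring
  rw [eq1, prolong2, fderiv_kgEquation hG hW hy]
  set ζ : Coord n → Coord n := fun z => ξ (z, 0) with hζ
  have hB := fun j => hG.fderiv_drift_of_conformal (ζ := ζ) sζ hψ hc hy j
  set h := (G y)⁻¹ with hh
  have hs : ∀ i j, h i j = h j i := hG.inv_symm hy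
  have e1 : ∀ j, eta1 ξ η (y, u, p) j = dX j η (y, u) + p j * dU η (y, u)
      - ∑ k, pd j (fun z => ζ z k) y * p k := by
    intro j
    simp only [eta1, d0 _ y hy u, d1 _ _ y hy u, mul_zero, Finset.sum_const_zero, sub_zero, hζ]
  have e2 : ∀ i j, eta2 ξ η (y, u, p, 0) i j = dX i (dX j η) (y, u)
      + (dX i (dU η) (y, u) * p j + dX j (dU η) (y, u) * p i)
      - ∑ k, pd i (pd j (fun z => ζ z k)) y * p k + dU (dU η) (y, u) * p i * p j := by
    intro i j
    simp only [eta2, d11, d10, d00, d0 _ y hy u, mul_zero, zero_mul, add_zero,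
      Finset.sum_const_zero, sub_zero, Pi.zero_apply, hζ]
  have hξ0 : ξ (y, u) = ζ y := hind y hy u
  simp only [hξ0, e1, e2, hB, Pi.zero_apply, zero_mul, add_zero]
  have s1 : ∑ i, ∑ j, h i j * (dX i (dX j η) (y, u)
      + (dX i (dU η) (y, u) * p j + dX j (dU η) (y, u) * p i)
      - ∑ k, pd i (pd j (fun z => ζ z k)) y * p k + dU (dU η) (y, u) * p i * p j)
      = ∑ i, ∑ j, h i j * dX i (dX j η) (y, u) + 2 * ∑ j, (∑ i, h i j * dX i (dU η) (y, u)) * p j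
        - ∑ k, (∑ i, ∑ j, h i j * pd i (pd j (fun z => ζ z k)) y) * p k
        + dU (dU η) (y, u) * ∑ i, ∑ j, h i j * (p i * p j) := by
    have t1 : ∑ j, (∑ i, h i j * dX i (dU η) (y, u)) * p j
        = ∑ i, ∑ j, h i j * (dX i (dU η) (y, u) * p j) := by
      rw [Finset.sum_comm]
      refine Finset.sum_congr rfl fun j _ => ?_
      rw [Finset.sum_mul]
      exact Finset.sum_congr rfl fun i _ => by ring
    have t2 : ∑ i, ∑ j, h i j * (dX j (dU η) (y, u) * p i)
        = ∑ i, ∑ j, h i j * (dX i (dU η) (y, u) * p j) := by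
      rw [Finset.sum_comm]
      exact Finset.sum_congr rfl fun j _ => Finset.sum_congr rfl fun i _ => by rw [hs]
    have t3 : ∑ k, (∑ i, ∑ j, h i j * pd i (pd j (fun z => ζ z k)) y) * p k
        = ∑ i, ∑ j, h i j * ∑ k, pd i (pd j (fun z => ζ z k)) y * p k := by
      simp only [Finset.mul_sum, Finset.sum_mul]
      rw [Finset.sum_comm]
      refine Finset.sum_congr rfl fun i _ => ?_
      rw [Finset.sum_comm]
      exact Finset.sum_congr rfl fun j _ => Finset.sum_congr rfl fun k _ => by ring
    have l : ∀ i j, h i j * (dX i (dX j η) (y, u)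
        + (dX i (dU η) (y, u) * p j + dX j (dU η) (y, u) * p i)
        - ∑ k, pd i (pd j (fun z => ζ z k)) y * p k + dU (dU η) (y, u) * p i * p j)
        = h i j * dX i (dX j η) (y, u) + h i j * (dX i (dU η) (y, u) * p j)
          + h i j * (dX j (dU η) (y, u) * p i)
          - h i j * ∑ k, pd i (pd j (fun z => ζ z k)) y * p k
          + dU (dU η) (y, u) * (h i j * (p i * p j)) := fun i j => by ring
    simp only [l, Finset.sum_add_distrib, Finset.sum_sub_distrib, t2, ← Finset.mul_sum]
    rw [t1, t3]
    ring
  have s2 : ∑ j, (drift G j y * (dX j η (y, u) + p j * dU η (y, u)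
        - ∑ k, pd j (fun z => ζ z k) y * p k)
      + p j * ((n - 2) * ∑ i, h i j * pd i ψ y - 2 * ψ y * drift G j y
        + ∑ m, drift G m y * pd m (fun z => ζ z j) y
        + ∑ i, ∑ m, h i m * pd i (pd m (fun z => ζ z j)) y))
      = ∑ j, drift G j y * dX j η (y, u) + (dU η (y, u) - 2 * ψ y) * ∑ j, drift G j y * p j
        + ∑ j, ((n - 2) * ∑ i, h i j * pd i ψ y) * p j
        + ∑ j, (∑ i, ∑ m, h i m * pd i (pd m (fun z => ζ z j)) y) * p j := by
    have t : ∑ j, drift G j y * ∑ k, pd j (fun z => ζ z k) y * p k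
        = ∑ j, p j * ∑ m, drift G m y * pd m (fun z => ζ z j) y := by
      simp only [Finset.mul_sum]
      rw [Finset.sum_comm]
      exact Finset.sum_congr rfl fun j _ => Finset.sum_congr rfl fun k _ => by ring
    have l : ∀ j, drift G j y * (dX j η (y, u) + p j * dU η (y, u)
        - ∑ k, pd j (fun z => ζ z k) y * p k)
      + p j * ((n - 2) * ∑ i, h i j * pd i ψ y - 2 * ψ y * drift G j y
        + ∑ m, drift G m y * pd m (fun z => ζ z j) y
        + ∑ i, ∑ m, h i m * pd i (pd m (fun z => ζ z j)) y)
        = drift G j y * dX j η (y, u) + (dU η (y, u) - 2 * ψ y) * (drift G j y * p j)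
          + ((n - 2) * ∑ i, h i j * pd i ψ y) * p j
          + (∑ i, ∑ m, h i m * pd i (pd m (fun z => ζ z j)) y) * p j
          - drift G j y * ∑ k, pd j (fun z => ζ z k) y * p k
          + p j * ∑ m, drift G m y * pd m (fun z => ζ z j) y := fun j => by ring
    rw [Finset.sum_congr rfl fun j _ => l j]
    rw [Finset.sum_add_distrib, Finset.sum_sub_distrib, Finset.sum_add_distrib,
      Finset.sum_add_distrib, Finset.sum_add_distrib, t, Finset.mul_sum]
    ring
  rw [s1, s2]
  have s3 : ∑ j, (∑ i, h i j * (dX i (dU η) (y, u) + dX i (dU η) (y, u)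
            + (n - 2) * pd i ψ y)) * p j
      = 2 * ∑ j, (∑ i, h i j * dX i (dU η) (y, u)) * p j
        + ∑ j, ((n - 2) * ∑ i, h i j * pd i ψ y) * p j := by
    rw [Finset.mul_sum, ← Finset.sum_add_distrib]
    refine Finset.sum_congr rfl fun j _ => ?_
    rw [Finset.mul_sum, Finset.sum_mul, Finset.sum_mul, Finset.sum_mul, Finset.mul_sum,
      ← Finset.sum_add_distrib]
    exact Finset.sum_congr rfl fun i _ => by ring
  rw [s3]
  ring

end

section

variable {G : Coord n → Matrix (Fin n) (Fin n) ℝ} {W : Coord n → ℝ} {U : Set (Coord n)}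
  {ξ : Coord n × ℝ → Coord n} {η : Coord n × ℝ → ℝ}

lemma IsMetricOn.eq_zero_of_inv_mul (hG : IsMetricOn G U) {y : Coord n} (hy : y ∈ U)
    {v : Fin n → ℝ} (hv : ∀ j, ∑ i, (G y)⁻¹ i j * v i = 0) : v = 0 := by
  have h1 : (G y)⁻¹.mulVec v = 0 := by
    funext j
    simp only [Matrix.mulVec, dotProduct, Pi.zero_apply]
    rw [← hv j]
    exact Finset.sum_congr rfl fun i _ => by rw [hG.inv_symm hy]
  have := congrArg (G y).mulVec h1
  rwa [Matrix.mulVec_mulVec, Matrix.mul_nonsing_inv _ (hG.isUnit_det hy), Matrix.one_mulVec,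
    Matrix.mulVec_zero] at this

lemma IsMetricOn.exists_quadratic_ne_zero (hG : IsMetricOn G U) (hn : n ≠ 0) {y : Coord n}
    (hy : y ∈ U) : ∃ p : Fin n → ℝ, ∑ i, ∑ j, (G y)⁻¹ i j * (p i * p j) ≠ 0 := by
  by_contra! H
  obtain ⟨i, j, hij⟩ := hG.exists_inv_ne_zero hn hy
  exact hij (eq_of_quadratic (h := 0) (fun _ _ => rfl) (hG.inv_symm hy)
    (fun p => by rw [H p]; simp) i j)

/-- A symmetric jet with prescribed `(x, u, u_i)` on which `H = 0`. -/
lemma IsMetricOn.exists_jet (hG : IsMetricOn G U) (hn : n ≠ 0) {y : Coord n} (hy : y ∈ U) (u : ℝ)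
    (p : Fin n → ℝ) : ∃ q : Fin n → Fin n → ℝ, (∀ i j, q i j = q j i) ∧
      kgEquation G W (y, u, p, q) = 0 := by
  obtain ⟨r, hr⟩ := hG.exists_quadratic_ne_zero hn hy
  set N := ∑ i, ∑ j, (G y)⁻¹ i j * (r i * r j)
  set d := ∑ j, drift G j y * p j + W y * u with hd
  refine ⟨fun i j => -(d / N) * (r i * r j), fun i j => by ring, ?_⟩
  rw [kgEquation_eq, ← hd]
  have : ∑ i, ∑ j, (G y)⁻¹ i j * (-(d / N) * (r i * r j)) = -(d / N) * N := by
    simp only [N, Finset.mul_sum]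
    exact Finset.sum_congr rfl fun i _ => Finset.sum_congr rfl fun j _ => by ring
  rw [this]
  field_simp
  ring

/-- A polynomial in `p` of degree three vanishes only if its homogeneous parts do. -/
lemma homogeneous_parts_eq_zero {β : Fin n → ℝ} {C Q : (Fin n → ℝ) → ℝ} {c : ℝ}
    (hC : ∀ (t : ℝ) p, C (fun i => t * p i) = t ^ 3 * C p)
    (hQ : ∀ (t : ℝ) p, Q (fun i => t * p i) = t ^ 2 * Q p)
    (H : ∀ p, C p + Q p + ∑ j, β j * p j + c = 0) :
    c = 0 ∧ β = 0 ∧ (∀ p, Q p = 0) ∧ ∀ p, C p = 0 := by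
  have h1 : ∀ p (t : ℝ), t ^ 3 * C p + t ^ 2 * Q p + t * ∑ j, β j * p j + c = 0 := by
    intro p t
    rw [← H (fun i => t * p i), hQ, hC, Finset.mul_sum]
    congr 2
    exact Finset.sum_congr rfl fun j _ => by ring
  have hc : c = 0 := by simpa using h1 0 0
  have hp : ∀ p, Q p = 0 := fun p => by linarith [h1 p 1, h1 p (-1)]
  have hp' : ∀ p, C p = 0 := fun p => by linarith [h1 p 1, h1 p 2, hp p]
  refine ⟨hc, funext fun j => ?_, hp, hp'⟩
  have := h1 (Pi.single j 1) 1
  rw [hp, hp', hc] at this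
  simpa [Pi.single_apply] using this

lemma quadratic_smul (T : Matrix (Fin n) (Fin n) ℝ) (t : ℝ) (p : Fin n → ℝ) :
    ∑ i, ∑ j, T i j * ((t * p i) * (t * p j)) = t ^ 2 * ∑ i, ∑ j, T i j * (p i * p j) := by
  simp only [Finset.mul_sum]
  exact Finset.sum_congr rfl fun i _ => Finset.sum_congr rfl fun j _ => by ring

lemma IsLieSymmetryOn.isConformalOn (hL : IsLieSymmetryOn G W ξ η U) (hG : IsMetricOn G U)
    (hn : 2 ≤ n) (hW : ContDiffOn ℝ ∞ W U)
    (hξ : ∀ k, ContDiffOn ℝ ∞ (fun z => ξ z k) (U ×ˢ Set.univ))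
    (hη : ContDiffOn ℝ ∞ η (U ×ˢ Set.univ)) :
    IsConformalOn G W ξ η U (confFactor G fun z => ξ (z, 0)) (fun y => dU η (y, 0))
      (fun y => η (y, 0)) := by
  have hU := hG.isOpen
  have hUu : IsOpen (U ×ˢ (Set.univ : Set ℝ)) := hU.prod isOpen_univ
  have hn0 : n ≠ 0 := by omega
  have hind := indep_of_dU_eq_zero hU hξ fun y hy u => (hL.second_order hG hn hW hy u).1
  set ψ := confFactor G fun z => ξ (z, 0) with hψ
  have sψ : ContDiffOn ℝ ∞ ψ U := hG.smooth_confFactor fun k => smooth_slice (hξ k) 0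
  have hc : ∀ y ∈ U, ∀ i j, lieDerivMetric G (fun z => ξ (z, 0)) y i j = 2 * ψ y * G y i j := by
    intro y hy
    obtain ⟨m, hm⟩ := (hL.second_order hG hn hW hy 0).2
    have h1 := (hG.conformal_iff_lieInv hξ hind hy 0 (-m / 2)).2 fun i j => by rw [hm i j]; ring
    rw [hψ, ← hG.eq_confFactor hn0 hy h1]
    exact h1
  -- the remaining terms form a polynomial of degree two in the first derivatives
  have R : ∀ y ∈ U, ∀ u, _ ∧ _ ∧ _ ∧ _ := fun y hy u =>
    homogeneous_parts_eq_zero (C := fun _ => 0)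
      (β := fun j => ∑ i, (G y)⁻¹ i j * (dX i (dU η) (y, u)
        + dX i (dU η) (y, u) + (n - 2) * pd i ψ y))
      (Q := fun p => dU (dU η) (y, u) * ∑ i, ∑ j, (G y)⁻¹ i j * (p i * p j))
      (c := fderiv ℝ W y (ξ (y, 0)) * u + 2 * ψ y * W y * u
          + ∑ i, ∑ j, (G y)⁻¹ i j * dX i (dX j η) (y, u) + ∑ j, drift G j y * dX j η (y, u)
          + W y * η (y, u) - dU η (y, u) * W y * u)
      (fun _ _ => (mul_zero _).symm)
      (fun t p => (congrArg (dU (dU η) (y, u) * ·) (quadratic_smul (G y)⁻¹ t p)).trans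
        (mul_left_comm _ _ _))
      (fun p => by
        obtain ⟨q, hq, hz⟩ := hG.exists_jet (W := W) hn0 hy u p
        have := hL y hy u p q hq hz
        rw [prolong2_of_conformal hG hW hξ sψ hind hc hy u p q hq, hz] at this
        linarith)
  have huu : ∀ y ∈ U, ∀ u, dU (dU η) (y, u) = 0 := by
    intro y hy u
    obtain ⟨p, hp⟩ := hG.exists_quadratic_ne_zero hn0 hy
    exact (mul_eq_zero.1 ((R y hy u).2.2.1 p)).resolve_right hp
  have sU : ContDiffOn ℝ ∞ (dU η) (U ×ˢ Set.univ) := contDiffOn_dU hη hUu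
  have hσ : ∀ y ∈ U, ∀ u, dU η (y, u) = dU η (y, 0) := by
    intro y hy u
    have := eq_quadratic_of_dU (F := dU η) (y := y) (a := 0) (σ := 0)
      (fun u => differentiableAt_of_contDiffOn sU hUu ⟨hy, Set.mem_univ _⟩)
      (fun u => by rw [huu y hy u]; ring) u
    simpa using this
  have hηeq : ∀ y ∈ U, ∀ u, η (y, u) = dU η (y, 0) * u + η (y, 0) := by
    intro y hy u
    have := eq_quadratic_of_dU (F := η) (y := y) (a := 0) (σ := dU η (y, 0))
      (fun u => differentiableAt_of_contDiffOn hη hUu ⟨hy, Set.mem_univ _⟩)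
      (fun u => by rw [hσ y hy u]; ring) u
    simpa using this
  have sσ : ContDiffOn ℝ ∞ (fun y => dU η (y, 0)) U := smooth_slice sU 0
  have sb : ContDiffOn ℝ ∞ (fun y => η (y, 0)) U := smooth_slice hη 0
  have dif : ∀ {f : Coord n → ℝ}, ContDiffOn ℝ ∞ f U → ∀ {z}, z ∈ U → DifferentiableAt ℝ f z :=
    fun hf _ hz => differentiableAt_of_contDiffOn hf hU hz
  have hX : ∀ j, ∀ y ∈ U, ∀ u, dX j η (y, u)
      = pd j (fun y => dU η (y, 0)) y * u + pd j (fun y => η (y, 0)) y := fun j y hy u =>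
    dX_affine hU hηeq hy (dif sσ hy) (dif sb hy) u j
  have hXX : ∀ i j, ∀ y ∈ U, ∀ u, dX i (dX j η) (y, u)
      = pd i (pd j (fun y => dU η (y, 0))) y * u + pd i (pd j (fun y => η (y, 0))) y :=
    fun i j y hy u => dX_affine hU (hX j) hy (dif (contDiffOn_pd sσ hU j) hy)
      (dif (contDiffOn_pd sb hU j) hy) u i
  have hgrad : ∀ y ∈ U, ∀ i, pd i (fun y => dU η (y, 0)) y = (2 - (n : ℝ)) / 2 * pd i ψ y := by
    intro y hy i
    have h1 := congrFun (hG.eq_zero_of_inv_mul hy (fun j => congrFun (R y hy 0).2.1 j)) i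
    rw [dX_indep hU hσ hy (dif sσ hy)] at h1
    simp only [Pi.zero_apply] at h1
    linarith
  have h0 : ∀ y ∈ U, ∀ u, (∑ k, ξ (y, 0) k * pd k W y + 2 * ψ y * W y
      + laplacian G (fun y => dU η (y, 0)) y) * u
      + (laplacian G (fun y => η (y, 0)) y + W y * η (y, 0)) = 0 := by
    intro y hy u
    have h1 := (R y hy u).1
    rw [laplacian_eq hG sσ hy, laplacian_eq hG sb hy]
    simp only [hXX _ _ y hy, hX _ y hy, hσ y hy u, hηeq y hy u, mul_add,
      Finset.sum_add_distrib, ← mul_assoc, ← Finset.sum_mul, fderiv_eq_sum_pd] at h1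
    linarith
  refine ⟨sψ, sσ, sb, hind, hc, hηeq, hgrad, fun y hy => ?_, fun y hy => ?_⟩
  · simpa using h0 y hy 0
  · rw [← laplacian_congr_grad hU hgrad hy hG sψ sσ]
    have a0 := h0 y hy 0
    have a1 := h0 y hy 1
    linarith

lemma IsConformalOn.isLieSymmetryOn {ψ σ b : Coord n → ℝ} (hC : IsConformalOn G W ξ η U ψ σ b)
    (hG : IsMetricOn G U) (hW : ContDiffOn ℝ ∞ W U)
    (hξ : ∀ k, ContDiffOn ℝ ∞ (fun z => ξ z k) (U ×ˢ Set.univ)) : IsLieSymmetryOn G W ξ η U := by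
  intro y hy u p q hq hz
  have hU := hG.isOpen
  have dif : ∀ {f : Coord n → ℝ}, ContDiffOn ℝ ∞ f U → ∀ {z}, z ∈ U → DifferentiableAt ℝ f z :=
    fun hf _ hz => differentiableAt_of_contDiffOn hf hU hz
  have hσ : ∀ y ∈ U, ∀ u, dU η (y, u) = σ y := fun y hy u =>
    dU_affine hU hC.η_eq hy (dif hC.smooth_σ hy) (dif hC.smooth_b hy) u
  have hX : ∀ j, ∀ y ∈ U, ∀ u, dX j η (y, u) = pd j σ y * u + pd j b y := fun j y hy u =>
    dX_affine hU hC.η_eq hy (dif hC.smooth_σ hy) (dif hC.smooth_b hy) u j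
  have hXX : ∀ i j, ∀ y ∈ U, ∀ u, dX i (dX j η) (y, u)
      = pd i (pd j σ) y * u + pd i (pd j b) y :=
    fun i j y hy u => dX_affine hU (hX j) hy (dif (contDiffOn_pd hC.smooth_σ hU j) hy)
      (dif (contDiffOn_pd hC.smooth_b hU j) hy) u i
  have huu : dU (dU η) (y, u) = 0 := dU_indep hU hσ hy (dif hC.smooth_σ hy) u
  have hXU : ∀ i, dX i (dU η) (y, u) = pd i σ y := fun i =>
    dX_indep hU hσ hy (dif hC.smooth_σ hy) u i
  rw [prolong2_of_conformal hG hW hξ hC.smooth_ψ hC.ξ_indep hC.conformal hy u p q hq, hz, huu,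
    hσ y hy u]
  have e1 : ∑ j, (∑ i, (G y)⁻¹ i j * (dX i (dU η) (y, u) + dX i (dU η) (y, u)
            + (n - 2) * pd i ψ y)) * p j = 0 := by
    refine Finset.sum_eq_zero fun j _ => ?_
    rw [Finset.sum_eq_zero fun i _ => ?_, zero_mul]
    rw [hXU, hC.grad y hy i]; ring
  have e2 := hC.solution y hy
  have e3 := hC.constraint y hy
  rw [← laplacian_congr_grad hU hC.grad hy hG hC.smooth_ψ hC.smooth_σ,
    laplacian_eq hG hC.smooth_σ hy] at e3
  rw [laplacian_eq hG hC.smooth_b hy] at e2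
  rw [e1]
  simp only [hXX _ _ y hy, hX _ y hy, hC.η_eq y hy u, mul_add,
      Finset.sum_add_distrib, ← mul_assoc, ← Finset.sum_mul, fderiv_eq_sum_pd]
  linear_combination u * e3 + e2

end

/-! ### Noether point symmetries in coordinates -/

section

variable {G : Coord n → Matrix (Fin n) (Fin n) ℝ} {W : Coord n → ℝ} {U : Set (Coord n)}
  {ξ : Coord n × ℝ → Coord n} {η : Coord n × ℝ → ℝ}

lemma fderiv_kgLagrangian (hG : IsMetricOn G U) (hW : ContDiffOn ℝ ∞ W U) {y : Coord n}
    (hy : y ∈ U) (u : ℝ) (p : Fin n → ℝ) (v : Jet1 n) :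
    fderiv ℝ (kgLagrangian G W) (y, u, p) v
      = 1 / 2 * ∑ i, ∑ j, fderiv ℝ (fun z => sqrtDet G z * (G z)⁻¹ i j) y v.1 * (p i * p j)
        + ∑ i, ∑ j, sqrtDet G y * (G y)⁻¹ i j * (v.2.2 i * p j)
        - 1 / 2 * fderiv ℝ (fun z => sqrtDet G z * W z) y v.1 * u ^ 2
        - sqrtDet G y * W y * u * v.2.1 := by
  have dif : ∀ {f : Coord n → ℝ}, ContDiffOn ℝ ∞ f U → DifferentiableAt ℝ f y := fun hf =>
    differentiableAt_of_contDiffOn hf hG.isOpen hy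
  have sK : ∀ i j, ContDiffOn ℝ ∞ (fun z => sqrtDet G z * (G z)⁻¹ i j) U := fun i j =>
    hG.smooth_sqrtDet.mul (hG.smooth_inv i j)
  have sW : ContDiffOn ℝ ∞ (fun z => sqrtDet G z * W z) U := hG.smooth_sqrtDet.mul hW
  let ℓp : Fin n → (Jet1 n →L[ℝ] ℝ) := fun j =>
    (ContinuousLinearMap.proj j).comp
      ((ContinuousLinearMap.snd ℝ ℝ _).comp (ContinuousLinearMap.snd ℝ (Coord n) _))
  let ℓu : Jet1 n →L[ℝ] ℝ :=
    (ContinuousLinearMap.fst ℝ ℝ _).comp (ContinuousLinearMap.snd ℝ (Coord n) _)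
  have h1 : HasFDerivAt (fun J : Jet1 n => ∑ i, ∑ j,
      (sqrtDet G J.1 * (G J.1)⁻¹ i j * ℓp i J) * ℓp j J) _ (y, u, p) :=
    HasFDerivAt.fun_sum fun i _ => HasFDerivAt.fun_sum fun j _ =>
      (hasFDerivAt_fst_mul_clm (f := fun z => sqrtDet G z * (G z)⁻¹ i j) (ℓp i)
        (dif (sK i j))).mul (ℓp j).hasFDerivAt
  have h2 : HasFDerivAt (fun J : Jet1 n => (sqrtDet G J.1 * W J.1 * ℓu J) * ℓu J) _ (y, u, p) :=
    (hasFDerivAt_fst_mul_clm (f := fun z => sqrtDet G z * W z) ℓu (dif sW)).mul ℓu.hasFDerivAt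
  have h3 := (h1.const_mul (1 / 2 : ℝ)).sub (h2.const_mul (1 / 2 : ℝ))
  have h4 : ∀ J : Jet1 n, kgLagrangian G W J
      = 1 / 2 * (∑ i, ∑ j, (sqrtDet G J.1 * (G J.1)⁻¹ i j * ℓp i J) * ℓp j J)
        - 1 / 2 * ((sqrtDet G J.1 * W J.1 * ℓu J) * ℓu J) := by
    intro J
    simp only [kgLagrangian, Finset.mul_sum]
    congr 1
    · exact Finset.sum_congr rfl fun i _ => Finset.sum_congr rfl fun j _ => by
        simp only [ℓp, ContinuousLinearMap.comp_apply]
        change 1 / 2 * sqrtDet G J.1 * ((G J.1)⁻¹ i j * J.2.2 i * J.2.2 j)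
          = 1 / 2 * (sqrtDet G J.1 * (G J.1)⁻¹ i j * J.2.2 i * J.2.2 j)
        ring
    · change 1 / 2 * sqrtDet G J.1 * W J.1 * J.2.1 ^ 2
          = 1 / 2 * (sqrtDet G J.1 * W J.1 * J.2.1 * J.2.1)
      ring
  rw [(h3.congr_of_eventuallyEq (Filter.Eventually.of_forall h4)).fderiv]
  simp only [_root_.sub_apply, _root_.add_apply, _root_.sum_apply, _root_.smul_apply, smul_eq_mul,
    ContinuousLinearMap.comp_apply]
  have hp : ∀ j, ℓp j (y, u, p) = p j := fun _ => rfl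
  have hpv : ∀ j, ℓp j v = v.2.2 j := fun _ => rfl
  have hu : ℓu (y, u, p) = u := rfl
  have huv : ℓu v = v.2.1 := rfl
  have hf : (ContinuousLinearMap.fst ℝ (Coord n) (ℝ × (Fin n → ℝ))) v = v.1 := rfl
  simp only [hp, hpv, hu, huv, hf]
  have sym : ∑ i, ∑ j, sqrtDet G y * (G y)⁻¹ i j * (v.2.2 j * p i)
      = ∑ i, ∑ j, sqrtDet G y * (G y)⁻¹ i j * (v.2.2 i * p j) := by
    rw [Finset.sum_comm]
    exact Finset.sum_congr rfl fun i _ => Finset.sum_congr rfl fun j _ => by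
      rw [hG.inv_symm hy]
  have l : ∀ i j, sqrtDet G y * (G y)⁻¹ i j * p i * v.2.2 j
      + p j * (sqrtDet G y * (G y)⁻¹ i j * v.2.2 i
        + p i * fderiv ℝ (fun z => sqrtDet G z * (G z)⁻¹ i j) y v.1)
      = fderiv ℝ (fun z => sqrtDet G z * (G z)⁻¹ i j) y v.1 * (p i * p j)
        + sqrtDet G y * (G y)⁻¹ i j * (v.2.2 j * p i)
        + sqrtDet G y * (G y)⁻¹ i j * (v.2.2 i * p j) := fun i j => by ring
  simp only [l, Finset.sum_add_distrib, sym]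
  ring

/-- The left-hand side of the Noether condition, sorted by degree in the first derivatives. -/
lemma noether_lhs_eq (hG : IsMetricOn G U) (hW : ContDiffOn ℝ ∞ W U) {y : Coord n}
    (hy : y ∈ U) (u : ℝ) (p : Fin n → ℝ) :
    prolong1 ξ η (kgLagrangian G W) (y, u, p)
      + kgLagrangian G W (y, u, p) * ∑ i, totalD i (fun z => ξ z i) (y, u, p)
    = -(1 / 2 * ((∑ i, ∑ j, sqrtDet G y * (G y)⁻¹ i j * (p i * p j))
          * ∑ k, dU (fun w => ξ w k) (y, u) * p k))
      + 1 / 2 * ∑ i, ∑ j, (fderiv ℝ (fun z => sqrtDet G z * (G z)⁻¹ i j) y (ξ (y, u))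
          + 2 * dU η (y, u) * (sqrtDet G y * (G y)⁻¹ i j)
          - ∑ k, (sqrtDet G y * (G y)⁻¹ k j * dX k (fun w => ξ w i) (y, u)
            + sqrtDet G y * (G y)⁻¹ i k * dX k (fun w => ξ w j) (y, u))
          + (∑ k, dX k (fun w => ξ w k) (y, u)) * (sqrtDet G y * (G y)⁻¹ i j)) * (p i * p j)
      + ∑ j, (sqrtDet G y * ∑ i, (G y)⁻¹ j i * dX i η (y, u)
          - 1 / 2 * sqrtDet G y * W y * u ^ 2 * dU (fun w => ξ w j) (y, u)) * p j
      + (-(1 / 2 * fderiv ℝ (fun z => sqrtDet G z * W z) y (ξ (y, u)) * u ^ 2)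
          - sqrtDet G y * W y * u * η (y, u)
          - 1 / 2 * sqrtDet G y * W y * u ^ 2 * ∑ k, dX k (fun w => ξ w k) (y, u)) := by
  rw [prolong1, fderiv_kgLagrangian hG hW hy]
  set k : Fin n → Fin n → ℝ := fun i j => sqrtDet G y * (G y)⁻¹ i j with hk
  have ks : ∀ i j, k i j = k j i := fun i j => by simp only [hk]; rw [hG.inv_symm hy]
  have kd : ∀ i j, sqrtDet G y * (G y)⁻¹ i j = k i j := fun _ _ => rfl
  have hLag : kgLagrangian G W (y, u, p)
      = 1 / 2 * ∑ i, ∑ j, k i j * (p i * p j) - 1 / 2 * sqrtDet G y * W y * u ^ 2 := by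
    simp only [kgLagrangian, hk, Finset.mul_sum]
    congr 1
    exact Finset.sum_congr rfl fun i _ => Finset.sum_congr rfl fun j _ => by ring
  have hlin : ∀ j, sqrtDet G y * ∑ i, (G y)⁻¹ j i * dX i η (y, u)
      = ∑ i, k j i * dX i η (y, u) := fun j => by
    rw [Finset.mul_sum]; exact Finset.sum_congr rfl fun i _ => by simp only [hk]; ring
  simp only [hLag, totalD, eta1, kd, hlin]
  set w : Fin n → ℝ := fun k => dU (fun w => ξ w k) (y, u) with hw
  have wd : ∀ k, dU (fun w => ξ w k) (y, u) = w k := fun _ => rfl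
  set Z : Fin n → Fin n → ℝ := fun k i => dX i (fun w => ξ w k) (y, u) with hZ
  have Zd : ∀ k i, dX i (fun w => ξ w k) (y, u) = Z k i := fun _ _ => rfl
  set D : Fin n → Fin n → ℝ := fun i j =>
    fderiv ℝ (fun z => sqrtDet G z * (G z)⁻¹ i j) y (ξ (y, u)) with hD
  have Dd : ∀ i j, fderiv ℝ (fun z => sqrtDet G z * (G z)⁻¹ i j) y (ξ (y, u)) = D i j :=
    fun _ _ => rfl
  simp only [wd, Zd, Dd]
  set c := dU η (y, u)
  set a : Fin n → ℝ := fun i => dX i η (y, u) with ha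
  have ad : ∀ i, dX i η (y, u) = a i := fun _ => rfl
  simp only [ad]
  have t1 : ∀ i j, k i j * ((a i + p i * c - ∑ m, Z m i * p m - ∑ m, p i * p m * w m) * p j)
      = k i j * a i * p j + c * (k i j * (p i * p j)) - k i j * (∑ m, Z m i * p m) * p j
        - (∑ m, w m * p m) * (k i j * (p i * p j)) := by
    intro i j
    have : ∑ m, p i * p m * w m = p i * ∑ m, w m * p m := by
      rw [Finset.mul_sum]; exact Finset.sum_congr rfl fun m _ => by ring
    rw [this]; ring
  have t2 : ∑ i, ∑ j, k i j * a i * p j = ∑ j, (∑ i, k j i * a i) * p j := by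
    rw [Finset.sum_comm]
    refine Finset.sum_congr rfl fun j _ => ?_
    rw [Finset.sum_mul]
    exact Finset.sum_congr rfl fun i _ => by rw [ks i j]
  have t3 : ∑ i, ∑ j, k i j * (∑ m, Z m i * p m) * p j
      = ∑ i, ∑ j, (∑ m, k m j * Z i m) * (p i * p j) := by
    simp only [Finset.mul_sum, Finset.sum_mul]
    have : ∀ i, ∑ j, ∑ m, k i j * (Z m i * p m) * p j = ∑ m, ∑ j, k i j * (Z m i * p m) * p j :=
      fun i => Finset.sum_comm
    simp only [this]
    rw [Finset.sum_comm]
    refine Finset.sum_congr rfl fun m _ => ?_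
    rw [Finset.sum_comm]
    exact Finset.sum_congr rfl fun j _ => Finset.sum_congr rfl fun i _ => by ring
  have t4 : ∑ i, ∑ j, (∑ m, k i m * Z j m) * (p i * p j)
      = ∑ i, ∑ j, (∑ m, k m j * Z i m) * (p i * p j) := by
    rw [Finset.sum_comm]
    refine Finset.sum_congr rfl fun j _ => Finset.sum_congr rfl fun i _ => ?_
    rw [mul_comm (p i) (p j)]
    congr 1
    exact Finset.sum_congr rfl fun m _ => by rw [ks]
  have t5 : ∀ i j, (D i j + 2 * c * k i j - ∑ m, (k m j * Z i m + k i m * Z j m)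
      + (∑ m, Z m m) * k i j) * (p i * p j)
      = D i j * (p i * p j) + 2 * c * (k i j * (p i * p j)) - (∑ m, k m j * Z i m) * (p i * p j)
        - (∑ m, k i m * Z j m) * (p i * p j) + (∑ m, Z m m) * (k i j * (p i * p j)) := by
    intro i j; rw [Finset.sum_add_distrib]; ring
  have t6 : ∑ i, (Z i i + p i * w i) = ∑ i, Z i i + ∑ i, w i * p i := by
    rw [Finset.sum_add_distrib]; congr 1; exact Finset.sum_congr rfl fun i _ => mul_comm _ _
  have t7 : ∑ j, (∑ i, k j i * a i - 1 / 2 * sqrtDet G y * W y * u ^ 2 * w j) * p j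
      = ∑ j, (∑ i, k j i * a i) * p j - 1 / 2 * sqrtDet G y * W y * u ^ 2 * ∑ j, w j * p j := by
    rw [Finset.mul_sum, ← Finset.sum_sub_distrib]
    exact Finset.sum_congr rfl fun j _ => by ring
  simp only [t1, t5, t6, t7]
  simp only [Finset.sum_add_distrib, Finset.sum_sub_distrib, ← Finset.mul_sum, t2,
    t3, t4]
  ring

end

/-- The Noether condition in a coordinate domain `U`. -/
def IsGaugeOn (G : Coord n → Matrix (Fin n) (Fin n) ℝ) (W : Coord n → ℝ)
    (ξ : Coord n × ℝ → Coord n) (η : Coord n × ℝ → ℝ) (U : Set (Coord n))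
    (A : Coord n × ℝ → Fin n → ℝ) : Prop :=
  ∀ y ∈ U, ∀ (u : ℝ) (p : Fin n → ℝ),
    prolong1 ξ η (kgLagrangian G W) (y, u, p)
      + kgLagrangian G W (y, u, p) * ∑ i, totalD i (fun z => ξ z i) (y, u, p)
    = ∑ i, totalD i (fun z => A z i) (y, u, p)

/-- The vector density `√|g| g^{ij} f_{,j}`. -/
def gradDensity (G : Coord n → Matrix (Fin n) (Fin n) ℝ) (f : Coord n → ℝ) (i : Fin n)
    (y : Coord n) : ℝ :=
  sqrtDet G y * ∑ j, (G y)⁻¹ i j * pd j f y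

/-- If the cubic form `h(p, p) ⟨w, p⟩` with `h` nondegenerate vanishes, then `w = 0`. -/
lemma eq_zero_of_cubic {h : Matrix (Fin n) (Fin n) ℝ} (hdet : IsUnit h.det) (hs : h.IsSymm)
    {w : Fin n → ℝ} (H : ∀ p : Fin n → ℝ, (p ⬝ᵥ h.mulVec p) * (w ⬝ᵥ p) = 0) : w = 0 := by
  by_contra hw
  have hww : w ⬝ᵥ w ≠ 0 := fun h0 => hw (dotProduct_self_eq_zero.1 h0)
  have h00 : w ⬝ᵥ h.mulVec w = 0 := (mul_eq_zero.1 (H w)).resolve_right hww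
  -- polarization at `p = w`, where the linear factor does not vanish
  have hv : ∀ v : Fin n → ℝ, v ⬝ᵥ h.mulVec w = 0 := by
    intro v
    have sym : w ⬝ᵥ h.mulVec v = v ⬝ᵥ h.mulVec w := by
      rw [Matrix.dotProduct_mulVec, ← Matrix.mulVec_transpose, hs, dotProduct_comm]
    have h1 := H (w + v)
    have h2 := H (w - v)
    have h3 := H v
    simp only [Matrix.mulVec_add, Matrix.mulVec_sub, dotProduct_add, dotProduct_sub,
      add_dotProduct, sub_dotProduct, sym, h00] at h1 h2
    have h4 : (w ⬝ᵥ w) * (v ⬝ᵥ h.mulVec w) = 0 := by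
      linear_combination (h1 - h2 - 2 * h3) / 4
    exact (mul_eq_zero.1 h4).resolve_left hww
  have h1 : h.mulVec w = 0 := dotProduct_self_eq_zero.1 (hv _)
  have := congrArg (h⁻¹).mulVec h1
  rw [Matrix.mulVec_mulVec, Matrix.nonsing_inv_mul _ hdet, Matrix.one_mulVec,
    Matrix.mulVec_zero] at this
  exact hw this

section

variable {G : Coord n → Matrix (Fin n) (Fin n) ℝ} {W : Coord n → ℝ} {U : Set (Coord n)}
  {ξ : Coord n × ℝ → Coord n} {η : Coord n × ℝ → ℝ} {A : Coord n × ℝ → Fin n → ℝ}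

lemma IsMetricOn.smooth_gradDensity (hG : IsMetricOn G U) {f : Coord n → ℝ}
    (hf : ContDiffOn ℝ ∞ f U) (i : Fin n) : ContDiffOn ℝ ∞ (gradDensity G f i) U :=
  hG.smooth_sqrtDet.mul (ContDiffOn.sum fun j _ =>
    (hG.smooth_inv i j).mul (contDiffOn_pd hf hG.isOpen j))

lemma IsMetricOn.sum_pd_gradDensity (hG : IsMetricOn G U) (f : Coord n → ℝ) {y : Coord n}
    (hy : y ∈ U) : ∑ i, pd i (gradDensity G f i) y = sqrtDet G y * laplacian G f y := by
  rw [laplacian, ← mul_assoc, mul_inv_cancel₀ (hG.sqrtDet_pos hy).ne', one_mul]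
  rfl

lemma cubic_smul (T : Matrix (Fin n) (Fin n) ℝ) (w : Fin n → ℝ) (t : ℝ) (p : Fin n → ℝ) :
    -(1 / 2 * ((∑ i, ∑ j, T i j * ((t * p i) * (t * p j))) * ∑ k, w k * (t * p k)))
      = t ^ 3 * -(1 / 2 * ((∑ i, ∑ j, T i j * (p i * p j)) * ∑ k, w k * p k)) := by
  rw [quadratic_smul]
  have : ∑ k, w k * (t * p k) = t * ∑ k, w k * p k := by
    rw [Finset.mul_sum]; exact Finset.sum_congr rfl fun k _ => by ring
  rw [this]; ring

/-- The cubic and quadratic parts of the Noether condition: `ξ` does not depend on `u`, it is a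
conformal Killing vector, and `∂η/∂u` is determined by the conformal factor. -/
lemma IsGaugeOn.conformal (hA : IsGaugeOn G W ξ η U A) (hG : IsMetricOn G U) (hn : n ≠ 0)
    (hW : ContDiffOn ℝ ∞ W U) (hξ : ∀ k, ContDiffOn ℝ ∞ (fun z => ξ z k) (U ×ˢ Set.univ)) :
    (∀ y ∈ U, ∀ u, ξ (y, u) = ξ (y, 0)) ∧ ∀ y ∈ U,
      (∀ i j, lieDerivMetric G (fun z => ξ (z, 0)) y i j
        = 2 * confFactor G (fun z => ξ (z, 0)) y * G y i j) ∧
      ∀ u, dU η (y, u) = (2 - (n : ℝ)) / 2 * confFactor G (fun z => ξ (z, 0)) y := by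
  have hU := hG.isOpen
  have sK : ∀ i j, ContDiffOn ℝ ∞ (fun z => sqrtDet G z * (G z)⁻¹ i j) U := fun i j =>
    hG.smooth_sqrtDet.mul (hG.smooth_inv i j)
  have dif : ∀ {f : Coord n → ℝ}, ContDiffOn ℝ ∞ f U → ∀ {z}, z ∈ U → DifferentiableAt ℝ f z :=
    fun hf _ hz => differentiableAt_of_contDiffOn hf hU hz
  have R : ∀ y ∈ U, ∀ u, _ ∧ _ ∧ _ ∧ _ := fun y hy u =>
    homogeneous_parts_eq_zero
      (C := fun p => -(1 / 2 * ((∑ i, ∑ j, sqrtDet G y * (G y)⁻¹ i j * (p i * p j))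
          * ∑ k, dU (fun w => ξ w k) (y, u) * p k)))
      (Q := fun p => 1 / 2 * ∑ i, ∑ j, (fderiv ℝ (fun z => sqrtDet G z * (G z)⁻¹ i j) y (ξ (y, u))
          + 2 * dU η (y, u) * (sqrtDet G y * (G y)⁻¹ i j)
          - ∑ k, (sqrtDet G y * (G y)⁻¹ k j * dX k (fun w => ξ w i) (y, u)
            + sqrtDet G y * (G y)⁻¹ i k * dX k (fun w => ξ w j) (y, u))
          + (∑ k, dX k (fun w => ξ w k) (y, u)) * (sqrtDet G y * (G y)⁻¹ i j)) * (p i * p j))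
      (β := fun j => sqrtDet G y * ∑ i, (G y)⁻¹ j i * dX i η (y, u)
          - 1 / 2 * sqrtDet G y * W y * u ^ 2 * dU (fun w => ξ w j) (y, u)
          - dU (fun z => A z j) (y, u))
      (c := (-(1 / 2 * fderiv ℝ (fun z => sqrtDet G z * W z) y (ξ (y, u)) * u ^ 2)
          - sqrtDet G y * W y * u * η (y, u)
          - 1 / 2 * sqrtDet G y * W y * u ^ 2 * ∑ k, dX k (fun w => ξ w k) (y, u))
          - ∑ i, dX i (fun z => A z i) (y, u))
      (fun t p => cubic_smul (Matrix.of fun i j => sqrtDet G y * (G y)⁻¹ i j) _ t p)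
      (fun t p => (congrArg (1 / 2 * ·) (quadratic_smul (Matrix.of fun i j =>
          (fderiv ℝ (fun z => sqrtDet G z * (G z)⁻¹ i j) y (ξ (y, u))
          + 2 * dU η (y, u) * (sqrtDet G y * (G y)⁻¹ i j)
          - ∑ k, (sqrtDet G y * (G y)⁻¹ k j * dX k (fun w => ξ w i) (y, u)
            + sqrtDet G y * (G y)⁻¹ i k * dX k (fun w => ξ w j) (y, u))
          + (∑ k, dX k (fun w => ξ w k) (y, u)) * (sqrtDet G y * (G y)⁻¹ i j))) t p)).trans
        (mul_left_comm _ _ _))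
      (fun p => by
        have := hA y hy u p
        rw [noether_lhs_eq hG hW hy] at this
        simp only [totalD, Finset.sum_add_distrib] at this
        have e : ∑ j, (sqrtDet G y * ∑ i, (G y)⁻¹ j i * dX i η (y, u)
          - 1 / 2 * sqrtDet G y * W y * u ^ 2 * dU (fun w => ξ w j) (y, u)
          - dU (fun z => A z j) (y, u)) * p j
          = ∑ j, (sqrtDet G y * ∑ i, (G y)⁻¹ j i * dX i η (y, u)
          - 1 / 2 * sqrtDet G y * W y * u ^ 2 * dU (fun w => ξ w j) (y, u)) * p j
          - ∑ j, p j * dU (fun z => A z j) (y, u) := by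
          rw [← Finset.sum_sub_distrib]
          exact Finset.sum_congr rfl fun j _ => by ring
        simp only [e, Finset.sum_add_distrib]
        linarith)
  have hw : ∀ y ∈ U, ∀ u k, dU (fun w => ξ w k) (y, u) = 0 := by
    intro y hy u k
    have hcub := (R y hy u).2.2.2
    refine congrFun (eq_zero_of_cubic (h := (G y)⁻¹) (w := fun k => dU (fun w => ξ w k) (y, u))
      (Matrix.isUnit_nonsing_inv_det _ (hG.isUnit_det hy))
      (Matrix.IsSymm.ext fun i j => hG.inv_symm hy j i) fun p => ?_) k
    have h1 := hcub p
    have h2 : ∑ i, ∑ j, sqrtDet G y * (G y)⁻¹ i j * (p i * p j)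
        = sqrtDet G y * (p ⬝ᵥ (G y)⁻¹.mulVec p) := by
      rw [← sum_sum_mul_mul_eq, Finset.mul_sum]
      refine Finset.sum_congr rfl fun i _ => ?_
      rw [Finset.mul_sum]
      exact Finset.sum_congr rfl fun j _ => by ring
    simp only [h2] at h1
    refine ((mul_eq_zero (a := sqrtDet G y)).1 ?_).resolve_left (hG.sqrtDet_pos hy).ne'
    simp only [dotProduct] at h1 ⊢
    linarith
  have hind := indep_of_dU_eq_zero hU hξ hw
  have key : ∀ y ∈ U, ∀ u, ∃ c, (∀ i j, lieDerivMetric G (fun z => ξ (z, 0)) y i j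
        = 2 * c * G y i j) ∧ dU η (y, u) = (2 - (n : ℝ)) / 2 * c := by
    intro y hy u
    have hquad := (R y hy u).2.2.1
    set d := ∑ k, dX k (fun w => ξ w k) (y, u) with hd
    set s := sqrtDet G y with hs
    have s0 : s ≠ 0 := (hG.sqrtDet_pos hy).ne'
    set Ds := fderiv ℝ (sqrtDet G) y (ξ (y, u)) with hDs
    have co : ∀ i j, fderiv ℝ (fun z => sqrtDet G z * (G z)⁻¹ i j) y (ξ (y, u))
          + 2 * dU η (y, u) * (s * (G y)⁻¹ i j)
          - ∑ k, (s * (G y)⁻¹ k j * dX k (fun w => ξ w i) (y, u)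
            + s * (G y)⁻¹ i k * dX k (fun w => ξ w j) (y, u))
          + d * (s * (G y)⁻¹ i j)
          = s * lieInv G ξ (y, u) i j + (Ds + 2 * dU η (y, u) * s + d * s) * (G y)⁻¹ i j := by
      intro i j
      rw [fderiv_mul_apply (dif hG.smooth_sqrtDet hy) (dif (hG.smooth_inv i j) hy), lieInv]
      have : ∑ k, (s * (G y)⁻¹ k j * dX k (fun w => ξ w i) (y, u)
            + s * (G y)⁻¹ i k * dX k (fun w => ξ w j) (y, u))
          = s * ∑ k, ((G y)⁻¹ k j * dX k (fun w => ξ w i) (y, u)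
            + (G y)⁻¹ i k * dX k (fun w => ξ w j) (y, u)) := by
        rw [Finset.mul_sum]; exact Finset.sum_congr rfl fun k _ => by ring
      rw [this]
      ring
    simp only [co] at hquad
    have hz : ∀ i j, s * lieInv G ξ (y, u) i j
        + (Ds + 2 * dU η (y, u) * s + d * s) * (G y)⁻¹ i j = 0 := by
      intro i j
      refine eq_of_quadratic (h := 0) (S := fun i j => s * lieInv G ξ (y, u) i j
        + (Ds + 2 * dU η (y, u) * s + d * s) * (G y)⁻¹ i j) (fun _ _ => rfl) (fun i j => ?_)
        (fun p => ?_) i j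
      · rw [hG.lieInv_symm hy, hG.inv_symm hy]
      · have := hquad p
        simp only [Pi.zero_apply, zero_mul, Finset.sum_const_zero]
        linarith
    have hconf := (hG.conformal_iff_lieInv hξ hind hy u ((Ds / s + 2 * dU η (y, u) + d) / 2)).2
      (fun i j => by
        have := hz i j
        field_simp
        linarith)
    refine ⟨_, hconf, ?_⟩
    have h1 := hG.fderiv_sqrtDet_of_conformal hy hconf
    have h2 : coordDiv (fun z => ξ (z, 0)) y = d :=
      Finset.sum_congr rfl fun k _ => (dX_indep hU (fun z hz u => by rw [hind z hz u]) hy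
        (dif (smooth_slice (hξ k) 0) hy) u k).symm
    simp only [h2] at h1
    rw [← hind y hy u] at h1
    -- `ζ(√|g|) = (n ψ - div ζ) √|g|` turns `2 ψ = ζ(√|g|) / √|g| + 2 η_u + div ζ` into the claim
    have h3 : Ds / s = n * ((Ds / s + 2 * dU η (y, u) + d) / 2) - d := by
      rw [div_eq_iff s0]
      exact h1
    linarith
  refine ⟨hind, fun y hy => ⟨?_, fun u => ?_⟩⟩
  · obtain ⟨c, hc, -⟩ := key y hy 0
    rw [← hG.eq_confFactor hn hy hc]
    exact hc
  · obtain ⟨c, hc, h⟩ := key y hy u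
    rw [← hG.eq_confFactor hn hy hc]
    exact h

/-- The Noether condition for a conformal Killing vector, after the integration of its linear part
in `u`. -/
lemma isGaugeOn_iff_of_conformal (hG : IsMetricOn G U) (hW : ContDiffOn ℝ ∞ W U)
    (hξ : ∀ k, ContDiffOn ℝ ∞ (fun z => ξ z k) (U ×ˢ Set.univ))
    {ψ σ b : Coord n → ℝ} (hσ : ContDiffOn ℝ ∞ σ U)
    (hb : ContDiffOn ℝ ∞ b U) (hind : ∀ y ∈ U, ∀ u, ξ (y, u) = ξ (y, 0))
    (hc : ∀ y ∈ U, ∀ i j, lieDerivMetric G (fun z => ξ (z, 0)) y i j = 2 * ψ y * G y i j)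
    (hη : ∀ y ∈ U, ∀ u, η (y, u) = σ y * u + b y)
    (hσψ : ∀ y ∈ U, σ y = (2 - (n : ℝ)) / 2 * ψ y)
    (hA : ∀ i, ContDiffOn ℝ ∞ (fun z => A z i) (U ×ˢ Set.univ)) :
    IsGaugeOn G W ξ η U A ↔
      (∀ y ∈ U, ∀ u i, A (y, u) i
        = 1 / 2 * gradDensity G σ i y * u ^ 2 + gradDensity G b i y * u + A (y, 0) i) ∧
      ∀ y ∈ U, ∀ u : ℝ, 1 / 2 * sqrtDet G y * (∑ k, ξ (y, 0) k * pd k W y + 2 * ψ y * W y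
          + laplacian G σ y) * u ^ 2
        + sqrtDet G y * (laplacian G b y + W y * b y) * u
        + ∑ i, pd i (fun z => A (z, 0) i) y = 0 := by
  have hU := hG.isOpen
  have hUu : IsOpen (U ×ˢ (Set.univ : Set ℝ)) := hU.prod isOpen_univ
  have dif : ∀ {f : Coord n → ℝ}, ContDiffOn ℝ ∞ f U → ∀ {z}, z ∈ U → DifferentiableAt ℝ f z :=
    fun hf _ hz => differentiableAt_of_contDiffOn hf hU hz
  -- the left-hand side of the Noether condition is of degree one in the first derivatives
  have hN : ∀ y ∈ U, ∀ u p, prolong1 ξ η (kgLagrangian G W) (y, u, p)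
      + kgLagrangian G W (y, u, p) * ∑ i, totalD i (fun z => ξ z i) (y, u, p)
      = ∑ j, (gradDensity G σ j y * u + gradDensity G b j y) * p j
        - 1 / 2 * sqrtDet G y * (∑ k, ξ (y, 0) k * pd k W y + n * ψ y * W y) * u ^ 2
        - sqrtDet G y * W y * u * (σ y * u + b y) := by
    intro y hy u p
    have hw : ∀ k, dU (fun w => ξ w k) (y, u) = 0 := fun k =>
      dU_indep hU (b := fun z => ξ (z, 0) k) (fun z hz u => by rw [hind z hz u]) hy
        (dif (smooth_slice (hξ k) 0) hy) u
    have hd : ∀ k i, dX i (fun w => ξ w k) (y, u) = pd i (fun z => ξ (z, 0) k) y := fun k i =>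
      dX_indep hU (fun z hz u => by rw [hind z hz u]) hy (dif (smooth_slice (hξ k) 0) hy) u i
    have hk := hG.fderiv_density_of_conformal hy (hc y hy)
    have hdiv : ∑ k, pd k (fun z => ξ (z, 0) k) y = coordDiv (fun z => ξ (z, 0)) y := rfl
    have hη1 : dU η (y, u) = (2 - (n : ℝ)) / 2 * ψ y := by
      rw [dU_affine hU hη hy (dif hσ hy) (dif hb hy), hσψ y hy]
    have hη2 : ∀ i, dX i η (y, u) = pd i σ y * u + pd i b y := fun i =>
      dX_affine hU hη hy (dif hσ hy) (dif hb hy) u i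
    have hsW : fderiv ℝ (fun z => sqrtDet G z * W z) y (ξ (y, 0))
        = sqrtDet G y * ∑ k, ξ (y, 0) k * pd k W y
          + (n * ψ y - coordDiv (fun z => ξ (z, 0)) y) * sqrtDet G y * W y := by
      rw [fderiv_mul_apply (dif hG.smooth_sqrtDet hy) (dif hW hy), fderiv_eq_sum_pd W,
        hG.fderiv_sqrtDet_of_conformal hy (hc y hy)]
    rw [noether_lhs_eq hG hW hy]
    simp only [hw, hd, hind y hy u, hk, hη1, hη2, hη y hy u, hdiv, hsW]
    have q0 : ∑ i, ∑ j, ((n - 2) * ψ y * (sqrtDet G y * (G y)⁻¹ i j)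
        + ∑ k, (sqrtDet G y * (G y)⁻¹ k j * pd k (fun z => ξ (z, 0) i) y
          + sqrtDet G y * (G y)⁻¹ i k * pd k (fun z => ξ (z, 0) j) y)
        - coordDiv (fun z => ξ (z, 0)) y * (sqrtDet G y * (G y)⁻¹ i j)
        + 2 * ((2 - (n : ℝ)) / 2 * ψ y) * (sqrtDet G y * (G y)⁻¹ i j)
        - ∑ k, (sqrtDet G y * (G y)⁻¹ k j * pd k (fun z => ξ (z, 0) i) y
          + sqrtDet G y * (G y)⁻¹ i k * pd k (fun z => ξ (z, 0) j) y)
        + coordDiv (fun z => ξ (z, 0)) y * (sqrtDet G y * (G y)⁻¹ i j)) * (p i * p j) = 0 :=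
      Finset.sum_eq_zero fun i _ => Finset.sum_eq_zero fun j _ => by ring
    have l0 : ∀ j, sqrtDet G y * ∑ i, (G y)⁻¹ j i * (pd i σ y * u + pd i b y)
        = gradDensity G σ j y * u + gradDensity G b j y := by
      intro j
      simp only [gradDensity, mul_add, Finset.sum_add_distrib, ← mul_assoc, ← Finset.sum_mul]
    rw [q0]
    simp only [l0, zero_mul, mul_zero, sub_zero, Finset.sum_const_zero]
    ring
  have hpt : ∀ y ∈ U, ∀ u : ℝ, (∀ p, prolong1 ξ η (kgLagrangian G W) (y, u, p)
      + kgLagrangian G W (y, u, p) * ∑ i, totalD i (fun z => ξ z i) (y, u, p)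
      = ∑ i, totalD i (fun z => A z i) (y, u, p)) ↔
      (∀ i, dU (fun z => A z i) (y, u) = gradDensity G σ i y * u + gradDensity G b i y) ∧
      ∑ i, dX i (fun z => A z i) (y, u)
        = - (1 / 2 * sqrtDet G y * (∑ k, ξ (y, 0) k * pd k W y + n * ψ y * W y) * u ^ 2)
        - sqrtDet G y * W y * u * (σ y * u + b y) := by
    intro y hy u
    constructor
    · intro h
      obtain ⟨h1, h2, -, -⟩ := homogeneous_parts_eq_zero (C := fun _ => 0) (Q := fun _ => 0)
        (β := fun i => gradDensity G σ i y * u + gradDensity G b i y - dU (fun z => A z i) (y, u))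
        (c := - (1 / 2 * sqrtDet G y * (∑ k, ξ (y, 0) k * pd k W y + n * ψ y * W y) * u ^ 2)
          - sqrtDet G y * W y * u * (σ y * u + b y) - ∑ i, dX i (fun z => A z i) (y, u))
        (fun _ _ => (mul_zero _).symm) (fun _ _ => (mul_zero _).symm) (fun p => by
          have := h p
          rw [hN y hy u p] at this
          simp only [totalD, Finset.sum_add_distrib] at this
          have e : ∑ i, (gradDensity G σ i y * u + gradDensity G b i y
              - dU (fun z => A z i) (y, u)) * p i
              = ∑ i, (gradDensity G σ i y * u + gradDensity G b i y) * p i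
                - ∑ i, p i * dU (fun z => A z i) (y, u) := by
            rw [← Finset.sum_sub_distrib]
            exact Finset.sum_congr rfl fun j _ => by ring
          rw [e]
          linarith)
      refine ⟨fun i => ?_, by linarith⟩
      have := congrFun h2 i
      simp only [Pi.zero_apply] at this
      linarith
    · rintro ⟨h1, h2⟩ p
      rw [hN y hy u p]
      simp only [totalD, Finset.sum_add_distrib, h1, h2]
      rw [Finset.sum_congr rfl fun i _ => mul_comm (p i) _]
      ring
  have sA0 : ∀ i, ContDiffOn ℝ ∞ (fun z => A (z, 0) i) U := fun i => smooth_slice (hA i) 0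
  -- the divergence of the integrated gauge function
  have hdiv : (∀ y ∈ U, ∀ u i, A (y, u) i
        = 1 / 2 * gradDensity G σ i y * u ^ 2 + gradDensity G b i y * u + A (y, 0) i) →
      ∀ y ∈ U, ∀ u, ∑ i, dX i (fun z => A z i) (y, u)
        = 1 / 2 * sqrtDet G y * laplacian G σ y * u ^ 2 + sqrtDet G y * laplacian G b y * u
          + ∑ i, pd i (fun z => A (z, 0) i) y := by
    intro h y hy u
    have e : ∀ i, dX i (fun z => A z i) (y, u) = 1 / 2 * pd i (gradDensity G σ i) y * u ^ 2
        + pd i (gradDensity G b i) y * u + pd i (fun z => A (z, 0) i) y := by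
      intro i
      rw [dX_quadratic hU (fun y hy u => h y hy u i) hy
        ((dif (hG.smooth_gradDensity hσ i) hy).const_mul _) (dif (hG.smooth_gradDensity hb i) hy)
        (dif (sA0 i) hy), pd_const_mul (dif (hG.smooth_gradDensity hσ i) hy)]
    simp only [e, Finset.sum_add_distrib, ← Finset.sum_mul, ← Finset.mul_sum,
      hG.sum_pd_gradDensity _ hy]
    ring
  constructor
  · intro h
    have h1 : ∀ y ∈ U, ∀ u i, A (y, u) i
        = 1 / 2 * gradDensity G σ i y * u ^ 2 + gradDensity G b i y * u + A (y, 0) i := by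
      intro y hy u i
      exact eq_quadratic_of_dU (F := fun z => A z i)
        (fun u => differentiableAt_of_contDiffOn (hA i) hUu ⟨hy, Set.mem_univ _⟩)
        (fun u => by rw [((hpt y hy u).1 (h y hy u)).1 i]; ring) u
    refine ⟨h1, fun y hy u => ?_⟩
    have h2 := ((hpt y hy u).1 (h y hy u)).2
    rw [hdiv h1 y hy u, hσψ y hy] at h2
    linear_combination h2
  · rintro ⟨h1, h2⟩ y hy u
    refine (hpt y hy u).2 ⟨fun i => ?_, ?_⟩
    · rw [dU_quadratic hU (fun y hy u => h1 y hy u i) hy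
        ((dif (hG.smooth_gradDensity hσ i) hy).const_mul _) (dif (hG.smooth_gradDensity hb i) hy)
        (dif (sA0 i) hy)]
      ring
    · rw [hdiv h1 y hy u, hσψ y hy]
      linear_combination h2 y hy u

lemma IsGaugeOn.isConformalOn (hgauge : IsGaugeOn G W ξ η U A) (hG : IsMetricOn G U) (hn : n ≠ 0)
    (hW : ContDiffOn ℝ ∞ W U) (hξ : ∀ k, ContDiffOn ℝ ∞ (fun z => ξ z k) (U ×ˢ Set.univ))
    (hη : ContDiffOn ℝ ∞ η (U ×ˢ Set.univ))
    (hA : ∀ i, ContDiffOn ℝ ∞ (fun z => A z i) (U ×ˢ Set.univ)) :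
    IsConformalOn G W ξ η U (confFactor G fun z => ξ (z, 0))
      (fun y => (2 - (n : ℝ)) / 2 * confFactor G (fun z => ξ (z, 0)) y) (fun y => η (y, 0)) := by
  obtain ⟨hind, hc⟩ := hgauge.conformal hG hn hW hξ
  have hU := hG.isOpen
  set ψ := confFactor G fun z => ξ (z, 0) with hψ
  have sψ : ContDiffOn ℝ ∞ ψ U := hG.smooth_confFactor fun k => smooth_slice (hξ k) 0
  have sb : ContDiffOn ℝ ∞ (fun y => η (y, 0)) U := smooth_slice hη 0
  have sσ : ContDiffOn ℝ ∞ (fun y => (2 - (n : ℝ)) / 2 * ψ y) U := contDiffOn_const.mul sψ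
  have hηeq : ∀ y ∈ U, ∀ u, η (y, u) = (2 - (n : ℝ)) / 2 * ψ y * u + η (y, 0) := by
    intro y hy u
    have := eq_quadratic_of_dU (F := η) (y := y) (a := 0) (σ := (2 - (n : ℝ)) / 2 * ψ y)
      (fun u => differentiableAt_of_contDiffOn hη (hU.prod isOpen_univ) ⟨hy, Set.mem_univ _⟩)
      (fun u => by rw [(hc y hy).2 u]; ring) u
    simpa using this
  have hgrad : ∀ y ∈ U, ∀ i, pd i (fun y => (2 - (n : ℝ)) / 2 * ψ y) y
      = (2 - (n : ℝ)) / 2 * pd i ψ y := fun y hy i =>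
    pd_const_mul (differentiableAt_of_contDiffOn sψ hU hy) _ i
  have h := ((isGaugeOn_iff_of_conformal hG hW hξ sσ sb hind (fun y hy => (hc y hy).1) hηeq
    (fun _ _ => rfl) hA).1 hgauge).2
  have hs : ∀ y ∈ U, sqrtDet G y ≠ 0 := fun y hy => (hG.sqrtDet_pos hy).ne'
  refine ⟨sψ, sσ, sb, hind, fun y hy => (hc y hy).1, hηeq, hgrad, fun y hy => ?_, fun y hy => ?_⟩
  · refine ((mul_eq_zero (a := sqrtDet G y)).1 ?_).resolve_left (hs y hy)
    linarith [h y hy 1, h y hy (-1)]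
  · rw [← laplacian_congr_grad hU hgrad hy hG sψ sσ]
    refine ((mul_eq_zero (a := sqrtDet G y)).1 ?_).resolve_left (hs y hy)
    linarith [h y hy 1, h y hy (-1), h y hy 0]

/-- The gauge functions of a conformal generator, with indices raised. -/
lemma IsConformalOn.isGaugeOn_iff {ψ σ b : Coord n → ℝ} (hC : IsConformalOn G W ξ η U ψ σ b)
    (hσψ : ∀ y ∈ U, σ y = (2 - (n : ℝ)) / 2 * ψ y) (hG : IsMetricOn G U)
    (hW : ContDiffOn ℝ ∞ W U) (hξ : ∀ k, ContDiffOn ℝ ∞ (fun z => ξ z k) (U ×ˢ Set.univ))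
    (hA : ∀ i, ContDiffOn ℝ ∞ (fun z => A z i) (U ×ˢ Set.univ)) :
    IsGaugeOn G W ξ η U A ↔
      (∀ y ∈ U, ∀ u i, A (y, u) i
        = 1 / 2 * gradDensity G σ i y * u ^ 2 + gradDensity G b i y * u + A (y, 0) i) ∧
      ∀ y ∈ U, ∑ i, pd i (fun z => A (z, 0) i) y = 0 := by
  rw [isGaugeOn_iff_of_conformal hG hW hξ hC.smooth_σ hC.smooth_b hC.ξ_indep hC.conformal hC.η_eq
    hσψ hA]
  refine and_congr_right fun _ => forall_congr' fun y => forall_congr' fun hy => ?_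
  have h1 := hC.constraint y hy
  rw [← laplacian_congr_grad hG.isOpen hC.grad hy hG hC.smooth_ψ hC.smooth_σ] at h1
  simp [h1, hC.solution y hy]

/-- The components with lowered indices of a density gradient. -/
lemma IsMetricOn.sum_mul_gradDensity (hG : IsMetricOn G U) (f : Coord n → ℝ) {y : Coord n}
    (hy : y ∈ U) (i : Fin n) : ∑ j, G y i j * gradDensity G f j y = sqrtDet G y * pd i f y := by
  have h1 : (G y).mulVec ((G y)⁻¹.mulVec fun j => pd j f y) = fun j => pd j f y := by
    rw [Matrix.mulVec_mulVec, Matrix.mul_nonsing_inv _ (hG.isUnit_det hy), Matrix.one_mulVec]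
  rw [← congrFun h1 i]
  simp only [Matrix.mulVec, dotProduct, gradDensity]
  rw [Finset.mul_sum]
  exact Finset.sum_congr rfl fun j _ => by ring

lemma IsMetricOn.eq_of_lower (hG : IsMetricOn G U) {y : Coord n} (hy : y ∈ U) {v w : Fin n → ℝ}
    (h : ∀ i, ∑ j, G y i j * v j = ∑ j, G y i j * w j) : v = w := by
  have h1 : (G y).mulVec v = (G y).mulVec w := funext h
  have := congrArg ((G y)⁻¹).mulVec h1
  rwa [Matrix.mulVec_mulVec, Matrix.mulVec_mulVec, Matrix.nonsing_inv_mul _ (hG.isUnit_det hy),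
    Matrix.one_mulVec, Matrix.one_mulVec] at this

end

/-! ### Change of coordinates -/

/-- The chain rule for partial derivatives. -/
lemma fderiv_comp_eq_sum {f : Coord n → ℝ} {φ : Coord n → Coord n} {y : Coord n}
    (hf : DifferentiableAt ℝ f (φ y)) (hφ : DifferentiableAt ℝ φ y) (v : Coord n) :
    fderiv ℝ (fun z => f (φ z)) y v = ∑ a, pd a f (φ y) * fderiv ℝ (fun z => φ z a) y v := by
  have h1 : HasFDerivAt (fun z => f (φ z)) ((fderiv ℝ f (φ y)).comp (fderiv ℝ φ y)) y :=
    hf.hasFDerivAt.comp y hφ.hasFDerivAt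
  rw [h1.fderiv, ContinuousLinearMap.comp_apply, fderiv_eq_sum_pd]
  refine Finset.sum_congr rfl fun a _ => ?_
  have h2 : HasFDerivAt (fun z => φ z a) ((EuclideanSpace.proj a).comp (fderiv ℝ φ y)) y :=
    (EuclideanSpace.proj (𝕜 := ℝ) a).hasFDerivAt.comp y hφ.hasFDerivAt
  rw [h2.fderiv, mul_comm]
  rfl

/-- The Lie derivative of a metric is a tensor. -/
lemma lieDerivMetric_comp {U : Set (Coord n)} (hU : IsOpen U) {φ : Coord n → Coord n}
    (hφ : ContDiffOn ℝ ∞ φ U) {G G' : Coord n → Matrix (Fin n) (Fin n) ℝ}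
    {ζ ζ' : Coord n → Coord n} {y : Coord n} (hy : y ∈ U)
    (hG : ∀ z ∈ U, ∀ i j, G z i j = ∑ a, ∑ b, G' (φ z) a b *
      (pd i (fun x => φ x a) z * pd j (fun x => φ x b) z))
    (hζ : ∀ z ∈ U, ∀ a, ζ' (φ z) a = ∑ k, ζ z k * pd k (fun x => φ x a) z)
    (dG' : ∀ a b, DifferentiableAt ℝ (fun z => G' z a b) (φ y))
    (dζ' : ∀ a, DifferentiableAt ℝ (fun z => ζ' z a) (φ y))
    (dζ : ∀ a, DifferentiableAt ℝ (fun z => ζ z a) y) (i j : Fin n) :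
    lieDerivMetric G ζ y i j = ∑ a, ∑ b, lieDerivMetric G' ζ' (φ y) a b *
      (pd i (fun x => φ x a) y * pd j (fun x => φ x b) y) := by
  have dφ : DifferentiableAt ℝ φ y := differentiableAt_of_contDiffOn hφ hU hy
  have sφ : ∀ a, ContDiffOn ℝ ∞ (fun x => φ x a) U := fun a =>
    (EuclideanSpace.proj (𝕜 := ℝ) a).contDiff.comp_contDiffOn hφ
  have dP : ∀ i a, DifferentiableAt ℝ (pd i (fun x => φ x a)) y := fun i a =>
    differentiableAt_of_contDiffOn (contDiffOn_pd (sφ a) hU i) hU hy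
  have dGφ : ∀ a b, DifferentiableAt ℝ (fun z => G' (φ z) a b) y := fun a b =>
    DifferentiableAt.comp (g := fun z => G' z a b) y (dG' a b) dφ
  set P : Fin n → Fin n → ℝ := fun a i => pd i (fun x => φ x a) y with hP
  -- the derivative of the transformation law of `ζ` involves the second derivatives of `φ`
  have h1 : ∀ i a, ∑ k, ζ y k * pd k (pd i (fun x => φ x a)) y
      = ∑ c, pd c (fun z => ζ' z a) (φ y) * P c i - ∑ k, pd i (fun z => ζ z k) y * P a k := by
    intro i a
    have e := pd_congr_on hU (fun z hz => hζ z hz a) hy i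
    rw [pd_sum fun k _ => (dζ k).fun_mul (dP k a)] at e
    rw [Finset.sum_congr rfl fun k _ => pd_mul (dζ k) (dP k a) i, Finset.sum_add_distrib] at e
    rw [pd, fderiv_comp_eq_sum (f := fun z => ζ' z a) (dζ' a) dφ] at e
    rw [Finset.sum_congr rfl fun k _ => by rw [pd_pd_comm hU (sφ a) hy k i]]
    exact eq_sub_of_add_eq e.symm
  have h2 : ∑ k, ζ y k * pd k (fun z => G z i j) y
      = ∑ a, ∑ b, ((∑ c, ζ' (φ y) c * pd c (fun z => G' z a b) (φ y)) * (P a i * P b j)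
        + G' (φ y) a b * ((∑ k, ζ y k * pd k (pd i (fun x => φ x a)) y) * P b j
          + P a i * ∑ k, ζ y k * pd k (pd j (fun x => φ x b)) y)) := by
    rw [← fderiv_eq_sum_pd, fderiv_congr_on hU (fun z hz => hG z hz i j) hy]
    have dT : ∀ a b, DifferentiableAt ℝ (fun z => G' (φ z) a b *
        (pd i (fun x => φ x a) z * pd j (fun x => φ x b) z)) y := fun a b =>
      (dGφ a b).fun_mul ((dP i a).fun_mul (dP j b))
    rw [fderiv_fun_sum fun a _ => DifferentiableAt.fun_sum fun b _ => dT a b, _root_.sum_apply]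
    refine Finset.sum_congr rfl fun a _ => ?_
    rw [fderiv_fun_sum fun b _ => dT a b, _root_.sum_apply]
    refine Finset.sum_congr rfl fun b _ => ?_
    rw [fderiv_mul_apply (dGφ a b) ((dP i a).fun_mul (dP j b)), fderiv_mul_apply (dP i a) (dP j b),
      fderiv_comp_eq_sum (f := fun z => G' z a b) (dG' a b) dφ]
    have : ∀ c, fderiv ℝ (fun z => φ z c) y (ζ y) = ζ' (φ y) c := fun c => by
      rw [hζ y hy c, fderiv_eq_sum_pd]
    simp only [this, fderiv_eq_sum_pd (pd i _), fderiv_eq_sum_pd (pd j _), hP]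
    rw [Finset.sum_congr rfl fun c _ => mul_comm (pd c _ _) _]
    ring
  have h3 : ∑ k, G y k j * pd i (fun z => ζ z k) y
      = ∑ a, ∑ b, G' (φ y) a b * ((∑ k, pd i (fun z => ζ z k) y * P a k) * P b j) := by
    simp only [hG y hy, Finset.mul_sum, Finset.sum_mul]
    rw [Finset.sum_comm]
    refine Finset.sum_congr rfl fun a _ => ?_
    rw [Finset.sum_comm]
    exact Finset.sum_congr rfl fun b _ => Finset.sum_congr rfl fun k _ => by simp only [hP]; ring
  have h4 : ∑ k, G y i k * pd j (fun z => ζ z k) y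
      = ∑ a, ∑ b, G' (φ y) a b * (P a i * (∑ k, pd j (fun z => ζ z k) y * P b k)) := by
    simp only [hG y hy, Finset.mul_sum, Finset.sum_mul]
    rw [Finset.sum_comm]
    refine Finset.sum_congr rfl fun a _ => ?_
    rw [Finset.sum_comm]
    exact Finset.sum_congr rfl fun b _ => Finset.sum_congr rfl fun k _ => by simp only [hP]; ring
  have h5 : ∑ a, ∑ b, (∑ c, G' (φ y) c b * pd a (fun z => ζ' z c) (φ y)) * (P a i * P b j)
      = ∑ a, ∑ b, G' (φ y) a b * ((∑ c, pd c (fun z => ζ' z a) (φ y) * P c i) * P b j) := by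
    simp only [Finset.mul_sum, Finset.sum_mul]
    have : ∀ a, ∑ b, ∑ c, G' (φ y) c b * pd a (fun z => ζ' z c) (φ y) * (P a i * P b j)
        = ∑ c, ∑ b, G' (φ y) c b * pd a (fun z => ζ' z c) (φ y) * (P a i * P b j) :=
      fun a => Finset.sum_comm
    simp only [this]
    rw [Finset.sum_comm]
    refine Finset.sum_congr rfl fun c _ => ?_
    rw [Finset.sum_comm]
    exact Finset.sum_congr rfl fun b _ => Finset.sum_congr rfl fun a _ => by ring
  have h6 : ∑ a, ∑ b, (∑ c, G' (φ y) a c * pd b (fun z => ζ' z c) (φ y)) * (P a i * P b j)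
      = ∑ a, ∑ b, G' (φ y) a b * (P a i * (∑ c, pd c (fun z => ζ' z b) (φ y) * P c j)) := by
    refine Finset.sum_congr rfl fun a _ => ?_
    simp only [Finset.mul_sum, Finset.sum_mul]
    rw [Finset.sum_comm]
    exact Finset.sum_congr rfl fun b _ => Finset.sum_congr rfl fun c _ => by ring
  have l : ∀ a b, lieDerivMetric G' ζ' (φ y) a b * (P a i * P b j)
      = (∑ c, ζ' (φ y) c * pd c (fun z => G' z a b) (φ y)) * (P a i * P b j)
        + (∑ c, G' (φ y) c b * pd a (fun z => ζ' z c) (φ y)) * (P a i * P b j)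
        + (∑ c, G' (φ y) a c * pd b (fun z => ζ' z c) (φ y)) * (P a i * P b j) := by
    intro a b
    simp only [lieDerivMetric, Finset.sum_add_distrib]
    ring
  have r : lieDerivMetric G ζ y i j = ∑ k, ζ y k * pd k (fun z => G z i j) y
      + ∑ k, G y k j * pd i (fun z => ζ z k) y + ∑ k, G y i k * pd j (fun z => ζ z k) y := by
    simp only [lieDerivMetric, Finset.sum_add_distrib]
  have l' : ∀ a b, (∑ c, ζ' (φ y) c * pd c (fun z => G' z a b) (φ y)) * (P a i * P b j)
        + G' (φ y) a b * ((∑ c, pd c (fun z => ζ' z a) (φ y) * P c i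
            - ∑ k, pd i (fun z => ζ z k) y * P a k) * P b j
          + P a i * (∑ c, pd c (fun z => ζ' z b) (φ y) * P c j
            - ∑ k, pd j (fun z => ζ z k) y * P b k))
      = (∑ c, ζ' (φ y) c * pd c (fun z => G' z a b) (φ y)) * (P a i * P b j)
        + G' (φ y) a b * ((∑ c, pd c (fun z => ζ' z a) (φ y) * P c i) * P b j)
        - G' (φ y) a b * ((∑ k, pd i (fun z => ζ z k) y * P a k) * P b j)
        + G' (φ y) a b * (P a i * (∑ c, pd c (fun z => ζ' z b) (φ y) * P c j))
        - G' (φ y) a b * (P a i * (∑ k, pd j (fun z => ζ z k) y * P b k)) := by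
    intro a b; ring
  have goal' : ∑ a, ∑ b, lieDerivMetric G' ζ' (φ y) a b *
      (pd i (fun x => φ x a) y * pd j (fun x => φ x b) y)
      = ∑ a, ∑ b, lieDerivMetric G' ζ' (φ y) a b * (P a i * P b j) := rfl
  rw [goal', r, h2, h3, h4]
  simp only [h1, l, l', Finset.sum_add_distrib, Finset.sum_sub_distrib, h5, h6]
  ring

/-! ### Coordinate expressions on the manifold -/

section Manifold

variable {M : Type*} [TopologicalSpace M] [ChartedSpace (Coord n) M]
  {e e' : OpenPartialHomeomorph M (Coord n)}

lemma mdifferentiable_of_mem_smoothCharts (he : e ∈ smoothCharts n M) :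
    e.MDifferentiable (𝓡 n) (𝓡 n) :=
  ⟨(contMDiffOn_of_mem_maximalAtlas he).mdifferentiableOn (by simp),
    (contMDiffOn_symm_of_mem_maximalAtlas he).mdifferentiableOn (by simp)⟩

variable [IsManifold (𝓡 n) ∞ M]

/-- The coordinate vector fields are smooth. -/
lemma contMDiffOn_coordVec (he : e ∈ smoothCharts n M) (i : Fin n) :
    ContMDiffOn 𝓘(ℝ, Coord n) (𝓡 n).tangent ∞
      (fun y => (⟨e.symm y, coordVec e y i⟩ : TangentBundle (𝓡 n) M)) e.target := by
  have h1 := (contMDiffOn_symm_of_mem_maximalAtlas he).contMDiffOn_tangentMapWithin (m := ∞)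
    (by simp) e.open_target.uniqueMDiffOn
  have h2 : ContMDiff 𝓘(ℝ, Coord n) 𝓘(ℝ, Coord n).tangent ∞
      (fun y => (⟨y, (basisVec i : Coord n)⟩ : TangentBundle 𝓘(ℝ, Coord n) (Coord n))) :=
    contMDiff_vectorSpace_iff_contDiff.2 contDiff_const
  refine (h1.comp h2.contMDiffOn (s := e.target) fun y hy => hy).congr fun y hy => ?_
  simp only [Function.comp_apply, tangentMapWithin, coordVec]
  rw [mfderivWithin_of_isOpen e.open_target hy]

lemma contDiffOn_comp (g : PseudoRiemannianMetric n M) (he : e ∈ smoothCharts n M) (i j : Fin n) :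
    ContDiffOn ℝ ∞ (fun y => g.comp e y i j) e.target := by
  have h1 := g.contMDiff.comp_contMDiffOn (contMDiffOn_symm_of_mem_maximalAtlas he)
  have h2 := ContMDiffOn.clm_bundle_apply₂ (F₁ := Coord n) (F₂ := Coord n) (F₃ := ℝ)
    (E₁ := fun x : M => TangentSpace (𝓡 n) x) (E₂ := fun x : M => TangentSpace (𝓡 n) x)
    (E₃ := fun _ : M => ℝ) (b := e.symm) h1 (contMDiffOn_coordVec he i) (contMDiffOn_coordVec he j)
  rw [← contMDiffOn_iff_contDiffOn]
  intro y hy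
  have h3 := h2 y hy
  rw [Bundle.contMDiffWithinAt_totalSpace] at h3
  exact h3.2

end Manifold

section Manifold

variable {M : Type*} [TopologicalSpace M] [ChartedSpace (Coord n) M]
  {e e' : OpenPartialHomeomorph M (Coord n)}

lemma vecComp_mfderiv_symm (he : e ∈ smoothCharts n M) {y : Coord n} (hy : y ∈ e.target)
    (v : Coord n) : vecComp e (e.symm y) (mfderiv (𝓡 n) (𝓡 n) e.symm y v) = v :=
  DFunLike.congr_fun ((mdifferentiable_of_mem_smoothCharts he).comp_symm_deriv hy) v

lemma mfderiv_symm_vecComp (he : e ∈ smoothCharts n M) {y : Coord n} (hy : y ∈ e.target)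
    (v : TangentSpace (𝓡 n) (e.symm y)) :
    mfderiv (𝓡 n) (𝓡 n) e.symm y (vecComp e (e.symm y) v) = v := by
  have h := DFunLike.congr_fun
    ((mdifferentiable_of_mem_smoothCharts he).symm_comp_deriv (e.map_target hy)) v
  rw [e.right_inv hy] at h
  exact h

lemma mfderiv_symm_eq_sum (y v : Coord n) :
    (mfderiv (𝓡 n) (𝓡 n) e.symm y v : Coord n) = ∑ i, v i • (coordVec e y i : Coord n) := by
  have hv : v = ∑ k, v k • basisVec k := by
    have := (EuclideanSpace.basisFun (Fin n) ℝ).sum_repr v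
    simpa [basisVec] using this.symm
  let L : Coord n →L[ℝ] Coord n := mfderiv (𝓡 n) (𝓡 n) e.symm y
  have : L v = ∑ i, v i • L (basisVec i) := by
    conv_lhs => rw [hv]
    simp [map_sum]
  exact this

lemma contDiffOn_transition (he : e ∈ smoothCharts n M) (he' : e' ∈ smoothCharts n M) :
    ContDiffOn ℝ ∞ (fun z => e' (e.symm z)) (e.target ∩ e.symm ⁻¹' e'.source) := by
  rw [← contMDiffOn_iff_contDiffOn]
  exact (contMDiffOn_of_mem_maximalAtlas he').comp
    ((contMDiffOn_symm_of_mem_maximalAtlas he).mono Set.inter_subset_left) fun z hz => hz.2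

lemma mfderiv_symm_transition (he : e ∈ smoothCharts n M) (he' : e' ∈ smoothCharts n M)
    {z : Coord n} (hz : z ∈ e.target ∩ e.symm ⁻¹' e'.source)
    (v : Coord n) : (mfderiv (𝓡 n) (𝓡 n) e.symm z v : Coord n)
      = mfderiv (𝓡 n) (𝓡 n) e'.symm (e' (e.symm z))
          (fderiv ℝ (fun z => e' (e.symm z)) z v : Coord n) := by
  have hU : IsOpen (e.target ∩ e.symm ⁻¹' e'.source) := e.isOpen_inter_preimage_symm e'.open_source
  have h1 : e.symm =ᶠ[nhds z] e'.symm ∘ fun z => e' (e.symm z) := by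
    filter_upwards [hU.mem_nhds hz] with w hw
    exact (e'.left_inv hw.2).symm
  have d1 : MDifferentiableAt (𝓡 n) (𝓡 n) (fun z => e' (e.symm z)) z :=
    (((contDiffOn_transition he he').contDiffAt (hU.mem_nhds hz)).differentiableAt
      (by simp)).mdifferentiableAt
  have d2 := (mdifferentiable_of_mem_smoothCharts he').mdifferentiableAt_symm
    (e'.map_source hz.2)
  have h2 := h1.mfderiv_eq (I := 𝓡 n) (I' := 𝓡 n)
  rw [mfderiv_comp z d2 d1, mfderiv_eq_fderiv] at h2
  exact DFunLike.congr_fun h2 v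

lemma vecComp_transition (he : e ∈ smoothCharts n M) (he' : e' ∈ smoothCharts n M)
    {z : Coord n} (hz : z ∈ e.target ∩ e.symm ⁻¹' e'.source)
    (v : TangentSpace (𝓡 n) (e.symm z)) :
    vecComp e' (e.symm z) v = fderiv ℝ (fun z => e' (e.symm z)) z (vecComp e (e.symm z) v) := by
  have d1 := (mdifferentiable_of_mem_smoothCharts he).mdifferentiableAt_symm hz.1
  have d2 := (mdifferentiable_of_mem_smoothCharts he').mdifferentiableAt hz.2
  have h2 : mfderiv (𝓡 n) (𝓡 n) (e' ∘ e.symm) z = _ := mfderiv_comp z d2 d1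
  rw [mfderiv_eq_fderiv] at h2
  have h3 := DFunLike.congr_fun h2 (vecComp e (e.symm z) v)
  have h4 := mfderiv_symm_vecComp he hz.1 v
  refine Eq.trans ?_ h3.symm
  exact (congrArg (fun w => mfderiv (𝓡 n) (𝓡 n) e' (e.symm z) w) h4).symm

lemma contMDiffOn_symm_prodMap (he : e ∈ smoothCharts n M) :
    ContMDiffOn 𝓘(ℝ, Coord n × ℝ) ((𝓡 n).prod 𝓘(ℝ, ℝ)) ∞ (fun z : Coord n × ℝ => (e.symm z.1, z.2))
      (e.target ×ˢ Set.univ) :=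
  ((contMDiffOn_symm_of_mem_maximalAtlas he).comp
    (contDiff_fst.contMDiff.contMDiffOn (s := e.target ×ˢ Set.univ)) fun _ hz => hz.1).prodMk
    contDiff_snd.contMDiff.contMDiffOn

lemma contDiffOn_comp_symm {f : M → ℝ} (hf : ContMDiff (𝓡 n) 𝓘(ℝ, ℝ) ∞ f)
    (he : e ∈ smoothCharts n M) : ContDiffOn ℝ ∞ (f ∘ e.symm) e.target := by
  rw [← contMDiffOn_iff_contDiffOn]
  exact hf.comp_contMDiffOn (contMDiffOn_symm_of_mem_maximalAtlas he)

variable [IsManifold (𝓡 n) ∞ M]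

lemma isMetricOn_comp (g : PseudoRiemannianMetric n M) (he : e ∈ smoothCharts n M) :
    IsMetricOn (g.comp e) e.target := by
  refine ⟨e.open_target, contDiffOn_comp g he, fun y _ => ?_, fun y hy hdet => ?_⟩
  · ext i j; exact g.symm _ _ _
  · obtain ⟨v, hv0, hv⟩ := Matrix.exists_mulVec_eq_zero_iff.2 hdet
    let B : Coord n →L[ℝ] Coord n →L[ℝ] ℝ := g.inner (e.symm y)
    let c : Fin n → Coord n := fun i => coordVec e y i
    have hB : ∀ i, B (∑ j, v j • c j) (c i) = 0 := by
      intro i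
      refine Eq.trans ?_ (congrFun hv i)
      rw [map_sum, _root_.sum_apply]
      simp only [Matrix.mulVec, dotProduct, map_smul, _root_.smul_apply, smul_eq_mul]
      exact Finset.sum_congr rfl fun j _ => by
        rw [mul_comm]; exact congrArg (· * v j) (g.symm _ _ _)
    have hw : ∀ w : Coord n, B (∑ j, v j • c j) w = 0 := by
      intro w
      have h1 : w = ∑ i, (vecComp e (e.symm y) w) i • c i :=
        (mfderiv_symm_vecComp he hy w).symm.trans (mfderiv_symm_eq_sum y _)
      rw [h1, map_sum]
      exact Finset.sum_eq_zero fun i _ => by rw [map_smul, hB i, smul_zero]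
    have h0 : (∑ j, v j • c j) = 0 := g.nondegenerate (e.symm y) _ hw
    let v' : Coord n := WithLp.toLp 2 v
    have h1 : (mfderiv (𝓡 n) (𝓡 n) e.symm y v' : Coord n) = 0 :=
      (mfderiv_symm_eq_sum y v').trans h0
    have h2 := vecComp_mfderiv_symm he hy v'
    have h3 : v' = 0 := by
      rw [← h2]
      exact (congrArg (fun w => mfderiv (𝓡 n) (𝓡 n) e (e.symm y) w) h1).trans (map_zero _)
    exact hv0 (congrArg WithLp.ofLp h3)

lemma contDiffOn_ηComp (X : PointGenerator n M) (he : e ∈ smoothCharts n M) :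
    ContDiffOn ℝ ∞ (X.ηComp e) (e.target ×ˢ Set.univ) := by
  rw [← contMDiffOn_iff_contDiffOn]
  exact X.contMDiff_η.comp_contMDiffOn (contMDiffOn_symm_prodMap he)

lemma contDiffOn_ξComp (X : PointGenerator n M) (he : e ∈ smoothCharts n M) (k : Fin n) :
    ContDiffOn ℝ ∞ (fun z => X.ξComp e z k) (e.target ×ˢ Set.univ) := by
  have h1 := (contMDiffOn_of_mem_maximalAtlas he).contMDiffOn_tangentMapWithin (m := ∞)
    (by simp) e.open_source.uniqueMDiffOn
  have h2 := X.contMDiff_ξ.comp_contMDiffOn (contMDiffOn_symm_prodMap he)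
  have h3 := h1.comp h2 fun z hz => e.map_target hz.1
  have h4 := contMDiff_snd_tangentBundle_modelSpace (Coord n) 𝓘(ℝ, Coord n) (n := ∞)
  have h5 : ContMDiffOn 𝓘(ℝ, Coord n × ℝ) 𝓘(ℝ, Coord n) ∞ (X.ξComp e) (e.target ×ˢ Set.univ) := by
    refine (h4.comp_contMDiffOn h3).congr fun z hz => ?_
    exact (DFunLike.congr_fun (mfderivWithin_of_isOpen (I := 𝓡 n) (I' := 𝓡 n) (f := e)
      e.open_source (e.map_target hz.1)) _).symm
  exact (EuclideanSpace.proj (𝕜 := ℝ) k).contDiff.comp_contDiffOn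
    (contMDiffOn_iff_contDiffOn.1 h5)

/-- The conformal Killing equation at a point does not depend on the chart. -/
lemma conformal_of_conformal_chart (g : PseudoRiemannianMetric n M) (X : PointGenerator n M)
    (he : e ∈ smoothCharts n M) (he' : e' ∈ smoothCharts n M) {y : Coord n} (hy : y ∈ e.target)
    (hy' : e.symm y ∈ e'.source) {c : ℝ}
    (h : ∀ i j, lieDerivMetric (g.comp e') (fun z => X.ξComp e' (z, 0)) (e' (e.symm y)) i j
      = 2 * c * g.comp e' (e' (e.symm y)) i j) (i j : Fin n) :
    lieDerivMetric (g.comp e) (fun z => X.ξComp e (z, 0)) y i j = 2 * c * g.comp e y i j := by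
  set φ : Coord n → Coord n := fun z => e' (e.symm z) with hφ
  set U := e.target ∩ e.symm ⁻¹' e'.source with hUdef
  have hU : IsOpen U := e.isOpen_inter_preimage_symm e'.open_source
  have sφ : ContDiffOn ℝ ∞ φ U := contDiffOn_transition he he'
  have hyU : y ∈ U := ⟨hy, hy'⟩
  have hpd : ∀ z ∈ U, ∀ v : Coord n, ∀ a,
      fderiv ℝ (fun x => φ x a) z v = (fderiv ℝ φ z v) a := by
    intro z hz v a
    have h2 : HasFDerivAt (fun z => φ z a) ((EuclideanSpace.proj a).comp (fderiv ℝ φ z)) z :=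
      (EuclideanSpace.proj (𝕜 := ℝ) a).hasFDerivAt.comp z
        (differentiableAt_of_contDiffOn sφ hU hz).hasFDerivAt
    rw [h2.fderiv]; rfl
  have hG : ∀ z ∈ U, ∀ i j, g.comp e z i j = ∑ a, ∑ b, g.comp e' (φ z) a b *
      (pd i (fun x => φ x a) z * pd j (fun x => φ x b) z) := by
    intro z hz i j
    have hx : e'.symm (φ z) = e.symm z := e'.left_inv hz.2
    let B : M → Coord n →L[ℝ] Coord n →L[ℝ] ℝ := fun x => g.inner x
    let c' : Fin n → Coord n := fun a => coordVec e' (φ z) a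
    have hc : ∀ i, (coordVec e z i : Coord n) = ∑ a, pd i (fun x => φ x a) z • c' a := by
      intro i
      refine (mfderiv_symm_transition he he' hz (basisVec i)).trans
        ((mfderiv_symm_eq_sum (φ z) _).trans ?_)
      exact Finset.sum_congr rfl fun a _ => by rw [pd, hpd z hz]; rfl
    have h1 : g.comp e z i j = B (e.symm z) (coordVec e z i : Coord n) (coordVec e z j : Coord n) :=
      rfl
    have h2 : ∀ a b, g.comp e' (φ z) a b = B (e.symm z) (c' a) (c' b) := fun a b => by
      rw [← hx]; rfl
    rw [h1, hc, hc]
    simp only [h2, map_sum, _root_.sum_apply, map_smul, _root_.smul_apply, smul_eq_mul,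
      Finset.mul_sum]
    rw [Finset.sum_comm]
    exact Finset.sum_congr rfl fun a _ => Finset.sum_congr rfl fun b _ => by ring
  have hζ : ∀ z ∈ U, ∀ a, X.ξComp e' (φ z, 0) a
      = ∑ k, X.ξComp e (z, 0) k * pd k (fun x => φ x a) z := by
    intro z hz a
    have hx : e'.symm (φ z) = e.symm z := e'.left_inv hz.2
    let F : M → Coord n := fun x => vecComp e' x (X.ξ x 0)
    have hF : X.ξComp e' (φ z, 0) = F (e.symm z) := congrArg F hx
    rw [← fderiv_eq_sum_pd, hpd z hz, hF]
    exact congrArg (fun w : Coord n => w a) (vecComp_transition he he' hz _)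
  have hG' := isMetricOn_comp g he'
  have hφy : φ y ∈ e'.target := e'.map_source hy'
  have h' : ∀ a b, lieDerivMetric (g.comp e') (fun z => X.ξComp e' (z, 0)) (φ y) a b
      = 2 * c * g.comp e' (φ y) a b := h
  rw [lieDerivMetric_comp hU sφ hyU hG hζ
    (fun a b => differentiableAt_of_contDiffOn (hG'.smooth a b) e'.open_target hφy)
    (fun a => differentiableAt_of_contDiffOn (smooth_slice (contDiffOn_ξComp X he' a) 0)
      e'.open_target hφy)
    (fun a => differentiableAt_of_contDiffOn (smooth_slice (contDiffOn_ξComp X he a) 0)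
      e.open_target hy), hG y hyU]
  simp only [Finset.mul_sum, h']
  exact Finset.sum_congr rfl fun a _ => Finset.sum_congr rfl fun b _ => by ring

end Manifold

/-! ### From the charts to the manifold -/

section Manifold

variable {M : Type*} [TopologicalSpace M] [ChartedSpace (Coord n) M] [IsManifold (𝓡 n) ∞ M]
  {g : PseudoRiemannianMetric n M} {V : M → ℝ} {X : PointGenerator n M}

/-- The conformal factor in the coordinates of a chart, as a function on the coordinate space. -/
def chartFactor (g : PseudoRiemannianMetric n M) (X : PointGenerator n M)
    (e : OpenPartialHomeomorph M (Coord n)) : Coord n → ℝ :=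
  confFactor (g.comp e) fun z => X.ξComp e (z, 0)

/-- The conformal factor as a function on the manifold, computed at each point in the preferred
chart. -/
def conformalFactor (g : PseudoRiemannianMetric n M) (X : PointGenerator n M) (x : M) : ℝ :=
  chartFactor g X (chartAt (Coord n) x) (chartAt (Coord n) x x)

lemma chartAt_mem_smoothCharts (x : M) : chartAt (Coord n) x ∈ smoothCharts n M :=
  IsManifold.chart_mem_maximalAtlas x

/-- A generator which has the conformal form in every chart is a conformal generator.  Only the
additive constant `a₀` needs connectedness. -/
lemma exists_isConformalGenerator [ConnectedSpace M] (hn : n ≠ 0)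
    (H : ∀ e ∈ smoothCharts n M, ∃ σ, IsConformalOn (g.comp e) (V ∘ e.symm) (X.ξComp e) (X.ηComp e)
      e.target (chartFactor g X e) σ fun y => X.ηComp e (y, 0)) :
    ∃ a₀ : ℝ, (∀ x, X.η x 1 - X.η x 0 - (2 - (n : ℝ)) / 2 * conformalFactor g X x = a₀) ∧
      IsConformalGenerator g V X (conformalFactor g X) a₀ fun x => X.η x 0 := by
  set ψ := conformalFactor g X with hψ
  have hψe : ∀ e ∈ smoothCharts n M, ∀ y ∈ e.target, ψ (e.symm y) = chartFactor g X e y := by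
    intro e he y hy
    have he' := chartAt_mem_smoothCharts (n := n) (e.symm y)
    have hy' := mem_chart_source (Coord n) (e.symm y)
    obtain ⟨σ, hσ⟩ := H _ he'
    exact (isMetricOn_comp g he).eq_confFactor hn hy (conformal_of_conformal_chart g X he he' hy hy'
      (hσ.conformal _ ((chartAt (Coord n) (e.symm y)).map_source hy')))
  have sψ : ContMDiff (𝓡 n) 𝓘(ℝ, ℝ) ∞ ψ := by
    intro x
    set e := chartAt (Coord n) x
    have he : e ∈ smoothCharts n M := chartAt_mem_smoothCharts x
    have hx : x ∈ e.source := mem_chart_source (Coord n) x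
    obtain ⟨σ, hσ⟩ := H e he
    have h1 := (hσ.smooth_ψ.contMDiffOn.comp (contMDiffOn_of_mem_maximalAtlas he)
      fun z hz => e.map_source hz).contMDiffAt (e.open_source.mem_nhds hx)
    refine h1.congr_of_eventuallyEq ?_
    filter_upwards [e.open_source.mem_nhds hx] with z hz
    rw [Function.comp_apply, ← hψe e he _ (e.map_source hz), e.left_inv hz]
  have sη : ∀ u, ContMDiff (𝓡 n) 𝓘(ℝ, ℝ) ∞ fun x => X.η x u := fun u =>
    X.contMDiff_η.comp (contMDiff_id.prodMk contMDiff_const)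
  -- `a₀ = σ - (2 - n) / 2 ψ` has vanishing differential, hence is locally constant
  set f : M → ℝ := fun x => X.η x 1 - X.η x 0 - (2 - (n : ℝ)) / 2 * ψ x with hf
  have hfe : ∀ e ∈ smoothCharts n M, ∀ σ, IsConformalOn (g.comp e) (V ∘ e.symm) (X.ξComp e)
      (X.ηComp e) e.target (chartFactor g X e) σ (fun y => X.ηComp e (y, 0)) → ∀ y ∈ e.target,
      f (e.symm y) = σ y - (2 - (n : ℝ)) / 2 * chartFactor g X e y := by
    intro e he σ hσ y hy
    have h1 := hσ.η_eq y hy 1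
    simp only [hf, hψe e he y hy]
    simp only [PointGenerator.ηComp] at h1
    linarith
  have hloc : IsLocallyConstant f := by
    rw [IsLocallyConstant.iff_eventually_eq]
    intro x
    set e := chartAt (Coord n) x
    have he : e ∈ smoothCharts n M := chartAt_mem_smoothCharts x
    have hx : x ∈ e.source := mem_chart_source (Coord n) x
    obtain ⟨σ, hσ⟩ := H e he
    obtain ⟨r, hr, hball⟩ := Metric.isOpen_iff.1 e.open_target _ (e.map_source hx)
    set k : Coord n → ℝ := fun y => σ y - (2 - (n : ℝ)) / 2 * chartFactor g X e y with hk
    have sk : ∀ y ∈ e.target, DifferentiableAt ℝ σ y ∧ DifferentiableAt ℝ (chartFactor g X e) y :=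
      fun y hy => ⟨differentiableAt_of_contDiffOn hσ.smooth_σ e.open_target hy,
        differentiableAt_of_contDiffOn hσ.smooth_ψ e.open_target hy⟩
    have dk : DifferentiableOn ℝ k (Metric.ball (e x) r) := fun y hy =>
      ((sk y (hball hy)).1.fun_sub
        ((sk y (hball hy)).2.const_mul _)).differentiableWithinAt
    have zk : Set.EqOn (fderiv ℝ k) 0 (Metric.ball (e x) r) := by
      intro y hy
      ext v
      obtain ⟨h1, h2⟩ := sk y (hball hy)
      rw [fderiv_eq_sum_pd]
      refine Finset.sum_eq_zero fun i _ => ?_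
      rw [hk, pd_sub h1 (h2.const_mul _), pd_const_mul h2, hσ.grad y (hball hy) i, sub_self,
        mul_zero]
    have hconst : ∀ y ∈ Metric.ball (e x) r, k y = k (e x) := fun y hy =>
      Metric.isOpen_ball.is_const_of_fderiv_eq_zero (convex_ball _ _).isPreconnected dk zk hy
        (Metric.mem_ball_self hr)
    have hc : ContinuousAt e x := e.continuousAt hx
    filter_upwards [e.open_source.mem_nhds hx, hc (Metric.ball_mem_nhds _ hr)] with z hz hzr
    have h1 := hfe e he σ hσ _ (e.map_source hz)
    have h2 := hfe e he σ hσ _ (e.map_source hx)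
    rw [e.left_inv hz] at h1
    rw [e.left_inv hx] at h2
    rw [h1, h2]
    exact hconst _ hzr
  obtain ⟨x₀⟩ : Nonempty M := inferInstance
  have hfc : ∀ x, f x = f x₀ := fun x => hloc.apply_eq_of_isPreconnected isPreconnected_univ
    (Set.mem_univ _) (Set.mem_univ _)
  have hη : ∀ x u, X.η x u = (X.η x 1 - X.η x 0) * u + X.η x 0 := by
    intro x u
    have he := chartAt_mem_smoothCharts (n := n) x
    set e := chartAt (Coord n) x
    have hx : x ∈ e.source := mem_chart_source (Coord n) x
    obtain ⟨σ, hσ⟩ := H e he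
    have h1 := hσ.η_eq _ (e.map_source hx) 1
    have h2 := hσ.η_eq _ (e.map_source hx) u
    simp only [PointGenerator.ηComp, e.left_inv hx] at h1 h2
    rw [h2, h1]
    ring
  refine ⟨f x₀, hfc, sψ, sη 0, fun x u => ?_, fun e he y hy i j => ?_, fun x u => ?_,
    fun e he y hy => ?_, fun e he y hy => ?_⟩
  · have he := chartAt_mem_smoothCharts (n := n) x
    set e := chartAt (Coord n) x
    have hx : x ∈ e.source := mem_chart_source (Coord n) x
    obtain ⟨σ, hσ⟩ := H e he
    have h1 := hσ.ξ_indep _ (e.map_source hx) u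
    change (fun z => vecComp e z (X.ξ z u)) (e.symm (e x))
      = (fun z => vecComp e z (X.ξ z 0)) (e.symm (e x)) at h1
    rw [e.left_inv hx] at h1
    exact (mdifferentiable_of_mem_smoothCharts he).mfderiv_injective hx h1
  · obtain ⟨σ, hσ⟩ := H e he
    rw [hψe e he y hy]
    exact hσ.conformal y hy i j
  · have h1 := hfc x
    rw [hη x u, ← h1]
    simp only [hf]
    ring
  · obtain ⟨σ, hσ⟩ := H e he
    exact hσ.solution y hy
  · obtain ⟨σ, hσ⟩ := H e he
    rw [hψe e he y hy]
    have h1 := hσ.constraint y hy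
    have h2 : laplacian (g.comp e) (ψ ∘ e.symm) y = laplacian (g.comp e) (chartFactor g X e) y := by
      have := laplacian_congr_grad (G := g.comp e) (f := ψ ∘ e.symm) (g := chartFactor g X e)
        (c := 1) e.open_target (fun z hz i => by
          rw [one_mul]; exact pd_congr_on e.open_target (hψe e he) hz i) hy
        (isMetricOn_comp g he) hσ.smooth_ψ (contDiffOn_comp_symm sψ he)
      rwa [one_mul] at this
    rw [h2]
    exact h1

lemma IsConformalGenerator.isConformalOn {ψ b : M → ℝ} {a₀ : ℝ}
    (hC : IsConformalGenerator g V X ψ a₀ b) {e : OpenPartialHomeomorph M (Coord n)}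
    (he : e ∈ smoothCharts n M) : IsConformalOn (g.comp e) (V ∘ e.symm) (X.ξComp e) (X.ηComp e)
      e.target (ψ ∘ e.symm) (fun y => (2 - (n : ℝ)) / 2 * ψ (e.symm y) + a₀) (b ∘ e.symm) := by
  have sψ := contDiffOn_comp_symm hC.smooth_ψ he
  refine ⟨sψ, (contDiffOn_const.mul sψ).add contDiffOn_const, contDiffOn_comp_symm hC.smooth_b he,
    fun y _ u => ?_, hC.conformal e he, fun y _ u => ?_, fun y hy i => ?_, hC.solution e he,
    hC.constraint e he⟩
  · exact congrArg (vecComp e (e.symm y)) (hC.ξ_indep (e.symm y) u)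
  · simp only [PointGenerator.ηComp, hC.η_eq, Function.comp_apply]
    ring
  · have d := differentiableAt_of_contDiffOn sψ e.open_target hy
    have h1 := pd_add (d.const_mul ((2 - (n : ℝ)) / 2)) (differentiableAt_const a₀) i
    rw [pd_const_mul d] at h1
    refine h1.trans ?_
    simp [pd]

lemma isLieSymmetry_iff [ConnectedSpace M] (hn : 2 ≤ n) (hV : ContMDiff (𝓡 n) 𝓘(ℝ, ℝ) ∞ V) :
    IsLieSymmetry g V X ↔ ∃ (ψ : M → ℝ) (a₀ : ℝ) (b : M → ℝ),
      IsConformalGenerator g V X ψ a₀ b := by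
  constructor
  · intro h
    obtain ⟨a₀, -, h1⟩ := exists_isConformalGenerator (g := g) (V := V) (X := X) (by omega)
      fun e he => ⟨_, IsLieSymmetryOn.isConformalOn (h e he) (isMetricOn_comp g he) hn
        (contDiffOn_comp_symm hV he) (contDiffOn_ξComp X he) (contDiffOn_ηComp X he)⟩
    exact ⟨_, _, _, h1⟩
  · rintro ⟨ψ, a₀, b, hC⟩ e he
    exact (hC.isConformalOn he).isLieSymmetryOn (isMetricOn_comp g he) (contDiffOn_comp_symm hV he)
      (contDiffOn_ξComp X he)

lemma isGauge_iff {e : OpenPartialHomeomorph M (Coord n)} {A : Coord n × ℝ → Fin n → ℝ} :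
    IsGauge g V X e A ↔ (∀ i, ContDiffOn ℝ ∞ (fun z => A z i) (e.target ×ˢ Set.univ)) ∧
      IsGaugeOn (g.comp e) (V ∘ e.symm) (X.ξComp e) (X.ηComp e) e.target A :=
  ⟨fun h => ⟨contDiffOn_pi.1 h.smooth, h.noether⟩, fun h => ⟨contDiffOn_pi.2 h.1, h.2⟩⟩

lemma IsNoetherSymmetry.exists_isConformalGenerator [ConnectedSpace M] (hn : n ≠ 0)
    (hV : ContMDiff (𝓡 n) 𝓘(ℝ, ℝ) ∞ V) (h : IsNoetherSymmetry g V X) :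
    ∃ (ψ b : M → ℝ), IsConformalGenerator g V X ψ 0 b := by
  have H : ∀ e ∈ smoothCharts n M, IsConformalOn (g.comp e) (V ∘ e.symm) (X.ξComp e) (X.ηComp e)
      e.target (chartFactor g X e) (fun y => (2 - (n : ℝ)) / 2 * chartFactor g X e y)
      fun y => X.ηComp e (y, 0) := by
    intro e he
    obtain ⟨A, hA⟩ := h e he
    exact (isGauge_iff.1 hA).2.isConformalOn (isMetricOn_comp g he) hn (contDiffOn_comp_symm hV he)
      (contDiffOn_ξComp X he) (contDiffOn_ηComp X he) (isGauge_iff.1 hA).1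
  obtain ⟨a₀, ha, h1⟩ := KleinGordon.exists_isConformalGenerator hn fun e he => ⟨_, H e he⟩
  obtain ⟨x⟩ : Nonempty M := inferInstance
  have he := chartAt_mem_smoothCharts (n := n) x
  have hx := mem_chart_source (Coord n) x
  have h2 := (H _ he).η_eq _ ((chartAt (Coord n) x).map_source hx) 1
  simp only [PointGenerator.ηComp, (chartAt (Coord n) x).left_inv hx] at h2
  have h3 : a₀ = 0 := by
    rw [← ha x, h2, conformalFactor]
    ring
  exact ⟨_, _, h3 ▸ h1⟩

/-- The gauge functions of a conformal generator with `a₀ = 0`. -/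
lemma IsConformalGenerator.isGauge_iff_exists (hV : ContMDiff (𝓡 n) 𝓘(ℝ, ℝ) ∞ V) {ψ b : M → ℝ}
    (hC : IsConformalGenerator g V X ψ 0 b) {e : OpenPartialHomeomorph M (Coord n)}
    (he : e ∈ smoothCharts n M) (A : Coord n × ℝ → Fin n → ℝ) :
    IsGauge g V X e A ↔ ∃ Φ : Coord n → Fin n → ℝ, ContDiffOn ℝ ∞ Φ e.target ∧
      (∀ y ∈ e.target, ∑ i, pd i (fun z => Φ z i) y = 0) ∧
      ∀ y ∈ e.target, ∀ (u : ℝ) (i : Fin n), ∑ j, g.comp e y i j * A (y, u) j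
        = (2 - (n : ℝ)) / 4 * sqrtDet (g.comp e) y * pd i (ψ ∘ e.symm) y * u ^ 2
          + sqrtDet (g.comp e) y * pd i (b ∘ e.symm) y * u + ∑ j, g.comp e y i j * Φ y j := by
  have hG := isMetricOn_comp g he
  have hU := e.open_target
  have hW := contDiffOn_comp_symm hV he
  have hξ := contDiffOn_ξComp X he
  have hL := hC.isConformalOn he
  set σ : Coord n → ℝ := fun y => (2 - (n : ℝ)) / 2 * ψ (e.symm y) + 0 with hσ
  have hσψ : ∀ y ∈ e.target, σ y = (2 - (n : ℝ)) / 2 * (ψ ∘ e.symm) y := fun y _ => add_zero _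
  -- raising and lowering of the index
  have hlow : ∀ y ∈ e.target, ∀ (u : ℝ) (Φ : Fin n → ℝ) (i : Fin n), ∑ j, g.comp e y i j *
      (1 / 2 * gradDensity (g.comp e) σ j y * u ^ 2 + gradDensity (g.comp e) (b ∘ e.symm) j y * u
        + Φ j) = (2 - (n : ℝ)) / 4 * sqrtDet (g.comp e) y * pd i (ψ ∘ e.symm) y * u ^ 2
          + sqrtDet (g.comp e) y * pd i (b ∘ e.symm) y * u + ∑ j, g.comp e y i j * Φ j := by
    intro y hy u Φ i
    have l : ∀ j, g.comp e y i j * (1 / 2 * gradDensity (g.comp e) σ j y * u ^ 2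
        + gradDensity (g.comp e) (b ∘ e.symm) j y * u + Φ j)
        = 1 / 2 * u ^ 2 * (g.comp e y i j * gradDensity (g.comp e) σ j y)
          + u * (g.comp e y i j * gradDensity (g.comp e) (b ∘ e.symm) j y)
          + g.comp e y i j * Φ j := fun j => by ring
    rw [Finset.sum_congr rfl fun j _ => l j, Finset.sum_add_distrib, Finset.sum_add_distrib,
      ← Finset.mul_sum, ← Finset.mul_sum, hG.sum_mul_gradDensity _ hy, hG.sum_mul_gradDensity _ hy,
      hL.grad y hy i]
    ring
  rw [isGauge_iff]
  constructor
  · rintro ⟨sA, hA⟩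
    obtain ⟨h1, h2⟩ := (hL.isGaugeOn_iff hσψ hG hW hξ sA).1 hA
    refine ⟨fun y => A (y, 0), contDiffOn_pi.2 fun i => smooth_slice (sA i) 0, h2,
      fun y hy u i => ?_⟩
    rw [← hlow y hy u]
    exact Finset.sum_congr rfl fun j _ => by rw [h1 y hy u j]
  · rintro ⟨Φ, sΦ, hdiv, hΦ⟩
    have hA : ∀ y ∈ e.target, ∀ u i, A (y, u) i = 1 / 2 * gradDensity (g.comp e) σ i y * u ^ 2
        + gradDensity (g.comp e) (b ∘ e.symm) i y * u + Φ y i := by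
      intro y hy u i
      exact congrFun (hG.eq_of_lower hy (v := A (y, u)) (w := fun j =>
        1 / 2 * gradDensity (g.comp e) σ j y * u ^ 2
          + gradDensity (g.comp e) (b ∘ e.symm) j y * u + Φ y j)
        fun i => by rw [hΦ y hy u i, hlow y hy u]) i
    have hA0 : ∀ y ∈ e.target, ∀ i, A (y, 0) i = Φ y i := fun y hy i => by
      rw [hA y hy 0 i]; ring
    have sfst : ∀ {f : Coord n → ℝ}, ContDiffOn ℝ ∞ f e.target →
        ContDiffOn ℝ ∞ (fun z : Coord n × ℝ => f z.1) (e.target ×ˢ Set.univ) := fun hf =>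
      hf.comp contDiffOn_fst fun _ hz => hz.1
    have sA : ∀ i, ContDiffOn ℝ ∞ (fun z => A z i) (e.target ×ˢ Set.univ) := by
      intro i
      refine ContDiffOn.congr ?_ fun z hz => hA z.1 hz.1 z.2 i
      exact (((contDiffOn_const.mul (sfst (hG.smooth_gradDensity hL.smooth_σ i))).mul
        (contDiffOn_snd.pow 2)).add
        ((sfst (hG.smooth_gradDensity hL.smooth_b i)).mul contDiffOn_snd)).add
        (sfst (contDiffOn_pi.1 sΦ i))
    refine ⟨sA, (hL.isGaugeOn_iff hσψ hG hW hξ sA).2 ⟨fun y hy u i => ?_, fun y hy => ?_⟩⟩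
    · rw [hA0 y hy, hA y hy]
    · refine Eq.trans ?_ (hdiv y hy)
      exact Finset.sum_congr rfl fun i _ => pd_congr_on hU (fun z hz => hA0 z hz i) hy i

lemma IsConformalGenerator.isNoetherSymmetry (hV : ContMDiff (𝓡 n) 𝓘(ℝ, ℝ) ∞ V) {ψ b : M → ℝ}
    (hC : IsConformalGenerator g V X ψ 0 b) : IsNoetherSymmetry g V X := by
  intro e he
  have hG := isMetricOn_comp g he
  refine ⟨fun z j => 1 / 2 * gradDensity (g.comp e) (fun y => (2 - (n : ℝ)) / 2 * ψ (e.symm y) + 0)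
    j z.1 * z.2 ^ 2 + gradDensity (g.comp e) (b ∘ e.symm) j z.1 * z.2, ?_⟩
  have hL := hC.isConformalOn he
  have sfst : ∀ {f : Coord n → ℝ}, ContDiffOn ℝ ∞ f e.target →
      ContDiffOn ℝ ∞ (fun z : Coord n × ℝ => f z.1) (e.target ×ˢ Set.univ) := fun hf =>
    hf.comp contDiffOn_fst fun _ hz => hz.1
  have sA := fun i => ((contDiffOn_const (c := (1 / 2 : ℝ)).mul
    (sfst (hG.smooth_gradDensity hL.smooth_σ i))).mul (contDiffOn_snd.pow 2)).add
      ((sfst (hG.smooth_gradDensity hL.smooth_b i)).mul contDiffOn_snd)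
  refine isGauge_iff.2 ⟨sA, (hL.isGaugeOn_iff (fun y _ => add_zero _) hG
    (contDiffOn_comp_symm hV he) (contDiffOn_ξComp X he) sA).2 ⟨fun y _ u i => ?_, fun y _ => ?_⟩⟩
  · ring
  · simp [pd]

/-- The constant `a₀` is determined by the generator. -/
lemma IsConformalGenerator.const_unique [Nonempty M] (hn : n ≠ 0) {ψ b ψ' b' : M → ℝ} {a₀ a₀' : ℝ}
    (h : IsConformalGenerator g V X ψ a₀ b) (h' : IsConformalGenerator g V X ψ' a₀' b') :
    a₀ = a₀' := by
  obtain ⟨x⟩ : Nonempty M := inferInstance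
  have he := chartAt_mem_smoothCharts (n := n) x
  set e := chartAt (Coord n) x
  have hx : x ∈ e.source := mem_chart_source (Coord n) x
  have hG := isMetricOn_comp g he
  have h1 := hG.eq_confFactor hn (e.map_source hx) (h.conformal e he _ (e.map_source hx))
  have h2 := hG.eq_confFactor hn (e.map_source hx) (h'.conformal e he _ (e.map_source hx))
  rw [e.left_inv hx] at h1 h2
  have h3 : ψ x = ψ' x := h1.trans h2.symm
  have e0 := (h.η_eq x 0).symm.trans (h'.η_eq x 0)
  have e1 := (h.η_eq x 1).symm.trans (h'.η_eq x 1)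
  rw [h3] at e0 e1
  linarith

end Manifold

end KleinGordon

end

theorem theorem3 (n : ℕ) (hn : 2 ≤ n) (M : Type*) [TopologicalSpace M] [ConnectedSpace M]
    [ChartedSpace (KleinGordon.Coord n) M] [IsManifold (𝓡 n) ∞ M]
    (g : KleinGordon.PseudoRiemannianMetric n M)
    (V : M → ℝ) (hV : ContMDiff (𝓡 n) 𝓘(ℝ, ℝ) ∞ V)
    (X : KleinGordon.PointGenerator n M) :
    -- the Lie point symmetries are generated by the conformal Killing vectors
    (KleinGordon.IsLieSymmetry g V X ↔
      ∃ (ψ : M → ℝ) (a₀ : ℝ) (b : M → ℝ), KleinGordon.IsConformalGenerator g V X ψ a₀ b) ∧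
    -- the Noether point symmetries are the Lie point symmetries with `a₀ = 0`
    (KleinGordon.IsNoetherSymmetry g V X ↔
      KleinGordon.IsLieSymmetry g V X ∧
        ∃ (ψ : M → ℝ) (b : M → ℝ), KleinGordon.IsConformalGenerator g V X ψ 0 b) ∧
    (∀ (ψ : M → ℝ) (a₀ : ℝ) (b : M → ℝ), KleinGordon.IsConformalGenerator g V X ψ a₀ b →
      (KleinGordon.IsNoetherSymmetry g V X ↔ a₀ = 0)) ∧
    -- their gauge functions, in any coordinate system
    (∀ (ψ : M → ℝ) (b : M → ℝ), KleinGordon.IsConformalGenerator g V X ψ 0 b →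
      ∀ e ∈ KleinGordon.smoothCharts n M, ∀ A : KleinGordon.Coord n × ℝ → Fin n → ℝ,
        KleinGordon.IsGauge g V X e A ↔
          ∃ Φ : KleinGordon.Coord n → Fin n → ℝ,
            ContDiffOn ℝ ∞ Φ e.target ∧
            (∀ y ∈ e.target, ∑ i, KleinGordon.pd i (fun z => Φ z i) y = 0) ∧
            ∀ y ∈ e.target, ∀ (u : ℝ) (i : Fin n),
              ∑ j, g.comp e y i j * A (y, u) j
                = (2 - (n : ℝ)) / 4 * KleinGordon.sqrtDet (g.comp e) y
                      * KleinGordon.pd i (ψ ∘ e.symm) y * u ^ 2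
                  + KleinGordon.sqrtDet (g.comp e) y * KleinGordon.pd i (b ∘ e.symm) y * u
                  + ∑ j, g.comp e y i j * Φ y j) := by
  have hn0 : n ≠ 0 := by omega
  have hLie := KleinGordon.isLieSymmetry_iff (g := g) (X := X) hn hV
  refine ⟨hLie, ⟨fun h => ?_, fun ⟨_, _, _, h⟩ => h.isNoetherSymmetry hV⟩,
    fun ψ a₀ b hC => ⟨fun h => ?_, fun ha => ?_⟩,
    fun ψ b hC e he A => hC.isGauge_iff_exists hV he A⟩
  · obtain ⟨ψ, b, hC⟩ := h.exists_isConformalGenerator hn0 hV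
    exact ⟨hLie.2 ⟨ψ, 0, b, hC⟩, ψ, b, hC⟩
  · obtain ⟨ψ', b', hC'⟩ := h.exists_isConformalGenerator hn0 hV
    exact hC.const_unique hn0 hC'
  · subst ha
    exact hC.isNoetherSymmetry hV
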